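/- Let $0<q<1$, $\Delta=\tfrac12(q+q^{-1})$, $\eta=-\log q$, $[n]_{q^2}!=\prod_{i=1}^n\frac{1-q^{2i}}{1-q^2}$ and $\binom{n}{k}_{q^2}=\frac{[n]_{q^2}!}{[k]_{q^2}!\,[n-k]_{q^2}!}$. Scalar products are conjugate-linear in the first argument. **Finite chain.** Let $\Omega^{(N)}(x_1,\dots,x_m)$ be the orthonormal basis of $(\mathbb C^2)^{\otimes N}$ with down spins at the sites $x_1<\dots<x_m$ of $\{-\frac N2+\frac12,\dots,\frac N2-\frac12\}$. Put $K^s=(q^{s\sigma^3})^{\otimes N}$ and $F=\sum_y q^{\sigma^3}\otimes\dots\otimes q^{\sigma^3}\otimes\sigma^-_y\otimes 1\otimes\dots\otimes 1$. Put $B(a,b)=(1-2\Delta b+ab)(1-2\Delta a^{-1}+ba^{-1})$ and $\beta(z)=(1-qz^{-1})z^{(N+1)/2}$, and $$B^{(N)}(\mathbf z)=\sum_{x_1<\dots<x_m}\lambda^{(N)}(\mathbf x|\mathbf z)\,\Omega^{(N)}(\mathbf x),\qquad \lambda^{(N)}(\mathbf x|\mathbf z)=\sum_w\epsilon_w\prod_i\beta(v_i^{-1})v_i^{x_i}\prod_{i<l}B(v_i^{-1},v_l)v_l^{-1},\quad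 \mathbf v=w\mathbf z,$$ where $w$ runs over the permutations and reflections $z_i\mapsto z_i^{-1}$ and $\epsilon_w=\pm1$ is the sign of the permutation times $(-1)^{\text{number of reflections}}$. Call $\mathbf z$ a Bethe solution for $N$ if $|z_j|=1$ and $z_j^{2N}=\prod_{l\ne j}B(z_j^{-1},z_l)/B(z_j,z_l)$ for all $j$. Put $B^{(N)}_p(\mathbf z)=\frac{q^{\binom p2}}{[p]_{q^2}!}K^{-p/2}F^pB^{(N)}(\mathbf z)$. Then for all Bethe solutions $\mathbf z',\mathbf z$ for $N$ (with any numbers $m',m$ of components) and all $p,p'\ge0$ $$(B^{(N)}_{p'}(\mathbf z'),B^{(N)}_p(\mathbf z))=\delta_{p,p'}\frac{q^{2p^2}}{[p]_{q^2}!}\Big(B^{(N)}(\mathbf z'),K^{-p}\prod_{k=1}^p\frac{1-K^2q^{-2p+2k}}{1-q^2}B^{(N)}(\mathbf z)\Big),$$ and, if $N=2(p+m)$ with $m$ the number of components of $\mathbf z$, $$(B^{(N)}_{p}(\mathbf z'),B^{(N)}_{p'}(\mathbf z))=\delta_{p,p'}\,(B^{(N)}(\mathbf z'),B^{(N)}(\mathbf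 z))\binom{2p}{p}_{q^2}.$$ Moreover the product $\prod_{k\ge1}\frac1{1-q^{2k}}$ converges and $\lim_{p\to\infty}\binom{2p}p_{q^2}=\prod_{k\ge1}\frac1{1-q^{2k}}$. **Infinite chain.** For $\mathbf z\in(\mathbb C^*)^m$ put $A(\mathbf z)=\prod_{i<j}(1-2\Delta z_i+z_iz_j)$ and $\lambda(\mathbf x|\mathbf z)=\sum_{\pi\in S_m}\epsilon_\pi A(\mathbf z_\pi)\mathbf z_\pi^{\mathbf x}$. Label the sites by $\mathbb Z$. The primary Bethe state is $B(\mathbf z)=\sum_{x_1<\dots<x_m}\lambda(\mathbf x|\mathbf z)\,\Omega(\mathbf x)$, where the $\Omega(\mathbf x)$ form an orthonormal basis labelled by the finite subsets of $\mathbb Z$. The domain wall (DW) state is $$B_\infty(\mathbf z)=q^{\binom{m+1}2}\sum_\delta q^{|\delta|}\sum_{1\le l_1<\dots<l_m<\infty}\frac{\lambda(\delta_{l_m}-l_m,\dots,\delta_{l_1}-l_1|\mathbf z)}{q^{\sum_a(\delta_{l_a}+l_a)}}\,\Omega_{DW}(\delta),$$ where $\delta$ runs over all integer partitions, the $\Omega_{DW}(\delta)$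 are orthonormal, and each geometric series beyond the number of parts $r$ of $\delta$ is given the value $\sum_{l>r}w^{-l}:=-w^{-r}/(1-w)$ (nested series are evaluated successively, from $l_m$ to $l_1$). The parameters $\mathbf z$ of the spectrum are composed of $k\ge0$ groups (single magnons and bound states), the $i$-th with $n_i\ge1$ magnons and rapidity $\beta_i\in\mathbb R$, given by $$z_j=\frac{\sinh(\mathrm i\beta_i+(\frac{n_i}2-j+1)\eta)}{\sinh(\mathrm i\beta_i+(\frac{n_i}2-j)\eta)},\qquad j=1,\dots,n_i .$$ Write $\mathbf z(\beta)$ for these parameters. The states belong to the continuous spectrum, so their scalar products are understood in the sense of distributions. For a smooth compactly supported $f:\mathbb R^k\to\mathbb C$ whose support avoids $\sin\beta_i=0$ for every $i$ with $n_i$ even (where some $z_j$ is infinite), put $B[f]=\int f(\beta)B(\mathbf z(\beta))\,d\beta$ and $B_\infty[f]=\int f(\beta)B_\infty(\mathbf z(\beta))\,d\beta$, coefficient by coefficient. Then these integrals converge absolutely, the vectors $B[f]$ and $B_\infty[f]$ are square summable, and for any two such families $(n_i)_{i\le k}$, $(n'_i)_{i\le k'}$ and functions $f,f'$ $$(B_\infty[f'],B_\infty[f])=(B[f'],B[f])\prod_{k=1}^\infty\frac1{1-q^{2k}}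 ,$$ i.e. $(B_\infty(\mathbf z'),B_\infty(\mathbf z))=(B(\mathbf z'),B(\mathbf z))\prod_{k\ge1}\frac1{1-q^{2k}}$ as distributions. -/

import Mathlib

noncomputable section

namespace XXZ

/-! ### `q`-numbers -/

/-- `[n]_Q! = ∏_{i=1}^n (1 - Q^i) / (1 - Q)`. -/
def qFactorial (Q : ℝ) (n : ℕ) : ℝ :=
  ∏ i ∈ Finset.range n, (1 - Q ^ (i + 1)) / (1 - Q)

/-- The `Q`-binomial coefficient (used for `k ≤ n`). -/
def qBinom (Q : ℝ) (n k : ℕ) : ℝ :=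
  qFactorial Q n / (qFactorial Q k * qFactorial Q (n - k))

/-- The anisotropy `Δ = (q + q⁻¹) / 2`. -/
def anisotropy (q : ℝ) : ℂ := ((q : ℂ) + (q : ℂ)⁻¹) / 2

/-! ### The finite chain and the action of `U_q(sl_2)` -/

/-- The space of states `(ℂ²)^{⊗N}`, written in its orthonormal basis `Ω^{(N)}(X)`, where `X` is
the set of sites that carry a down spin. The site number `i = 0, …, N - 1` has the coordinate
`x = i - (N - 1) / 2`. -/
abbrev SpinChain (N : ℕ) : Type := EuclideanSpace ℂ (Finset (Fin N))

/-- The operator that is diagonal in the basis `Ω^{(N)}(X)` with the entries `d X`. -/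
def diagOp {N : ℕ} (d : Finset (Fin N) → ℂ) : Module.End ℂ (SpinChain N) where
  toFun v := WithLp.toLp 2 fun X => d X * v X
  map_add' v w := by ext X; simp [mul_add]
  map_smul' c v := by ext X; simp [mul_left_comm]

/-- `σ⁻` at the site `y`: it maps `Ω(X)` to `Ω(X ∪ {y})` if `y ∉ X`, and to `0` otherwise. -/
def sigmaMinus {N : ℕ} (y : Fin N) : Module.End ℂ (SpinChain N) where
  toFun v := WithLp.toLp 2 fun Y => if y ∈ Y then v (Y.erase y) else 0
  map_add' v w := by ext Y; by_cases h : y ∈ Y <;> simp [h]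
  map_smul' c v := by ext Y; by_cases h : y ∈ Y <;> simp [h]

/-- The real power `K^s = q^{sσ³} ⊗ ⋯ ⊗ q^{sσ³}`. -/
def opK (q : ℝ) (N : ℕ) (s : ℝ) : Module.End ℂ (SpinChain N) :=
  diagOp fun X => ∏ i : Fin N, if i ∈ X then ((q ^ (-s) : ℝ) : ℂ) else ((q ^ s : ℝ) : ℂ)

/-- `L_y = q^{σ³} ⊗ ⋯ ⊗ q^{σ³} ⊗ 1 ⊗ ⋯ ⊗ 1`, with `q^{σ³}` at the sites to the left of `y`. -/
def opL (q : ℝ) {N : ℕ} (y : Fin N) : Module.End ℂ (SpinChain N) :=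
  diagOp fun X => ∏ i ∈ Finset.Iio y, if i ∈ X then (q : ℂ)⁻¹ else (q : ℂ)

/-- `F = ∑_y L_y σ⁻_y`. -/
def opF (q : ℝ) (N : ℕ) : Module.End ℂ (SpinChain N) :=
  ∑ y : Fin N, opL q y * sigmaMinus y

/-! ### Bethe vectors of the finite chain -/

/-- `B(a, b) = (1 - 2Δ b + a b) (1 - 2Δ a⁻¹ + b a⁻¹)`. -/
def scatB (q : ℝ) (a b : ℂ) : ℂ :=
  (1 - 2 * anisotropy q * b + a * b) * (1 - 2 * anisotropy q * a⁻¹ + b * a⁻¹)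

/-- The summand `A^{(N)}(v) v₁^{x₁} ⋯ v_m^{x_m}` of the finite Bethe wave function, where `x i` is
a site number. With `β(v) = (1 - q v⁻¹) v^{(N+1)/2}` and the coordinate `x - (N - 1)/2` of the site
number `x`, the two half-integral powers of `v` in `β(v⁻¹) v^{x - (N-1)/2}` combine to the integral
power `v^{x - N}`. -/
def finiteTerm (q : ℝ) (N : ℕ) {m : ℕ} (v : Fin m → ℂ) (x : Fin m → Fin N) : ℂ :=
  (∏ i, (1 - q * v i) * v i ^ (((x i : ℕ) : ℤ) - (N : ℤ))) *
    ∏ i, ∏ l ∈ Finset.Ioi i, scatB q (v i)⁻¹ (v l) * (v l)⁻¹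

/-- `λ^{(N)}(x | z)`: the signed sum over all permutations and reflections `z_i ↦ z_i⁻¹`. -/
def finiteWave (q : ℝ) (N : ℕ) {m : ℕ} (z : Fin m → ℂ) (x : Fin m → Fin N) : ℂ :=
  ∑ π : Equiv.Perm (Fin m), ∑ ε : Fin m → ℤˣ,
    ((Equiv.Perm.sign π * ∏ i, ε i : ℤˣ) : ℂ) *
      finiteTerm q N (fun i => z (π i) ^ ((ε i : ℤˣ) : ℤ)) x

/-- The finite Bethe vector `B^{(N)}(z) = ∑_{x₁ < ⋯ < x_m} λ^{(N)}(x | z) Ω^{(N)}(x)`. -/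
def finiteBethe (q : ℝ) (N : ℕ) {m : ℕ} (z : Fin m → ℂ) : SpinChain N :=
  WithLp.toLp 2 fun X =>
    if h : X.card = m then finiteWave q N z (X.orderEmbOfFin h) else 0

/-- The numbers `z_j` lie on the unit circle and solve the Bethe equations of the chain of
length `N`. -/
def IsBetheSolution (q : ℝ) (N : ℕ) {m : ℕ} (z : Fin m → ℂ) : Prop :=
  (∀ j, ‖z j‖ = 1) ∧
    ∀ j, z j ^ (2 * N) =
      ∏ l ∈ Finset.univ.erase j, scatB q (z j)⁻¹ (z l) / scatB q (z j) (z l)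

/-- `B_p^{(N)}(z) = q^{p(p-1)/2} / [p]_{q²}! · K^{-p/2} F^p B^{(N)}(z)`. -/
def finiteDescendant (q : ℝ) (N p : ℕ) {m : ℕ} (z : Fin m → ℂ) : SpinChain N :=
  ((q ^ p.choose 2 / qFactorial (q ^ 2) p : ℝ) : ℂ) •
    opK q N (-(p : ℝ) / 2) ((opF q N ^ p) (finiteBethe q N z))

/-- The operator `K^{-p} ∏_{k=1}^p (1 - K² q^{-2p+2k}) / (1 - q²)`. -/
def kacOp (q : ℝ) (N p : ℕ) : Module.End ℂ (SpinChain N) :=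
  opK q N (-(p : ℝ)) *
    ((List.range p).map fun k =>
      (1 - (q : ℂ) ^ 2)⁻¹ •
        (1 - (q : ℂ) ^ (-2 * (p : ℤ) + 2 * ((k : ℤ) + 1)) • opK q N 2)).prod

/-! ### Bethe states of the infinite chain over the ferromagnetic vacuum

The site with the coordinate `x + 1/2` is labelled by the integer `x`; a finite set `X` of integers
stands for the basis vector `Ω(X)` whose down spins are at the sites in `X`. -/

/-- `A(z₁, …, z_m) = ∏_{i<j} (1 - 2Δ z_i + z_i z_j)`. -/
def amplitude (q : ℝ) {m : ℕ} (z : Fin m → ℂ) : ℂ :=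
  ∏ i, ∏ j ∈ Finset.Ioi i, (1 - 2 * anisotropy q * z i + z i * z j)

/-- `λ(x | z) = ∑_π ε_π A(z_π) z_π^x`. -/
def wave (q : ℝ) {m : ℕ} (z : Fin m → ℂ) (x : Fin m → ℤ) : ℂ :=
  ∑ π : Equiv.Perm (Fin m), ((Equiv.Perm.sign π : ℤˣ) : ℂ) *
    (amplitude q (fun i => z (π i)) * ∏ i, z (π i) ^ x i)

/-- The coefficients of the Bethe state `B(z) = ∑_{x₁ < ⋯ < x_m} λ(x | z) Ω(x)`. -/
def betheState (q : ℝ) {m : ℕ} (z : Fin m → ℂ) (X : Finset ℤ) : ℂ :=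
  if h : X.card = m then wave q z (X.orderEmbOfFin h) else 0

/-! ### Bethe states over the domain wall vacuum

The basis vectors `Ω_DW(δ)` are labelled by the integer partitions `δ`, given as Young diagrams. -/

/-- The part `δ_l`, for `l = 1, 2, …`. -/
def part (δ : YoungDiagram) (l : ℕ) : ℕ := δ.rowLen (l - 1)

/-- The value `-w^{-r} / (1 - w)` that is given to the geometric series `∑_{l > r} w^{-l}`, also
where it diverges. -/
def geomSeries (r : ℕ) (w : ℂ) : ℂ := -(w ^ r)⁻¹ / (1 - w)

/-- The value of `∑_{r < l₁ < ⋯ < l_n} w₁^{-l₁} ⋯ w_n^{-l_n}` when the summations over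
`l_n, …, l₁`, in this order, are evaluated by `geomSeries`. The sum over `l₂ < ⋯ < l_n` with
`l₁ < l₂` is `(w₂ ⋯ w_n)^{-l₁}` times the same sum with `0 < l₂`, so that the series in `l₁` is
geometric with the ratio `(w₁ ⋯ w_n)⁻¹`. -/
def nestedGeomSeries : ℕ → List ℂ → ℂ
  | _, [] => 1
  | r, w :: ws => geomSeries r (w :: ws).prod * nestedGeomSeries 0 ws

/-- The value of `∑_{s < l₁ < ⋯ < l_n} ∏_a ζ_a^{δ_{l_a} - l_a} q^{-(δ_{l_a} + l_a)}`: with `r` the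
number of parts of `δ`, the terms with `l₁ ≤ r` are summed over `l₁` directly, and those with
`l₁ > r`, where `δ_{l_a} = 0` for all `a`, form nested geometric series. -/
def dwSum (q : ℝ) (δ : YoungDiagram) : List ℂ → ℕ → ℂ
  | [], _ => 1
  | ζ :: ζs, s =>
      (∑ l ∈ Finset.Ioc s (δ.colLen 0),
        ζ ^ ((part δ l : ℤ) - (l : ℤ)) / (q : ℂ) ^ (part δ l + l) * dwSum q δ ζs l) +
      nestedGeomSeries (δ.colLen 0) ((ζ :: ζs).map fun w => (q : ℂ) * w)

/-- The coefficients of the domain wall Bethe state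
`B_∞(z) = q^{m(m+1)/2} ∑_δ q^{|δ|} ∑_{l₁ < ⋯ < l_m} λ(x | z) q^{-∑_a (δ_{l_a} + l_a)} Ω_DW(δ)`,
where `x₁ < ⋯ < x_m` are the numbers `δ_{l_a} - l_a` in increasing order, that is,
`x_i = δ_{l_a} - l_a` for `a = m + 1 - i`. -/
def dwState (q : ℝ) {m : ℕ} (z : Fin m → ℂ) (δ : YoungDiagram) : ℂ :=
  (q : ℂ) ^ ((m + 1).choose 2 + δ.card) *
    ∑ π : Equiv.Perm (Fin m), ((Equiv.Perm.sign π : ℤˣ) : ℂ) *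
      (amplitude q (fun i => z (π i)) *
        dwSum q δ (List.ofFn fun a : Fin m => z (π (Fin.rev a))) 0)

/-! ### The spectrum: magnons and their bound states -/

/-- The number `z_j` (`j = 1, …, n`) of a bound state of `n` magnons with the rapidity `β`, where
`q = e^{-η}`. For `n = 1` it is a single magnon, with `|z₁| = 1`. -/
def stringMagnon (q : ℝ) (n : ℕ) (β : ℝ) (j : ℕ) : ℂ :=
  Complex.sinh (Complex.I * β + ((n : ℂ) / 2 - j + 1) * ((-Real.log q : ℝ) : ℂ)) /
    Complex.sinh (Complex.I * β + ((n : ℂ) / 2 - j) * ((-Real.log q : ℝ) : ℂ))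

/-- The parameters `z` of a state that is composed of `k` bound states, with `n i` magnons and the
rapidity `β i` each. -/
def stringPoint (q : ℝ) {k : ℕ} (n : Fin k → ℕ) (β : Fin k → ℝ) : Fin (∑ i, n i) → ℂ :=
  fun a =>
    let s := (finSigmaFinEquiv (n := n)).symm a
    stringMagnon q (n s.1) (β s.1) ((s.2 : ℕ) + 1)

/-- Smooth compactly supported functions of the rapidities. The support has to avoid the rapidities
`β i ∈ πℤ` of bound states of an even number of magnons, where one of the `z_j` is infinite and
one is zero. -/
structure IsTestFunction {k : ℕ} (n : Fin k → ℕ) (f : (Fin k → ℝ) → ℂ) : Prop where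
  smooth : ContDiff ℝ ((⊤ : ℕ∞) : WithTop ℕ∞) f
  compact : HasCompactSupport f
  support : tsupport f ⊆ {β | ∀ i, Even (n i) → Real.sin (β i) ≠ 0}

/-- The wave packet `∫ f(β) B(z(β)) dβ`. -/
def bethePacket (q : ℝ) {k : ℕ} (n : Fin k → ℕ) (f : (Fin k → ℝ) → ℂ) (X : Finset ℤ) : ℂ :=
  ∫ β, f β * betheState q (stringPoint q n β) X

/-- The wave packet `∫ f(β) B_∞(z(β)) dβ`. -/
def dwPacket (q : ℝ) {k : ℕ} (n : Fin k → ℕ) (f : (Fin k → ℝ) → ℂ) (δ : YoungDiagram) : ℂ :=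
  ∫ β, f β * dwState q (stringPoint q n β) δ

end XXZ

end

/-! Let `E` be the adjoint of `F`. It satisfies `E F = q⁻² F E + (1 - K²) / (1 - q²)` (`opE_opF`).
On a vector `v` of fixed magnetization with `E v = 0`, each `E` therefore strips one `F` from `F^p
v` at the cost of an explicit scalar. Moving `F^{p'}` to the other side as `E^{p'}` yields the
orthogonality for `p ≠ p'` and the product formula for `p = p'` (`inner_descendant`); at half
filling the product is a `q²`-binomial coefficient, and its limit follows from a quotient of partial
products. The finite statements thus reduce to `opE_finiteBethe`: Bethe vectors are highest weight
vectors. That is a telescoping argument (`sum_raise_eq`): on plane waves, `E` is a discrete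
integral. The defects at occupied sites are antisymmetric under the exchange of two neighbouring
momenta and cancel by the scattering relation. The boundary terms cancel under reflection of one
momentum, on the left because of the Bethe equations.

For the infinite chain no scalar product is computed from explicit wave functions. Instead a linear
map `dwTransform`, from wave functions of `m` magnons to functions on Young diagrams, is shown to
multiply all scalar products of square summable vectors by the constant (`tsum_dwTransform`), and
the domain wall packets are shown to be images of the ferromagnetic packets
(`IsTestFunction.dwPacket_eq`).

The definition of the map has to cope with sums over magnons far to the left, which carry weights
`q^y` and in general diverge. For a highest weight function on a finite interval, `E ψ = 0` trades
the sum over one more particle on the left for a sum over the right half line, where `q^y` decays.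
The resulting recursion `tailSum` involves no interval length and is continuous in `ψ`. On Bethe
states it reproduces the prescribed values of the geometric series (`tailSum_betheState`), by a
rational identity and the scattering relation. On highest weight vectors of the chain on `[-L, L)`
the map gives the components of the descendant with `p = L - m`, once half filled configurations are
encoded by diagrams in the `L × L` box (`descendant_boxSet`). There scalar products are multiplied
by the binomial coefficient.

Every square summable function of `m` magnons is a limit of such highest weight vectors
(`exists_highestWeight_seq`): a truncation with a long empty stretch on its left is almost
annihilated by `E`, and a small correction `F w` makes this exact. Letting the length grow gives the
constant.

Finally the packets must be square summable, and the map must commute with the integral. Only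
permutations that keep the order inside each bound state have nonzero amplitude. Their waves factor
into unimodular powers of total momenta and powers that decay geometrically in the internal
distances. Bessel's inequality in the total momenta and a geometric sum over the distances then
suffice (`IsTestFunction.memℓp_integral_betheTerm`). Rapidities at which a geometric series has
ratio one form a null set. -/

noncomputable section

/-! ### Finite chains: the quantum group action and Bethe vectors as highest weight vectors. -/

namespace XXZ

open Finset

/-! ### Plane waves on finite sets of sites -/

/-- The number of elements of `X` to the left of `s`. -/
def rank (X : Finset ℤ) (s : ℤ) : ℕ := #{x ∈ X | x < s}

/-- The plane wave `∏ v_i ^ x_i`, where `x_0 < x_1 < ⋯` are the elements of `X`. -/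
def planeWave (v : ℕ → ℂ) (X : Finset ℤ) : ℂ := ∏ x ∈ X, v (rank X x) ^ x

/-- The plane wave with an additional particle at `s`, which may coincide with an element of `X`
and is then counted as the left one of the two. -/
def insertWave (v : ℕ → ℂ) (X : Finset ℤ) (s : ℤ) : ℂ :=
  (∏ x ∈ X with x < s, v (rank X x) ^ x) * v (rank X s) ^ s *
    ∏ x ∈ X with ¬ x < s, v (rank X x + 1) ^ x

/-- The factor `1 - 2Δ x + x y` of the amplitude. -/
def pairFactor (q : ℝ) (x y : ℂ) : ℂ := 1 - 2 * anisotropy q * x + x * y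

theorem rank_lt_card {X : Finset ℤ} {x : ℤ} (hx : x ∈ X) : rank X x < #X :=
  card_lt_card ⟨filter_subset _ _, fun h => by simpa using h hx⟩

theorem rank_le_card (X : Finset ℤ) (x : ℤ) : rank X x ≤ #X := card_filter_le _ _

theorem rank_insert {X : Finset ℤ} {y : ℤ} (hy : y ∉ X) (x : ℤ) :
    rank (insert y X) x = rank X x + if y < x then 1 else 0 := by
  unfold rank
  rw [filter_insert]
  split_ifs with h
  · rw [card_insert_of_notMem (by simp [hy])]
  · rfl

theorem rank_mono (X : Finset ℤ) {x y : ℤ} (h : x ≤ y) : rank X x ≤ rank X y :=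
  card_le_card fun _ hz => by
    simp only [mem_filter] at hz ⊢
    exact ⟨hz.1, hz.2.trans_le h⟩

theorem rank_add_one_of_mem {X : Finset ℤ} {s : ℤ} (hs : s ∈ X) :
    rank X (s + 1) = rank X s + 1 := by
  unfold rank
  rw [← card_insert_of_notMem (a := s) (by simp)]
  congr 1
  ext x
  simp only [mem_filter, mem_insert]
  grind

theorem rank_add_one_of_notMem {X : Finset ℤ} {s : ℤ} (hs : s ∉ X) :
    rank X (s + 1) = rank X s := by
  unfold rank
  congr 1
  ext x
  simp only [mem_filter]
  grind

theorem rank_lt_rank {X : Finset ℤ} {x y : ℤ} (hx : x ∈ X) (h : x < y) :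
    rank X x < rank X y := by
  have := rank_mono X (show x + 1 ≤ y by omega)
  rw [rank_add_one_of_mem hx] at this
  omega

theorem rank_eq_zero {X : Finset ℤ} {c : ℤ} (h : ∀ x ∈ X, c ≤ x) : rank X c = 0 := by
  simp only [rank, card_eq_zero, filter_eq_empty_iff, not_lt]
  exact fun x hx => h x hx

theorem rank_eq_card {X : Finset ℤ} {c : ℤ} (h : ∀ x ∈ X, x < c) : rank X c = #X := by
  rw [rank, filter_true_of_mem h]

theorem planeWave_insert (v : ℕ → ℂ) {X : Finset ℤ} {y : ℤ} (hy : y ∉ X) :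
    planeWave v (insert y X) = insertWave v X y := by
  rw [planeWave, prod_insert hy, ← prod_filter_mul_prod_filter_not X (fun x => x < y), insertWave,
    rank_insert hy]
  have h1 : ∏ x ∈ X with x < y, v (rank (insert y X) x) ^ x =
      ∏ x ∈ X with x < y, v (rank X x) ^ x :=
    prod_congr rfl fun x hx => by
      rw [rank_insert hy, if_neg (by simp only [mem_filter] at hx; omega), add_zero]
  have h2 : ∏ x ∈ X with ¬ x < y, v (rank (insert y X) x) ^ x =
      ∏ x ∈ X with ¬ x < y, v (rank X x + 1) ^ x :=
    prod_congr rfl fun x hx => by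
      simp only [mem_filter] at hx
      rw [rank_insert hy, if_pos (lt_of_le_of_ne (by omega) (by rintro rfl; exact hy hx.1))]
  rw [h1, h2]
  simp only [lt_irrefl, if_false, add_zero]
  ring

/-- Inserting a particle to the left of all others shifts the indices of the others. -/
theorem planeWave_insert_of_lt (v : ℕ → ℂ) {X : Finset ℤ} {y : ℤ} (hy : ∀ x ∈ X, y < x) :
    planeWave v (insert y X) = v 0 ^ y * planeWave (fun i => v (i + 1)) X := by
  have hy' : y ∉ X := fun h => lt_irrefl _ (hy y h)
  rw [planeWave_insert v hy', insertWave, rank_eq_zero fun x hx => (hy x hx).le,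
    filter_false_of_mem fun x hx => (hy x hx).not_gt, filter_true_of_mem fun x hx =>
    (hy x hx).not_gt, prod_empty, one_mul, planeWave]

theorem insertWave_left (v : ℕ → ℂ) {X : Finset ℤ} {c : ℤ} (h : ∀ x ∈ X, c ≤ x) :
    insertWave v X c = v 0 ^ c * planeWave (fun i => v (i + 1)) X := by
  rw [insertWave, rank_eq_zero h, filter_false_of_mem fun x hx => (h x hx).not_gt,
    filter_true_of_mem fun x hx => (h x hx).not_gt, prod_empty, one_mul, planeWave]

theorem insertWave_right (v : ℕ → ℂ) {X : Finset ℤ} {c : ℤ} (h : ∀ x ∈ X, x < c) :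
    insertWave v X c = planeWave v X * v #X ^ c := by
  rw [insertWave, rank_eq_card h, filter_true_of_mem h,
    filter_false_of_mem fun x hx => not_not.2 (h x hx), prod_empty, mul_one, planeWave]

theorem insertWave_add_one (v : ℕ → ℂ) {X : Finset ℤ} {s : ℤ} (hs : s ∉ X)
    (hv : v (rank X s) ≠ 0) : insertWave v X (s + 1) = insertWave v X s * v (rank X s) := by
  have h1 : {x ∈ X | x < s + 1} = {x ∈ X | x < s} := by
    ext x; simp only [mem_filter]; grind
  have h2 : {x ∈ X | ¬ x < s + 1} = {x ∈ X | ¬ x < s} := by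
    ext x; simp only [mem_filter]; grind
  rw [insertWave, insertWave, h1, h2, rank_add_one_of_notMem hs, zpow_add_one₀ hv]
  ring

/-- The particles other than those with the indices `rank X s` and `rank X s + 1` in
`insertWave v X s`. -/
def spectatorWave (v : ℕ → ℂ) (X : Finset ℤ) (s : ℤ) : ℂ :=
  (∏ x ∈ X with x < s, v (rank X x) ^ x) * ∏ x ∈ X with s < x, v (rank X x + 1) ^ x

theorem insertWave_of_mem (v : ℕ → ℂ) {X : Finset ℤ} {s : ℤ} (hs : s ∈ X) :
    insertWave v X s =
      spectatorWave v X s * (v (rank X s) ^ s * v (rank X s + 1) ^ s) := by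
  have h2 : {x ∈ X | ¬ x < s} = insert s {x ∈ X | s < x} := by
    ext x; simp only [mem_filter, mem_insert]; grind
  rw [insertWave, h2, prod_insert (by simp), spectatorWave]
  ring

theorem insertWave_add_one_of_mem (v : ℕ → ℂ) {X : Finset ℤ} {s : ℤ} (hs : s ∈ X)
    (hv : v (rank X s + 1) ≠ 0) :
    insertWave v X (s + 1) =
      spectatorWave v X s * (v (rank X s) ^ s * v (rank X s + 1) ^ s) * v (rank X s + 1) := by
  have h1 : {x ∈ X | x < s + 1} = insert s {x ∈ X | x < s} := by
    ext x; simp only [mem_filter, mem_insert]; grind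
  have h2 : {x ∈ X | ¬ x < s + 1} = {x ∈ X | s < x} := by
    ext x; simp only [mem_filter]; grind
  rw [insertWave, h1, h2, prod_insert (by simp), spectatorWave, rank_add_one_of_mem hs,
    zpow_add_one₀ hv]
  ring

/-- Particles left of `s` have indices below `rank X s`, and those right of `s` have shifted indices
above `rank X s + 1`, so the exchange touches none of them. -/
theorem spectatorWave_swap (v : ℕ → ℂ) {X : Finset ℤ} {s : ℤ} (hs : s ∈ X) :
    spectatorWave (v ∘ Equiv.swap (rank X s) (rank X s + 1)) X s = spectatorWave v X s := by
  unfold spectatorWave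
  congr 1
  · refine prod_congr rfl fun x hx => ?_
    simp only [mem_filter] at hx
    have := rank_lt_rank hx.1 hx.2
    rw [Function.comp_apply, Equiv.swap_apply_of_ne_of_ne (by omega) (by omega)]
  · refine prod_congr rfl fun x hx => ?_
    simp only [mem_filter] at hx
    have := rank_lt_rank hs hx.2
    rw [Function.comp_apply, Equiv.swap_apply_of_ne_of_ne (by omega) (by omega)]

/-! ### The telescoping sum of the raising operator -/

/-- The jump of the telescoping function across an occupied site. The factor `q⁻¹` combines one step
of `q^y` with one unit of rank, `q · q⁻²`. The jump is the two-body factor with its arguments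
reversed, which is why the scattering relation can remove it. -/
theorem one_div_sub_eq_pairFactor {q : ℝ} (hq : q ≠ 0) {x y : ℂ} (hx : 1 - q * x ≠ 0)
    (hy : 1 - q * y ≠ 0) :
    1 / (1 - q * x) - (q : ℂ)⁻¹ * y / (1 - q * y) =
      pairFactor q y x / ((1 - q * x) * (1 - q * y)) := by
  have hq' : (q : ℂ) ≠ 0 := by exact_mod_cast hq
  rw [pairFactor, anisotropy]
  field_simp
  ring

/-- Weights `α` of plane waves `v` such that exchanging two neighbouring momenta produces the
two-body scattering factor. -/
def ScatteringWeights (q : ℝ) {W : Type*} (n : ℕ) (α : W → ℂ) (v : W → ℕ → ℂ) : Prop :=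
  ∀ a < n, ∃ τ : Equiv.Perm W, ∀ w, v (τ w) = v w ∘ Equiv.swap a (a + 1) ∧
    α (τ w) * pairFactor q (v w a) (v w (a + 1)) = -(α w * pairFactor q (v w (a + 1)) (v w a))

theorem sum_eq_zero_of_antisymm {W : Type*} [Fintype W] (g : W → ℂ) (τ : Equiv.Perm W)
    (h : ∀ w, g (τ w) = -g w) : ∑ w, g w = 0 := by
  have h1 : ∑ w, g w = -∑ w, g w := by
    conv_lhs => rw [← Equiv.sum_comp τ]
    rw [← sum_neg_distrib]
    exact sum_congr rfl fun w _ => h w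
  exact self_eq_neg.1 h1

/-- The weight `q^{y - 2 rank}` with which the raising operator removes a particle at `y`. -/
def raiseWeight (q : ℝ) (X : Finset ℤ) (y : ℤ) : ℂ := (q : ℂ) ^ (y - 2 * (rank X y : ℤ))

/-- A wave proportional to `(q v)^s` has the discrete antiderivative `-(q v)^s / (1 - q v)`, which
settles vacant sites. At an occupied site the antiderivative must not jump: the jump is `α` times a
reversed pair factor times an expression symmetric in the two coinciding momenta, hence changes sign
under the relabelling `τ` and sums to zero. -/
theorem telescoping_step {q : ℝ} (hq : q ≠ 0) {W : Type*} [Fintype W] {α : W → ℂ}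
    {v : W → ℕ → ℂ} {X : Finset ℤ} (hα : ScatteringWeights q #X α v)
    (hv : ∀ w, ∀ i ≤ #X, v w i ≠ 0) (hv1 : ∀ w, ∀ i ≤ #X, 1 - q * v w i ≠ 0) (s : ℤ) :
    (if s ∈ X then 0 else raiseWeight q X s * ∑ w, α w * planeWave (v w) (insert s X)) =
      raiseWeight q X s * ∑ w, α w * (insertWave (v w) X s / (1 - q * v w (rank X s))) -
      raiseWeight q X (s + 1) *
        ∑ w, α w * (insertWave (v w) X (s + 1) / (1 - q * v w (rank X (s + 1)))) := by
  have hq' : (q : ℂ) ≠ 0 := by exact_mod_cast hq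
  split_ifs with hs
  · have ha : rank X s < #X := rank_lt_card hs
    have hw : raiseWeight q X (s + 1) = raiseWeight q X s * (q : ℂ)⁻¹ := by
      rw [raiseWeight, raiseWeight, rank_add_one_of_mem hs, ← zpow_sub_one₀ hq']
      congr 1
      push_cast
      ring
    rw [hw, mul_assoc, ← mul_sub, mul_sum, ← sum_sub_distrib]
    obtain ⟨τ, hτ⟩ := hα (rank X s) ha
    set a := rank X s with ha'
    symm
    apply mul_eq_zero_of_right
    have key : ∀ w, α w * (insertWave (v w) X s / (1 - q * v w a)) -
        (q : ℂ)⁻¹ * (α w * (insertWave (v w) X (s + 1) / (1 - q * v w (rank X (s + 1))))) =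
        α w * pairFactor q (v w (a + 1)) (v w a) *
          (spectatorWave (v w) X s * (v w a ^ s * v w (a + 1) ^ s) /
            ((1 - q * v w a) * (1 - q * v w (a + 1)))) := by
      intro w
      have h0 := one_div_sub_eq_pairFactor hq (hv1 w a ha.le) (hv1 w (a + 1) ha)
      rw [insertWave_of_mem _ hs, insertWave_add_one_of_mem _ hs (hv w _ ha),
        rank_add_one_of_mem hs, ← ha']
      calc _ = α w * (spectatorWave (v w) X s * (v w a ^ s * v w (a + 1) ^ s)) *
            (1 / (1 - q * v w a) - (q : ℂ)⁻¹ * v w (a + 1) / (1 - q * v w (a + 1))) := by ring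
        _ = _ := by rw [h0]; ring
    simp only [key]
    refine sum_eq_zero_of_antisymm _ τ fun w => ?_
    obtain ⟨h1, h2⟩ := hτ w
    rw [h1, ha', spectatorWave_swap _ hs, ← ha']
    simp only [Function.comp_apply, Equiv.swap_apply_left, Equiv.swap_apply_right]
    rw [h2]
    ring
  · have ha : rank X s ≤ #X := rank_le_card _ _
    have hw : raiseWeight q X (s + 1) = raiseWeight q X s * q := by
      rw [raiseWeight, raiseWeight, rank_add_one_of_notMem hs, ← zpow_add_one₀ hq']
      congr 1
      ring
    rw [hw, mul_assoc, ← mul_sub, mul_sum _ _ (q : ℂ), ← sum_sub_distrib]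
    congr 1
    refine sum_congr rfl fun w _ => ?_
    rw [planeWave_insert _ hs, insertWave_add_one _ hs (hv w _ ha), rank_add_one_of_notMem hs]
    have := hv1 w _ ha
    field_simp

/-- The sum over the sites `c ≤ y < c + n` of the raising operator, applied to a superposition of
plane waves, consists of boundary terms. -/
theorem sum_raise_eq {q : ℝ} (hq : q ≠ 0) {W : Type*} [Fintype W] {α : W → ℂ}
    {v : W → ℕ → ℂ} {X : Finset ℤ} (hα : ScatteringWeights q #X α v)
    (hv : ∀ w, ∀ i ≤ #X, v w i ≠ 0) (hv1 : ∀ w, ∀ i ≤ #X, 1 - q * v w i ≠ 0) (c : ℤ) (n : ℕ)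
    (hc : ∀ x ∈ X, c ≤ x) (hn : ∀ x ∈ X, x < c + n) :
    ∑ i ∈ range n, (if c + (i : ℤ) ∈ X then 0 else
      raiseWeight q X (c + i) * ∑ w, α w * planeWave (v w) (insert (c + (i : ℤ)) X)) =
      ∑ w, α w * (((q : ℂ) * v w 0) ^ c / (1 - q * v w 0) *
        planeWave (fun i => v w (i + 1)) X) -
      ∑ w, α w * ((q : ℂ) ^ (c + n - 2 * (#X : ℤ)) * v w #X ^ (c + n) / (1 - q * v w #X) *
        planeWave (v w) X) := by
  have h1 : ∀ i : ℕ, (if c + (i : ℤ) ∈ X then 0 else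
      raiseWeight q X (c + i) * ∑ w, α w * planeWave (v w) (insert (c + (i : ℤ)) X)) =
      (fun i : ℕ => raiseWeight q X (c + i) * ∑ w, α w * (insertWave (v w) X (c + i) /
        (1 - q * v w (rank X (c + i))))) i - (fun i : ℕ => raiseWeight q X (c + i) *
        ∑ w, α w * (insertWave (v w) X (c + i) / (1 - q * v w (rank X (c + i))))) (i + 1) := by
    intro i
    rw [telescoping_step hq hα hv hv1]
    simp only [Nat.cast_add, Nat.cast_one, add_assoc]
  simp only [h1]
  rw [sum_range_sub']
  congr 1
  · simp only [Nat.cast_zero, add_zero, rank_eq_zero hc, raiseWeight]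
    rw [mul_sum]
    refine sum_congr rfl fun w _ => ?_
    rw [insertWave_left _ hc, mul_zpow]
    simp only [mul_zero, sub_zero]
    ring
  · simp only [raiseWeight, rank_eq_card hn]
    rw [mul_sum]
    refine sum_congr rfl fun w _ => ?_
    rw [insertWave_right _ hn]
    ring

/-! ### The raising operator of the finite chain -/

/-- The eigenvalue of `L_y` at the basis vector `Ω(X)`. -/
def leftWeight (q : ℝ) {N : ℕ} (y : Fin N) (X : Finset (Fin N)) : ℂ :=
  ∏ i ∈ Iio y, if i ∈ X then (q : ℂ)⁻¹ else (q : ℂ)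

/-- The raising operator, the adjoint of `F`. -/
def opE (q : ℝ) (N : ℕ) : Module.End ℂ (SpinChain N) where
  toFun v := WithLp.toLp 2 fun X =>
    ∑ y, if y ∈ X then 0 else leftWeight q y X * v (insert y X)
  map_add' v w := by
    ext X
    simp only [PiLp.add_apply, ← sum_add_distrib]
    refine sum_congr rfl fun y _ => ?_
    split_ifs <;> ring
  map_smul' c v := by
    ext X
    simp only [PiLp.smul_apply, smul_eq_mul, mul_sum, RingHom.id_apply]
    refine sum_congr rfl fun y _ => ?_
    split_ifs <;> ring

theorem opE_apply (q : ℝ) {N : ℕ} (v : SpinChain N) (X : Finset (Fin N)) :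
    opE q N v X = ∑ y, if y ∈ X then 0 else leftWeight q y X * v (insert y X) := rfl

theorem opF_apply (q : ℝ) {N : ℕ} (v : SpinChain N) (X : Finset (Fin N)) :
    opF q N v X = ∑ y, if y ∈ X then leftWeight q y X * v (X.erase y) else 0 := by
  simp only [opF, LinearMap.sum_apply, WithLp.ofLp_sum, Finset.sum_apply, Module.End.mul_apply]
  refine sum_congr rfl fun y _ => ?_
  simp only [opL, diagOp, sigmaMinus, LinearMap.coe_mk, AddHom.coe_mk, leftWeight, mul_ite,
    mul_zero]

theorem prod_ite_mem {N : ℕ} (a b : ℂ) (hb : b ≠ 0) (s X : Finset (Fin N)) :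
    (∏ i ∈ s, if i ∈ X then a else b) = b ^ (#s : ℤ) * (a / b) ^ (#(s ∩ X) : ℤ) := by
  rw [prod_ite, prod_const, prod_const, ← filter_mem_eq_inter]
  have h := card_filter_add_card_filter_not (s := s) (fun i => i ∈ X)
  rw [← h, Nat.cast_add, zpow_add₀ hb, zpow_natCast, zpow_natCast, zpow_natCast, div_pow]
  field_simp

theorem leftWeight_eq {q : ℝ} (hq : q ≠ 0) {N : ℕ} (y : Fin N) (X : Finset (Fin N)) :
    leftWeight q y X = (q : ℂ) ^ ((y : ℤ) - 2 * (#{x ∈ X | x < y} : ℤ)) := by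
  have hq' : (q : ℂ) ≠ 0 := by exact_mod_cast hq
  have h : Iio y ∩ X = {x ∈ X | x < y} := by ext; simp [and_comm]
  rw [leftWeight, prod_ite_mem _ _ hq', h, Fin.card_Iio, zpow_sub₀ hq', zpow_mul,
    div_eq_mul_inv _ ((_ : ℂ) ^ _), ← inv_zpow]
  congr 2
  rw [div_eq_mul_inv, ← mul_inv, zpow_ofNat, sq]

theorem leftWeight_insert_of_lt {q : ℝ} (hq : q ≠ 0) {N : ℕ} {y w : Fin N} (h : w < y)
    {X : Finset (Fin N)} (hw : w ∉ X) :
    leftWeight q y (insert w X) = (q : ℂ)⁻¹ ^ 2 * leftWeight q y X := by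
  have hq' : (q : ℂ) ≠ 0 := by exact_mod_cast hq
  rw [leftWeight_eq hq, leftWeight_eq hq, filter_insert, if_pos h,
    card_insert_of_notMem (by simp [hw]), ← zpow_natCast, inv_zpow, ← zpow_neg, ← zpow_add₀ hq']
  congr 1
  push_cast
  ring

theorem leftWeight_insert_of_le {q : ℝ} {N : ℕ} {y w : Fin N} (h : y ≤ w)
    (X : Finset (Fin N)) : leftWeight q y (insert w X) = leftWeight q y X := by
  refine prod_congr rfl fun i hi => ?_
  have : i ≠ w := ((mem_Iio.1 hi).trans_le h).ne
  simp [this]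

/-- Of the two sites, only the right one sees the spin at the left one. Whichever site is on the
left, flipping that spin costs one factor `q⁻²`. This is the origin of the `q⁻²` in the commutation
relation. -/
theorem leftWeight_exchange {q : ℝ} (hq : q ≠ 0) {N : ℕ} {y w : Fin N} {X : Finset (Fin N)}
    (hy : y ∉ X) (hw : w ∈ X) :
    leftWeight q y X * leftWeight q w (insert y X) =
      (q : ℂ)⁻¹ ^ 2 * (leftWeight q w X * leftWeight q y (X.erase w)) := by
  have hX : leftWeight q y X = leftWeight q y (insert w (X.erase w)) := by rw [insert_erase hw]
  rcases lt_trichotomy y w with h | h | h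
  · rw [leftWeight_insert_of_lt hq h hy, hX, leftWeight_insert_of_le h.le]
    ring
  · exact absurd (h ▸ hw) hy
  · rw [leftWeight_insert_of_le h.le, hX, leftWeight_insert_of_lt hq h (notMem_erase w X)]
    ring

theorem sum_mem_eq_sum_notMem {N : ℕ} (y : Fin N) (g : Finset (Fin N) → ℂ) :
    (∑ Y, if y ∈ Y then g Y else 0) = ∑ X, if y ∈ X then 0 else g (insert y X) := by
  simp only [← sum_filter, ← ite_not (_ ∈ _) (g _)]
  refine sum_nbij' (fun Y => Y.erase y) (fun X => insert y X) ?_ ?_ ?_ ?_ ?_ <;>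
    simp +contextual [insert_erase]

theorem conj_leftWeight (q : ℝ) {N : ℕ} (y : Fin N) (X : Finset (Fin N)) :
    (starRingEnd ℂ) (leftWeight q y X) = leftWeight q y X := by
  simp only [leftWeight, map_prod, apply_ite (starRingEnd ℂ), map_inv₀, Complex.conj_ofReal]

theorem inner_opF (q : ℝ) {N : ℕ} (v w : SpinChain N) :
    inner ℂ (opF q N v) w = inner ℂ v (opE q N w) := by
  simp only [PiLp.inner_apply, RCLike.inner_apply, opF_apply, opE_apply, map_sum, mul_sum,
    sum_mul]
  rw [sum_comm]
  conv_rhs => rw [sum_comm]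
  refine sum_congr rfl fun y _ => ?_
  have h1 : ∀ Y : Finset (Fin N),
      (w Y * (starRingEnd ℂ) (if y ∈ Y then leftWeight q y Y * v (Y.erase y) else 0)) =
      if y ∈ Y then leftWeight q y Y * w Y * (starRingEnd ℂ) (v (Y.erase y)) else 0 := by
    intro Y
    split_ifs
    · rw [map_mul, conj_leftWeight]; ring
    · simp
  simp only [h1]
  rw [sum_mem_eq_sum_notMem]
  refine sum_congr rfl fun X _ => ?_
  split_ifs with h
  · simp
  · rw [erase_insert h, leftWeight_insert_of_le le_rfl]

theorem inner_opF_pow (q : ℝ) {N : ℕ} (p : ℕ) (v w : SpinChain N) :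
    inner ℂ ((opF q N ^ p) v) w = inner ℂ v ((opE q N ^ p) w) := by
  induction p generalizing v w with
  | zero => simp
  | succ p ih =>
    rw [pow_succ', Module.End.mul_apply, inner_opF, ih, ← Module.End.mul_apply, ← pow_succ]

theorem inner_diagOp {N : ℕ} (d : Finset (Fin N) → ℂ)
    (hd : ∀ X, (starRingEnd ℂ) (d X) = d X) (v w : SpinChain N) :
    inner ℂ (diagOp d v) w = inner ℂ v (diagOp d w) := by
  simp only [PiLp.inner_apply, RCLike.inner_apply, diagOp, LinearMap.coe_mk, AddHom.coe_mk,
    map_mul, hd]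
  exact sum_congr rfl fun X _ => by ring

theorem opK_apply {q : ℝ} (hq : 0 < q) {N : ℕ} (s : ℝ) (v : SpinChain N) (X : Finset (Fin N)) :
    opK q N s v X = ((q ^ (s * (N - 2 * #X)) : ℝ) : ℂ) * v X := by
  have hne : ((q ^ s : ℝ) : ℂ) ≠ 0 := by exact_mod_cast (Real.rpow_pos_of_pos hq s).ne'
  simp only [opK, diagOp, LinearMap.coe_mk, AddHom.coe_mk]
  congr 1
  rw [prod_ite_mem _ _ hne, univ_inter, card_univ, Fintype.card_fin]
  rw [zpow_natCast, zpow_natCast, ← Complex.ofReal_div, ← Complex.ofReal_pow,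
    ← Complex.ofReal_pow, ← Complex.ofReal_mul]
  congr 1
  rw [← Real.rpow_sub hq, ← Real.rpow_natCast, ← Real.rpow_mul hq.le, ← Real.rpow_natCast,
    ← Real.rpow_mul hq.le, ← Real.rpow_add hq]
  congr 1
  ring

theorem inner_opK {q : ℝ} {N : ℕ} (s : ℝ) (v w : SpinChain N) :
    inner ℂ (opK q N s v) w = inner ℂ v (opK q N s w) := by
  refine inner_diagOp _ (fun X => ?_) v w
  simp only [map_prod, apply_ite (starRingEnd ℂ), Complex.conj_ofReal]

/-- With `d_i` the one-site factors of `K²`, the squared weight at `y` is `∏_{i<y} d_i`, and each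
summand is `(1 - d_y) / (1 - q²)` times it. The sum is the ordered expansion of `1 - ∏ d_i`. -/
theorem sum_sq_leftWeight {q : ℝ} (hq : q ≠ 0) (hq2 : 1 - (q : ℂ) ^ 2 ≠ 0) {N : ℕ}
    (X : Finset (Fin N)) :
    (∑ y, if y ∈ X then -((q : ℂ)⁻¹ ^ 2 * leftWeight q y X ^ 2) else leftWeight q y X ^ 2) =
      (1 - (q : ℂ) ^ 2)⁻¹ * (1 - ∏ i, if i ∈ X then ((q : ℂ)⁻¹) ^ 2 else (q : ℂ) ^ 2) := by
  have hq' : (q : ℂ) ≠ 0 := by exact_mod_cast hq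
  set d : Fin N → ℂ := fun i => if i ∈ X then ((q : ℂ)⁻¹) ^ 2 else (q : ℂ) ^ 2 with hd
  have h := prod_one_sub_ordered (univ : Finset (Fin N)) (fun i => 1 - d i)
  simp only [sub_sub_cancel] at h
  rw [h, sub_sub_cancel, mul_sum]
  refine sum_congr rfl fun y _ => ?_
  have h2 : leftWeight q y X ^ 2 = ∏ j with j < y, d j := by
    rw [leftWeight, ← prod_pow]
    refine prod_congr (by ext; simp) fun i _ => ?_
    simp only [hd]
    split_ifs <;> rfl
  rw [h2, hd]
  dsimp only
  split_ifs
  · field_simp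
    ring
  · field_simp

/-- The commutation relation of the raising and the lowering operator. -/
theorem opE_opF {q : ℝ} (hq0 : 0 < q) (hq1 : q < 1) {N : ℕ} (v : SpinChain N) :
    opE q N (opF q N v) = (q : ℂ)⁻¹ ^ 2 • opF q N (opE q N v) +
      (1 - (q : ℂ) ^ 2)⁻¹ • (v - opK q N 2 v) := by
  have hq2 : 1 - (q : ℂ) ^ 2 ≠ 0 := by
    rw [sub_ne_zero]
    norm_cast
    nlinarith
  ext X
  have hK : opK q N 2 v X = (∏ i, if i ∈ X then ((q : ℂ)⁻¹) ^ 2 else (q : ℂ) ^ 2) * v X := by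
    simp only [opK, diagOp, LinearMap.coe_mk, AddHom.coe_mk]
    congr 1
    refine prod_congr rfl fun i _ => ?_
    rw [Real.rpow_neg hq0.le, show (2 : ℝ) = ((2 : ℕ) : ℝ) by norm_num, Real.rpow_natCast]
    push_cast
    rw [inv_pow]
  simp only [PiLp.add_apply, PiLp.smul_apply, PiLp.sub_apply, smul_eq_mul, hK]
  rw [← one_sub_mul, ← mul_assoc, ← sum_sq_leftWeight hq0.ne' hq2, sum_mul]
  rw [opE_apply, opF_apply]
  simp only [opE_apply, opF_apply]
  -- For `w ≠ y` the terms of `E F` and `q⁻² F E` agree by `leftWeight_exchange`. For `w = y`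
  -- occupied, `E F` has no term, and the negative entry cancels the diagonal part of `q⁻² F E`; for
  -- `w = y` vacant only `E F` contributes.
  have key : ∀ y w : Fin N,
      (if y ∈ X then 0 else leftWeight q y X * if w ∈ insert y X then
        leftWeight q w (insert y X) * v ((insert y X).erase w) else 0) =
      (q : ℂ)⁻¹ ^ 2 * (if w ∈ X then leftWeight q w X * (if y ∈ X.erase w then 0 else
        leftWeight q y (X.erase w) * v (insert y (X.erase w))) else 0) +
      if w = y then (if y ∈ X then -((q : ℂ)⁻¹ ^ 2 * leftWeight q y X ^ 2) else
        leftWeight q y X ^ 2) * v X else 0 := by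
    intro y w
    rcases eq_or_ne w y with rfl | hne
    · by_cases hw : w ∈ X
      · have : leftWeight q w X = leftWeight q w (X.erase w) := by
          conv_lhs => rw [← insert_erase hw]
          rw [leftWeight_insert_of_le le_rfl]
        simp only [hw, if_true, notMem_erase, if_false, insert_erase, ← this]
        ring
      · simp only [hw, if_false, mem_insert_self, if_true, erase_insert hw,
          leftWeight_insert_of_le le_rfl]
        ring
    · by_cases hw : w ∈ X
      · by_cases hy : y ∈ X
        · simp [hw, hy, hne, hne.symm]
        · have := leftWeight_exchange hq0.ne' hy hw
          simp only [hw, hy, hne, mem_insert, mem_erase, if_true, if_false, or_true, and_false,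
            add_zero, erase_insert_of_ne hne.symm]
          linear_combination this * v (insert y (X.erase w))
      · simp [hw, hne]
  have h1 : ∀ y : Fin N, (if y ∈ X then 0 else leftWeight q y X * ∑ w, if w ∈ insert y X then
        leftWeight q w (insert y X) * v ((insert y X).erase w) else 0) =
      ∑ w, ((q : ℂ)⁻¹ ^ 2 * (if w ∈ X then leftWeight q w X * (if y ∈ X.erase w then 0 else
        leftWeight q y (X.erase w) * v (insert y (X.erase w))) else 0) +
      if w = y then (if y ∈ X then -((q : ℂ)⁻¹ ^ 2 * leftWeight q y X ^ 2) else
        leftWeight q y X ^ 2) * v X else 0) := by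
    intro y
    simp only [← key]
    split_ifs
    · simp
    · rw [mul_sum]
  simp only [h1, sum_add_distrib, ← mul_sum]
  congr 1
  · rw [sum_comm]
    congr 1
    refine sum_congr rfl fun w _ => ?_
    split_ifs
    · rw [mul_sum]
    · simp
  · simp

/-! ### Scalar products of descendants of highest weight vectors -/

/-- The vector `v` has `m` down spins. -/
def InSector {N : ℕ} (m : ℕ) (v : SpinChain N) : Prop := ∀ X, #X ≠ m → v X = 0

theorem opK_of_inSector {q : ℝ} (hq : 0 < q) {N m : ℕ} {v : SpinChain N} (hv : InSector m v)
    (s : ℝ) : opK q N s v = ((q ^ (s * (N - 2 * m)) : ℝ) : ℂ) • v := by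
  ext X
  rw [opK_apply hq, PiLp.smul_apply, smul_eq_mul]
  by_cases h : #X = m
  · rw [h]
  · rw [hv X h, mul_zero, mul_zero]

theorem InSector.opF {q : ℝ} {N m : ℕ} {v : SpinChain N} (hv : InSector m v) :
    InSector (m + 1) (opF q N v) := by
  intro X hX
  rw [opF_apply]
  refine sum_eq_zero fun y _ => ?_
  split_ifs with h
  · rw [hv, mul_zero]
    rw [card_erase_of_mem h]
    have := card_pos.2 ⟨y, h⟩
    omega
  · rfl

theorem InSector.opF_pow {q : ℝ} {N m : ℕ} {v : SpinChain N} (hv : InSector m v) (p : ℕ) :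
    InSector (m + p) ((XXZ.opF q N ^ p) v) := by
  induction p with
  | zero => simpa using hv
  | succ p ih =>
    rw [pow_succ', Module.End.mul_apply]
    exact ih.opF

theorem InSector.opE {q : ℝ} {N m : ℕ} {v : SpinChain N} (hv : InSector (m + 1) v) :
    InSector m (opE q N v) := by
  intro X hX
  rw [opE_apply]
  refine sum_eq_zero fun y _ => ?_
  split_ifs with h
  · rfl
  · rw [hv, mul_zero]
    rw [card_insert_of_notMem h]
    omega

/-- The factor in `E F^{p+1} v = c F^p v` for a highest weight vector `v` with `K v = q^h v`. -/
def raiseCoeff (q : ℝ) (h : ℤ) (p : ℕ) : ℂ :=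
  (q : ℂ)⁻¹ ^ (2 * p) * ((1 - (q : ℂ) ^ (2 * (p + 1))) / (1 - (q : ℂ) ^ 2)) *
    ((1 - (q : ℂ) ^ (2 * (h - p))) / (1 - (q : ℂ) ^ 2))

theorem sub_smul_self {E : Type*} [AddCommGroup E] [Module ℂ E] (c : ℂ) (v : E) :
    v - c • v = (1 - c) • v := by
  rw [sub_smul, one_smul]

/-- With `h = N - 2m`, the vector `F^{p+1} v` has the `K²`-eigenvalue `q^{2(h - 2(p+1))}`. The
commutation relation gives `c_{p+1} = q⁻² c_p + (1 - q^{2(h - 2(p+1))}) / (1 - q²)`, and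
`raiseCoeff` is the closed form of this recursion. -/
theorem opE_opF_pow {q : ℝ} (hq0 : 0 < q) (hq1 : q < 1) {N m : ℕ} {v : SpinChain N}
    (hv : InSector m v) (hE : opE q N v = 0) (p : ℕ) :
    opE q N ((opF q N ^ (p + 1)) v) = raiseCoeff q (N - 2 * m) p • (opF q N ^ p) v := by
  have hq' : (q : ℂ) ≠ 0 := by exact_mod_cast hq0.ne'
  have hq2 : 1 - (q : ℂ) ^ 2 ≠ 0 := by
    rw [sub_ne_zero]
    norm_cast
    nlinarith
  have hK : ∀ p : ℕ, opK q N 2 ((opF q N ^ p) v) =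
      (q : ℂ) ^ (2 * ((N : ℤ) - 2 * m - 2 * p)) • (opF q N ^ p) v := by
    intro p
    rw [opK_of_inSector hq0 (hv.opF_pow p)]
    congr 1
    rw [← Complex.ofReal_zpow, ← Real.rpow_intCast]
    congr 2
    push_cast
    ring
  induction p with
  | zero =>
    have := hK 0
    rw [pow_zero, Module.End.one_apply] at this
    rw [zero_add, pow_one, opE_opF hq0 hq1, hE, map_zero, smul_zero, zero_add, this, pow_zero,
      Module.End.one_apply, raiseCoeff]
    simp only [Nat.cast_zero, mul_zero, sub_zero, zero_add, mul_one, pow_zero, one_mul,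
      div_self hq2]
    rw [sub_smul_self, smul_smul]
    congr 1
    ring
  | succ p ih =>
    rw [pow_succ', Module.End.mul_apply, opE_opF hq0 hq1, ih, map_smul, ← Module.End.mul_apply,
      ← pow_succ', hK, sub_smul_self, smul_smul, smul_smul, ← add_smul]
    congr 1
    set h : ℤ := (N : ℤ) - 2 * m
    have e1 : (q : ℂ) ^ (2 * (h - 2 * ((p + 1 : ℕ) : ℤ))) =
        (q : ℂ) ^ (2 * h) * (q : ℂ)⁻¹ ^ (2 * p) * (q : ℂ)⁻¹ ^ (2 * p) * (q : ℂ)⁻¹ ^ 4 := by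
      rw [← zpow_natCast, ← zpow_natCast, inv_zpow, inv_zpow, ← zpow_neg, ← zpow_neg,
        ← zpow_add₀ hq', ← zpow_add₀ hq', ← zpow_add₀ hq']
      congr 1
      push_cast
      ring
    have e2 : (q : ℂ) ^ (2 * (h - (p : ℤ))) = (q : ℂ) ^ (2 * h) * (q : ℂ)⁻¹ ^ (2 * p) := by
      rw [← zpow_natCast, inv_zpow, ← zpow_neg, ← zpow_add₀ hq']
      congr 1
      push_cast
      ring
    have e3 : (q : ℂ) ^ (2 * (h - ((p + 1 : ℕ) : ℤ))) =
        (q : ℂ) ^ (2 * h) * (q : ℂ)⁻¹ ^ (2 * p) * (q : ℂ)⁻¹ ^ 2 := by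
      rw [← zpow_natCast, ← zpow_natCast, inv_zpow, inv_zpow, ← zpow_neg, ← zpow_neg,
        ← zpow_add₀ hq', ← zpow_add₀ hq']
      congr 1
      push_cast
      ring
    have e4 : (q : ℂ) ^ (2 * (p + 1)) = (q : ℂ) ^ (2 * p) * (q : ℂ) ^ 2 := by ring
    have e5 : (q : ℂ) ^ (2 * (p + 1 + 1)) = (q : ℂ) ^ (2 * p) * (q : ℂ) ^ 4 := by ring
    have e6 : (q : ℂ)⁻¹ ^ (2 * (p + 1)) = (q : ℂ)⁻¹ ^ (2 * p) * (q : ℂ)⁻¹ ^ 2 := by ring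
    rw [raiseCoeff, raiseCoeff, e1, e2, e3, e4, e5, e6]
    have hp : (q : ℂ)⁻¹ ^ (2 * p) = ((q : ℂ) ^ (2 * p))⁻¹ := inv_pow _ _
    have hpne : (q : ℂ) ^ (2 * p) ≠ 0 := pow_ne_zero _ hq'
    rw [hp]
    generalize (q : ℂ) ^ (2 * p) = t at *
    generalize (q : ℂ) ^ (2 * h) = k at *
    field_simp
    ring

theorem opE_pow_opF_pow {q : ℝ} (hq0 : 0 < q) (hq1 : q < 1) {N m : ℕ} {v : SpinChain N}
    (hv : InSector m v) (hE : opE q N v = 0) (p : ℕ) :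
    (opE q N ^ p) ((opF q N ^ p) v) =
      (∏ i ∈ range p, raiseCoeff q (N - 2 * m) i) • v := by
  induction p with
  | zero => simp
  | succ p ih =>
    rw [pow_succ (opE q N), Module.End.mul_apply, opE_opF_pow hq0 hq1 hv hE, map_smul, ih,
      smul_smul, prod_range_succ, mul_comm]

theorem opE_pow_opF_pow_of_lt {q : ℝ} (hq0 : 0 < q) (hq1 : q < 1) {N m : ℕ} {v : SpinChain N}
    (hv : InSector m v) (hE : opE q N v = 0) {p p' : ℕ} (h : p < p') :
    (opE q N ^ p') ((opF q N ^ p) v) = 0 := by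
  obtain ⟨d, rfl⟩ : ∃ d, p' = d + 1 + p := ⟨p' - p - 1, by omega⟩
  rw [pow_add, Module.End.mul_apply, opE_pow_opF_pow hq0 hq1 hv hE, map_smul, pow_succ,
    Module.End.mul_apply, hE, map_zero, smul_zero]

/-- The descendant `q^{p(p-1)/2} / [p]_{q²}! K^{-p/2} F^p v`. -/
def descendant (q : ℝ) (N p : ℕ) (v : SpinChain N) : SpinChain N :=
  ((q ^ p.choose 2 / qFactorial (q ^ 2) p : ℝ) : ℂ) •
    opK q N (-(p : ℝ) / 2) ((opF q N ^ p) v)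

theorem qFactorial_ne_zero {q : ℝ} (hq0 : 0 < q) (hq1 : q < 1) (p : ℕ) :
    qFactorial (q ^ 2) p ≠ 0 := by
  refine prod_ne_zero_iff.2 fun i _ => div_ne_zero ?_ ?_
  · have : (q ^ 2) ^ (i + 1) < 1 := pow_lt_one₀ (by positivity) (by nlinarith) (by omega)
    linarith
  · nlinarith

theorem kacOp_of_inSector {q : ℝ} (hq0 : 0 < q) {N m : ℕ} {v : SpinChain N}
    (hv : InSector m v) (p : ℕ) :
    kacOp q N p v = ((q : ℂ) ^ (-(p : ℤ) * (N - 2 * m)) * ∏ k ∈ range p,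
      (1 - (q : ℂ) ^ (2 * ((N : ℤ) - 2 * m) - 2 * p + 2 * (k + 1))) / (1 - (q : ℂ) ^ 2)) • v := by
  have hq' : (q : ℂ) ≠ 0 := by exact_mod_cast hq0.ne'
  have hK : ∀ s : ℤ, opK q N s v = (q : ℂ) ^ (s * ((N : ℤ) - 2 * m)) • v := by
    intro s
    rw [opK_of_inSector hq0 hv, ← Complex.ofReal_zpow, ← Real.rpow_intCast]
    congr 3
    push_cast
    ring
  have hprod : ∀ n : ℕ, (((List.range n).map fun k : ℕ => (1 - (q : ℂ) ^ 2)⁻¹ •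
      (1 - (q : ℂ) ^ (-2 * (p : ℤ) + 2 * ((k : ℤ) + 1)) • opK q N 2)).prod :
      Module.End ℂ (SpinChain N)) v =
      (∏ k ∈ range n, (1 - (q : ℂ) ^ (2 * ((N : ℤ) - 2 * m) - 2 * p + 2 * (k + 1))) /
        (1 - (q : ℂ) ^ 2)) • v := by
    intro n
    induction n with
    | zero => simp
    | succ n ih =>
      have h2 := hK 2
      rw [Int.cast_ofNat] at h2
      rw [List.range_succ, List.map_append, List.prod_append, Module.End.mul_apply]
      simp only [List.map_cons, List.map_nil, List.prod_cons, List.prod_nil, mul_one,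
        LinearMap.smul_apply, LinearMap.sub_apply, Module.End.one_apply, h2, smul_smul,
        ← zpow_add₀ hq', sub_smul_self]
      rw [map_smul, ih, smul_smul, prod_range_succ]
      congr 1
      rw [mul_comm, div_eq_mul_inv, mul_comm ((1 - (q : ℂ) ^ 2)⁻¹)]
      congr 4
      ring
  have h1 := hK (-(p : ℤ))
  push_cast at h1
  simp only [kacOp, List.bind_eq_flatMap, List.pure_def, ← List.map_eq_flatMap, List.map_map,
    Function.comp_def]
  rw [Module.End.mul_apply, hprod, map_smul, h1, smul_smul, mul_comm]

/-- All `F` on one side become `E` on the other. If there are more `E` than `F`, the product reaches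
a highest weight vector with an `E` left over and vanishes; in the opposite case the roles of the
two vectors are exchanged. For equal numbers only the scalars `raiseCoeff` remain to be matched with
the eigenvalue of `kacOp`. -/
theorem inner_descendant {q : ℝ} (hq0 : 0 < q) (hq1 : q < 1) {N m m' : ℕ} {v v' : SpinChain N}
    (hv : InSector m v) (hE : opE q N v = 0) (hv' : InSector m' v') (hE' : opE q N v' = 0)
    (p p' : ℕ) :
    inner ℂ (descendant q N p' v') (descendant q N p v) =
      if p = p' then ((q ^ (2 * p ^ 2) / qFactorial (q ^ 2) p : ℝ) : ℂ) *
        inner ℂ v' (kacOp q N p v) else 0 := by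
  have hq' : (q : ℂ) ≠ 0 := by exact_mod_cast hq0.ne'
  simp only [descendant]
  rw [inner_smul_left, inner_smul_right, inner_opK, opK_of_inSector hq0 (hv.opF_pow p), map_smul,
    opK_of_inSector hq0 (hv.opF_pow p), inner_smul_right, inner_smul_right, inner_opF_pow,
    Complex.conj_ofReal]
  rcases lt_trichotomy p p' with h | rfl | h
  · rw [opE_pow_opF_pow_of_lt hq0 hq1 hv hE h, if_neg h.ne]
    simp
  · rw [if_pos rfl, opE_pow_opF_pow hq0 hq1 hv hE, kacOp_of_inSector hq0 hv, inner_smul_right,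
      inner_smul_right]
    simp only [← mul_assoc]
    congr 1
    have hfac : ((qFactorial (q ^ 2) p : ℝ) : ℂ) =
        ∏ i ∈ range p, (1 - (q : ℂ) ^ (2 * (i + 1))) / (1 - (q : ℂ) ^ 2) := by
      rw [qFactorial]
      push_cast
      exact prod_congr rfl fun i _ => by rw [pow_mul]
    have hfne : ((qFactorial (q ^ 2) p : ℝ) : ℂ) ≠ 0 := by
      exact_mod_cast qFactorial_ne_zero hq0 hq1 p
    have hcoef : ∏ i ∈ range p, raiseCoeff q (N - 2 * m) i =
        (q : ℂ)⁻¹ ^ (2 * p.choose 2) * (qFactorial (q ^ 2) p : ℝ) *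
          ∏ k ∈ range p, (1 - (q : ℂ) ^ (2 * ((N : ℤ) - 2 * m) - 2 * p + 2 * (k + 1))) /
            (1 - (q : ℂ) ^ 2) := by
      -- The exponents `2(h - i)` in `raiseCoeff` decrease while those in `kacOp` increase; they
      -- match under `k = p - 1 - i`.
      rw [hfac, ← prod_range_reflect (fun k : ℕ =>
        (1 - (q : ℂ) ^ (2 * ((N : ℤ) - 2 * m) - 2 * p + 2 * (k + 1))) / (1 - (q : ℂ) ^ 2))]
      simp only [raiseCoeff, prod_mul_distrib]
      rw [prod_pow_eq_pow_sum, ← mul_sum, sum_range_id, Nat.choose_two_right]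
      congr 1
      refine prod_congr rfl fun i hi => ?_
      rw [mem_range] at hi
      congr 3
      have : ((p - 1 - i : ℕ) : ℤ) = p - 1 - i := by omega
      rw [this]
      ring
    have hrp : ((q ^ (-(p : ℝ) / 2 * (N - 2 * ((m + p : ℕ) : ℝ))) : ℝ) : ℂ) *
        ((q ^ (-(p : ℝ) / 2 * (N - 2 * ((m + p : ℕ) : ℝ))) : ℝ) : ℂ) =
        (q : ℂ) ^ (2 * p ^ 2) * (q : ℂ) ^ (-(p : ℤ) * (N - 2 * m)) := by
      rw [← Complex.ofReal_mul, ← Real.rpow_add hq0, ← zpow_natCast, ← zpow_add₀ hq',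
        ← Complex.ofReal_zpow, ← Real.rpow_intCast]
      congr 2
      push_cast
      ring
    rw [hcoef]
    push_cast
    set R := (qFactorial (q ^ 2) p : ℝ)
    -- The two prefactors `q^{p(p-1)/2}` cancel the power of `q` in `hcoef`, one `q`-factorial
    -- cancels, and the two factors `K^{-p/2}` supply `q^{2p²}` times the eigenvalue of `K^{-p}`.
    calc _ = ((q : ℂ) ^ p.choose 2 * (q : ℂ) ^ p.choose 2 * (q : ℂ)⁻¹ ^ (2 * p.choose 2)) *
          ((R : ℂ) / (R : ℂ)) / R * (((q ^ (-(p : ℝ) / 2 * (N - 2 * ((m + p : ℕ) : ℝ))) : ℝ) : ℂ) *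
        ((q ^ (-(p : ℝ) / 2 * (N - 2 * ((m + p : ℕ) : ℝ))) : ℝ) : ℂ)) *
          ∏ k ∈ range p, (1 - (q : ℂ) ^ (2 * ((N : ℤ) - 2 * m) - 2 * p + 2 * (k + 1))) /
            (1 - (q : ℂ) ^ 2) := by push_cast; ring
      _ = _ := by
        rw [hrp, div_self hfne, ← pow_add, ← two_mul, inv_pow, mul_inv_cancel₀ (pow_ne_zero _ hq')]
        ring
  · rw [if_neg h.ne', ← inner_opF_pow, ← inner_conj_symm, inner_opF_pow,
      opE_pow_opF_pow_of_lt hq0 hq1 hv' hE' h]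
    simp

/-! ### Sums over permutations -/

/-- A finite sequence, continued by zero. -/
def extendSeq {m : ℕ} (u : Fin m → ℂ) (i : ℕ) : ℂ := if h : i < m then u ⟨i, h⟩ else 0

theorem extendSeq_val {m : ℕ} (u : Fin m → ℂ) (i : Fin m) : extendSeq u i = u i := by
  simp [extendSeq]

theorem extendSeq_of_lt {m : ℕ} (u : Fin m → ℂ) {i : ℕ} (h : i < m) :
    extendSeq u i = u ⟨i, h⟩ := by
  simp [extendSeq, h]

theorem extendSeq_comp_swap {m : ℕ} (u : Fin m → ℂ) {a : ℕ} (ha : a + 1 < m) :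
    extendSeq u ∘ Equiv.swap a (a + 1) =
      extendSeq (u ∘ Equiv.swap ⟨a, by omega⟩ ⟨a + 1, ha⟩) := by
  funext i
  by_cases hi : i < m
  · rw [extendSeq_of_lt _ hi, Function.comp_apply, Function.comp_apply]
    have : ((Equiv.swap (⟨a, by omega⟩ : Fin m) ⟨a + 1, ha⟩ ⟨i, hi⟩ : Fin m) : ℕ) =
        Equiv.swap a (a + 1) i := by
      simp only [Equiv.swap_apply_def, Fin.ext_iff]
      split_ifs <;> rfl
    rw [← this, extendSeq_val]
  · rw [Function.comp_apply, Equiv.swap_apply_of_ne_of_ne (by omega) (by omega), extendSeq,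
      dif_neg hi, extendSeq, dif_neg hi]

theorem rank_orderEmbOfFin {m : ℕ} {X : Finset ℤ} (h : #X = m) (i : Fin m) :
    rank X (X.orderEmbOfFin h i) = i := by
  have : {x ∈ X | x < X.orderEmbOfFin h i} = (Iio i).map (X.orderEmbOfFin h).toEmbedding := by
    ext x
    simp only [mem_filter, mem_map, mem_Iio, RelEmbedding.coe_toEmbedding]
    constructor
    · rintro ⟨hx, hlt⟩
      obtain ⟨j, rfl⟩ : x ∈ Set.range (X.orderEmbOfFin h) := by
        rw [range_orderEmbOfFin]; exact hx
      exact ⟨j, by simpa using hlt, rfl⟩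
    · rintro ⟨j, hj, rfl⟩
      exact ⟨orderEmbOfFin_mem _ _ _, by simpa using hj⟩
  rw [rank, this, card_map, Fin.card_Iio]

theorem prod_orderEmbOfFin {m : ℕ} {X : Finset ℤ} (h : #X = m) (u : Fin m → ℂ) :
    ∏ i, u i ^ X.orderEmbOfFin h i = planeWave (extendSeq u) X := by
  have : X = univ.map (X.orderEmbOfFin h).toEmbedding := by
    rw [map_eq_image]
    exact (image_orderEmbOfFin_univ X h).symm
  rw [planeWave]
  conv_rhs => rw [prod_congr this fun _ _ => rfl]
  rw [prod_map]
  refine prod_congr rfl fun i _ => ?_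
  simp only [RelEmbedding.coe_toEmbedding]
  rw [rank_orderEmbOfFin, extendSeq_val]

/-- The product of a two-body factor over all pairs, before and after an exchange of
neighbours. -/
theorem exists_prod_pairs_swap {m : ℕ} (κ : ℂ → ℂ → ℂ) (u : Fin m → ℂ) {a b : Fin m}
    (hab : (b : ℕ) = a + 1) :
    ∃ P, ∏ i, ∏ j ∈ Ioi i, κ (u i) (u j) = κ (u a) (u b) * P ∧
      ∏ i, ∏ j ∈ Ioi i, κ ((u ∘ Equiv.swap a b) i) ((u ∘ Equiv.swap a b) j) =
        κ (u b) (u a) * P := by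
  set S : Finset (Σ _ : Fin m, Fin m) := univ.sigma fun i => Ioi i with hS
  have hmem : (⟨a, b⟩ : Σ _ : Fin m, Fin m) ∈ S := by
    simp only [hS, mem_sigma, mem_univ, mem_Ioi, true_and, Fin.lt_def]
    omega
  refine ⟨∏ p ∈ S.erase ⟨a, b⟩, κ (u p.1) (u p.2), ?_, ?_⟩
  · rw [prod_sigma', mul_prod_erase S (fun p => κ (u p.1) (u p.2)) hmem]
  · rw [prod_sigma', ← mul_prod_erase S _ hmem]
    simp only [Function.comp_apply, Equiv.swap_apply_left, Equiv.swap_apply_right]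
    congr 1
    -- Since `a` and `b` are neighbours, the transposition permutes the ordered pairs other than
    -- `(a, b)` among themselves.
    refine prod_nbij' (fun p => ⟨Equiv.swap a b p.1, Equiv.swap a b p.2⟩)
      (fun p => ⟨Equiv.swap a b p.1, Equiv.swap a b p.2⟩) ?_ ?_ (by simp) (by simp) (by simp)
    all_goals
      rintro ⟨i, j⟩ h
      simp only [hS, mem_erase, ne_eq, Sigma.mk.injEq, heq_eq_eq, mem_sigma, mem_univ, mem_Ioi,
        true_and, Fin.lt_def, Fin.ext_iff, Equiv.swap_apply_def] at h ⊢
      split_ifs <;> omega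

/-! ### Bethe vectors of the finite chain are highest weight vectors -/

/-- The two-body factor of the finite chain. -/
def finitePair (q : ℝ) (x y : ℂ) : ℂ := scatB q x⁻¹ y * y⁻¹

theorem finitePair_eq {q : ℝ} {x y : ℂ} (hx : x ≠ 0) (hy : y ≠ 0) :
    finitePair q x y = (x⁻¹ + y⁻¹ - 2 * anisotropy q) * pairFactor q x y := by
  rw [finitePair, scatB, pairFactor, inv_inv]
  field_simp
  ring

/-- The pair factor equals `x (x⁻¹ + y⁻¹ - 2Δ)(x⁻¹ + y - 2Δ)`. Because of this symmetry, the terms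
at the right end of the chain cancel without any use of the Bethe equations. -/
theorem finitePair_inv_right {q : ℝ} {x y : ℂ} (hx : x ≠ 0) (hy : y ≠ 0) :
    finitePair q x y⁻¹ = finitePair q x y := by
  rw [finitePair_eq hx hy, finitePair_eq hx (inv_ne_zero hy), pairFactor, pairFactor, inv_inv]
  field_simp
  ring

/-- The amplitude of the finite wave function. -/
def finiteAmplitude (q : ℝ) (N : ℕ) {m : ℕ} (u : Fin m → ℂ) : ℂ :=
  (∏ i, (1 - q * u i) * u i ^ (-(N : ℤ))) * ∏ i, ∏ l ∈ Ioi i, finitePair q (u i) (u l)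

/-- The momenta after a permutation and reflections. -/
def reflected {m : ℕ} (z : Fin m → ℂ) (w : Equiv.Perm (Fin m) × (Fin m → ℤˣ)) (i : Fin m) : ℂ :=
  z (w.1 i) ^ ((w.2 i : ℤˣ) : ℤ)

/-- The sign of a permutation with reflections. -/
def reflectedSign {m : ℕ} (w : Equiv.Perm (Fin m) × (Fin m → ℤˣ)) : ℂ :=
  ((Equiv.Perm.sign w.1 * ∏ i, w.2 i : ℤˣ) : ℂ)

theorem reflected_ne_zero {m : ℕ} {z : Fin m → ℂ} (hz : ∀ j, ‖z j‖ = 1)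
    (w : Equiv.Perm (Fin m) × (Fin m → ℤˣ)) (i : Fin m) : reflected z w i ≠ 0 :=
  zpow_ne_zero _ fun h => by simpa [h] using hz (w.1 i)

theorem norm_reflected {m : ℕ} {z : Fin m → ℂ} (hz : ∀ j, ‖z j‖ = 1)
    (w : Equiv.Perm (Fin m) × (Fin m → ℤˣ)) (i : Fin m) : ‖reflected z w i‖ = 1 := by
  rw [reflected, norm_zpow, hz, one_zpow]

theorem one_sub_mul_ne_zero {q : ℝ} (hq0 : 0 < q) (hq1 : q < 1) {x : ℂ} (hx : ‖x‖ = 1) :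
    1 - q * x ≠ 0 := by
  intro h
  have : (1 : ℂ) = q * x := by linear_combination h
  have h2 := congrArg norm this
  rw [norm_mul, hx, norm_one, Complex.norm_real, Real.norm_of_nonneg hq0.le] at h2
  linarith

/-- On the unit circle a zero would force `2Δ = ‖1 + x y‖ ≤ 2`, whereas `q + q⁻¹ > 2`. -/
theorem pairFactor_ne_zero {q : ℝ} (hq0 : 0 < q) (hq1 : q < 1) {x y : ℂ} (hx : ‖x‖ = 1)
    (hy : ‖y‖ = 1) : pairFactor q x y ≠ 0 := by
  intro h
  have h1 : ((q + q⁻¹ : ℝ) : ℂ) * x = 1 + x * y := by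
    rw [pairFactor, anisotropy] at h
    push_cast
    linear_combination -h
  have h2 := congrArg norm h1
  have h3 : 2 < q + q⁻¹ := by
    have : 0 < (1 - q) ^ 2 / q := div_pos (pow_pos (by linarith) 2) hq0
    have h4 : (1 - q) ^ 2 / q = q + q⁻¹ - 2 := by field_simp; ring
    linarith
  have h5 : ‖1 + x * y‖ ≤ 2 := by
    refine (norm_add_le _ _).trans ?_
    rw [norm_mul, hx, hy, norm_one]
    norm_num
  rw [norm_mul, hx, mul_one, Complex.norm_real, Real.norm_of_nonneg (by linarith)] at h2
  linarith

theorem scatB_eq (q : ℝ) (a b : ℂ) :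
    scatB q a b = pairFactor q b a * pairFactor q a⁻¹ b := by
  rw [scatB, pairFactor, pairFactor]
  ring

theorem scatB_ne_zero {q : ℝ} (hq0 : 0 < q) (hq1 : q < 1) {x y : ℂ} (hx : ‖x‖ = 1)
    (hy : ‖y‖ = 1) : scatB q x y ≠ 0 := by
  rw [scatB_eq]
  exact mul_ne_zero (pairFactor_ne_zero hq0 hq1 hy hx)
    (pairFactor_ne_zero hq0 hq1 (by rw [norm_inv, hx, inv_one]) hy)

theorem scatB_inv_right {q : ℝ} {a b : ℂ} (ha : a ≠ 0) (hb : b ≠ 0) :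
    scatB q a b⁻¹ = b⁻¹ ^ 2 * scatB q a b := by
  rw [scatB, scatB]
  field_simp
  ring

theorem scatB_div_inv_right {q : ℝ} {a b : ℂ} (ha : a ≠ 0) (hb : b ≠ 0) :
    scatB q a⁻¹ b⁻¹ / scatB q a b⁻¹ = scatB q a⁻¹ b / scatB q a b := by
  rw [scatB_inv_right (inv_ne_zero ha) hb, scatB_inv_right ha hb,
    mul_div_mul_left _ _ (pow_ne_zero _ (inv_ne_zero hb))]

/-- The Bethe equations are invariant under permutations and reflections. -/
theorem IsBetheSolution.reflected {q : ℝ} {N m : ℕ} {z : Fin m → ℂ}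
    (hz : IsBetheSolution q N z) (w : Equiv.Perm (Fin m) × (Fin m → ℤˣ)) (j : Fin m) :
    reflected z w j ^ (2 * N) = ∏ l ∈ univ.erase j,
      scatB q (reflected z w j)⁻¹ (reflected z w l) / scatB q (reflected z w j)
        (reflected z w l) := by
  have hne : ∀ i, z i ≠ 0 := fun i h => by simpa [h] using hz.1 i
  have h1 : ∀ l, scatB q (XXZ.reflected z w j)⁻¹ (XXZ.reflected z w l) /
      scatB q (XXZ.reflected z w j) (XXZ.reflected z w l) =
      scatB q (XXZ.reflected z w j)⁻¹ (z (w.1 l)) /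
        scatB q (XXZ.reflected z w j) (z (w.1 l)) := by
    intro l
    have hj := reflected_ne_zero hz.1 w j
    conv_lhs => rw [show XXZ.reflected z w l = z (w.1 l) ^ ((w.2 l : ℤˣ) : ℤ) from rfl]
    rcases Int.units_eq_one_or (w.2 l) with h | h <;> rw [h]
    · simp
    · simp only [Units.val_neg, Units.val_one, zpow_neg, zpow_one]
      exact scatB_div_inv_right hj (hne _)
  simp only [h1]
  have h2 : ∀ g : ℂ → ℂ, ∏ l ∈ univ.erase j, g (z (w.1 l)) =
      ∏ l ∈ univ.erase (w.1 j), g (z l) := by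
    intro g
    refine prod_bij (fun l _ => w.1 l) (by simp) (by simp) ?_ (by simp)
    intro b hb
    exact ⟨w.1.symm b, by simpa [Equiv.symm_apply_eq] using hb, by simp⟩
  rw [h2 fun x => scatB q (XXZ.reflected z w j)⁻¹ x / scatB q (XXZ.reflected z w j) x]
  have h3 := hz.2 (w.1 j)
  rw [show XXZ.reflected z w j = z (w.1 j) ^ ((w.2 j : ℤˣ) : ℤ) from rfl]
  rcases Int.units_eq_one_or (w.2 j) with h | h <;> rw [h]
  · simpa using h3
  · simp only [Units.val_neg, Units.val_one, zpow_neg, zpow_one, inv_pow, h3, inv_inv]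
    rw [← prod_inv_distrib]
    exact prod_congr rfl fun l _ => by rw [inv_div]

theorem finiteWave_eq {q : ℝ} {N m : ℕ} {z : Fin m → ℂ} (hz : ∀ j, ‖z j‖ = 1)
    (x : Fin m → Fin N) :
    finiteWave q N z x = ∑ w : Equiv.Perm (Fin m) × (Fin m → ℤˣ),
      reflectedSign w * finiteAmplitude q N (reflected z w) *
        ∏ i, reflected z w i ^ ((x i : ℕ) : ℤ) := by
  rw [finiteWave, ← Fintype.sum_prod_type' (f := fun π (ε : Fin m → ℤˣ) =>
    ((Equiv.Perm.sign π * ∏ i, ε i : ℤˣ) : ℂ) *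
      finiteTerm q N (fun i => z (π i) ^ ((ε i : ℤˣ) : ℤ)) x)]
  refine sum_congr rfl fun w _ => ?_
  have h : ∀ i, (1 - q * reflected z w i) * reflected z w i ^ (((x i : ℕ) : ℤ) - (N : ℤ)) =
      (1 - q * reflected z w i) * reflected z w i ^ (-(N : ℤ)) *
        reflected z w i ^ ((x i : ℕ) : ℤ) := by
    intro i
    rw [mul_assoc, ← zpow_add₀ (reflected_ne_zero hz w i), neg_add_eq_sub]
  rw [finiteAmplitude, mul_assoc, reflectedSign]
  congr 1
  rw [mul_right_comm, ← prod_mul_distrib]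
  simp only [← h]
  rfl

/-- The coordinates `c, c + 1, …` of the sites. -/
def siteEmb (c : ℤ) (N : ℕ) : Fin N ↪ ℤ where
  toFun i := c + ((i : ℕ) : ℤ)
  inj' i j h := by simpa [Fin.ext_iff] using h

theorem siteEmb_apply (c : ℤ) {N : ℕ} (i : Fin N) : siteEmb c N i = c + ((i : ℕ) : ℤ) := rfl

/-- The set of the sites in `X`, with the coordinates `c, c + 1, …`. -/
def siteSet (c : ℤ) {N : ℕ} (X : Finset (Fin N)) : Finset ℤ := X.map (siteEmb c N)

theorem mem_siteSet {c : ℤ} {N : ℕ} {X : Finset (Fin N)} {y : Fin N} :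
    c + ((y : ℕ) : ℤ) ∈ siteSet c X ↔ y ∈ X := by
  rw [← siteEmb_apply, siteSet, mem_map']

theorem siteSet_insert (c : ℤ) {N : ℕ} (X : Finset (Fin N)) (y : Fin N) :
    siteSet c (insert y X) = insert (c + ((y : ℕ) : ℤ)) (siteSet c X) := by
  rw [siteSet, map_insert]
  rfl

theorem card_siteSet (c : ℤ) {N : ℕ} (X : Finset (Fin N)) : #(siteSet c X) = #X := card_map _

theorem le_of_mem_siteSet {c : ℤ} {N : ℕ} {X : Finset (Fin N)} {x : ℤ} (hx : x ∈ siteSet c X) :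
    c ≤ x := by
  simp only [siteSet, mem_map, siteEmb_apply] at hx
  obtain ⟨i, _, rfl⟩ := hx
  omega

theorem lt_of_mem_siteSet {c : ℤ} {N : ℕ} {X : Finset (Fin N)} {x : ℤ} (hx : x ∈ siteSet c X) :
    x < c + N := by
  simp only [siteSet, mem_map, siteEmb_apply] at hx
  obtain ⟨i, _, rfl⟩ := hx
  have := i.2
  omega

theorem rank_siteSet (c : ℤ) {N : ℕ} (X : Finset (Fin N)) (y : Fin N) :
    rank (siteSet c X) (c + ((y : ℕ) : ℤ)) = #{x ∈ X | x < y} := by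
  rw [rank, siteSet, filter_map, card_map]
  congr 1
  ext x
  simp only [mem_filter, Function.comp_apply, siteEmb_apply, Fin.lt_def]
  exact and_congr_right fun _ => by omega

theorem orderEmbOfFin_siteSet {N m : ℕ} {X : Finset (Fin N)} (h : #X = m) (i : Fin m) :
    (siteSet 0 X).orderEmbOfFin ((card_siteSet 0 X).trans h) i =
      ((X.orderEmbOfFin h i : ℕ) : ℤ) := by
  have := orderEmbOfFin_unique (s := siteSet 0 X) ((card_siteSet 0 X).trans h)
    (f := fun i => ((X.orderEmbOfFin h i : ℕ) : ℤ))
    (fun i => by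
      have := (mem_siteSet (c := 0)).2 (orderEmbOfFin_mem X h i)
      rwa [zero_add] at this)
    (fun i j hij => by
      have := (X.orderEmbOfFin h).strictMono hij
      rw [Fin.lt_def] at this
      exact Int.ofNat_lt.2 this)
  exact (congrFun this i).symm

theorem finiteBethe_apply {q : ℝ} {N m : ℕ} {z : Fin m → ℂ} (hz : ∀ j, ‖z j‖ = 1)
    {X : Finset (Fin N)} (h : #X = m) :
    finiteBethe q N z X = ∑ w : Equiv.Perm (Fin m) × (Fin m → ℤˣ),
      reflectedSign w * finiteAmplitude q N (reflected z w) *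
        planeWave (extendSeq (reflected z w)) (siteSet 0 X) := by
  rw [show finiteBethe q N z X = finiteWave q N z (X.orderEmbOfFin h) from dif_pos h,
    finiteWave_eq hz]
  refine sum_congr rfl fun w _ => ?_
  rw [← prod_orderEmbOfFin ((card_siteSet 0 X).trans h)]
  simp only [orderEmbOfFin_siteSet h]

theorem inSector_finiteBethe (q : ℝ) (N : ℕ) {m : ℕ} (z : Fin m → ℂ) :
    InSector m (finiteBethe q N z) := fun X hX => by
  rw [finiteBethe]
  exact dif_neg hX

/-- The relabelling composes the permutation with an adjacent transposition and carries the
reflections along. The sign changes, the one-particle factors are symmetric, and of the pair factors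
only that of the two neighbours changes. Its part `x⁻¹ + y⁻¹ - 2Δ` is symmetric as well, which
leaves `pairFactor`. -/
theorem scatteringWeights_finite {q : ℝ} {N n : ℕ} {z : Fin (n + 1) → ℂ}
    (hz : ∀ j, ‖z j‖ = 1) :
    ScatteringWeights q n
      (fun w : Equiv.Perm (Fin (n + 1)) × (Fin (n + 1) → ℤˣ) =>
        reflectedSign w * finiteAmplitude q N (reflected z w))
      (fun w => extendSeq (reflected z w)) := by
  intro a ha
  set σ : Equiv.Perm (Fin (n + 1)) := Equiv.swap ⟨a, by omega⟩ ⟨a + 1, by omega⟩ with hσ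
  let τ : Equiv.Perm (Equiv.Perm (Fin (n + 1)) × (Fin (n + 1) → ℤˣ)) :=
    Equiv.prodCongr (Equiv.mulRight σ) (Equiv.arrowCongr σ (Equiv.refl _))
  have hσσ : σ.symm = σ := Equiv.symm_swap _ _
  have hτ : ∀ w, reflected z (τ w) = reflected z w ∘ σ := by
    intro w
    funext i
    simp only [τ, reflected, Equiv.prodCongr_apply, Prod.map_fst, Prod.map_snd,
      Equiv.coe_mulRight, Equiv.Perm.mul_apply, Equiv.arrowCongr_apply, Function.comp_apply,
      Equiv.refl_apply, hσσ]
  have hsign : ∀ w, reflectedSign (τ w) = -reflectedSign w := by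
    intro w
    simp only [τ, reflectedSign, Equiv.prodCongr_apply, Prod.map_fst, Prod.map_snd,
      Equiv.coe_mulRight, Equiv.arrowCongr_apply, Function.comp_apply, Equiv.refl_apply, hσσ,
      Equiv.Perm.sign_mul]
    rw [Equiv.prod_comp σ (fun i => w.2 i), hσ, Equiv.Perm.sign_swap (by simp [Fin.ext_iff])]
    simp
  refine ⟨τ, fun w => ⟨?_, ?_⟩⟩
  · dsimp only
    rw [hτ, extendSeq_comp_swap _ (by omega)]
  · have hu := fun i => reflected_ne_zero hz w i
    obtain ⟨P, h1, h2⟩ := exists_prod_pairs_swap (finitePair q) (reflected z w)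
      (a := ⟨a, by omega⟩) (b := ⟨a + 1, by omega⟩) rfl
    have h3 : ∏ i, (1 - q * reflected z (τ w) i) * reflected z (τ w) i ^ (-(N : ℤ)) =
        ∏ i, (1 - q * reflected z w i) * reflected z w i ^ (-(N : ℤ)) := by
      rw [hτ]
      exact Equiv.prod_comp σ fun i =>
        (1 - q * reflected z w i) * reflected z w i ^ (-(N : ℤ))
    dsimp only
    rw [hsign, finiteAmplitude, finiteAmplitude, h3, hτ, h1, h2, extendSeq_of_lt _ (by omega),
      extendSeq_of_lt _ (by omega), finitePair_eq (hu _) (hu _), finitePair_eq (hu _) (hu _)]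
    ring

/-- The reflection of the momentum number `j`. -/
def reflectAt {m : ℕ} (j : Fin m) : Equiv.Perm (Equiv.Perm (Fin m) × (Fin m → ℤˣ)) where
  toFun w := (w.1, Function.update w.2 j (-w.2 j))
  invFun w := (w.1, Function.update w.2 j (-w.2 j))
  left_inv w := by simp
  right_inv w := by simp

theorem reflected_reflectAt {m : ℕ} (z : Fin m → ℂ) (j : Fin m)
    (w : Equiv.Perm (Fin m) × (Fin m → ℤˣ)) :
    reflected z (reflectAt j w) = Function.update (reflected z w) j (reflected z w j)⁻¹ := by
  funext i
  by_cases h : i = j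
  · subst h
    simp [reflected, reflectAt]
  · simp [reflected, reflectAt, h]

theorem reflectedSign_reflectAt {m : ℕ} (j : Fin m)
    (w : Equiv.Perm (Fin m) × (Fin m → ℤˣ)) :
    reflectedSign (reflectAt j w) = -reflectedSign w := by
  have : ∏ i, Function.update w.2 j (-w.2 j) i = -∏ i, w.2 i := by
    rw [prod_update_of_mem (mem_univ j), ← mul_prod_erase univ w.2 (mem_univ j), neg_mul,
      sdiff_singleton_eq_erase]
  simp [reflectedSign, reflectAt, this]

theorem planeWave_congr {v v' : ℕ → ℂ} {X : Finset ℤ} (h : ∀ i < #X, v i = v' i) :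
    planeWave v X = planeWave v' X :=
  prod_congr rfl fun x hx => by rw [h _ (rank_lt_card hx)]

/-- The factor `1 - q u₀` of the amplitude cancels the denominator. What then depends on `u₀` is
`u₀^{-N} ∏ finitePair u₀ u_l`, and the Bethe equation for `u₀` says exactly that this is unchanged
under `u₀ ↦ u₀⁻¹`. The sign of the reflection makes the terms cancel in pairs. -/
theorem left_boundary_eq_zero {q : ℝ} (hq0 : 0 < q) (hq1 : q < 1) {N n : ℕ}
    {z : Fin (n + 1) → ℂ} (hz : IsBetheSolution q N z) {X : Finset ℤ} (hX : #X = n) :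
    ∑ w : Equiv.Perm (Fin (n + 1)) × (Fin (n + 1) → ℤˣ),
      reflectedSign w * finiteAmplitude q N (reflected z w) *
        (1 / (1 - q * extendSeq (reflected z w) 0) *
          planeWave (fun i => extendSeq (reflected z w) (i + 1)) X) = 0 := by
  refine sum_eq_zero_of_antisymm _ (reflectAt 0) fun w => ?_
  set u := reflected z w with hu
  have hne : ∀ i, u i ≠ 0 := fun i => reflected_ne_zero hz.1 w i
  have hnorm : ∀ i, ‖u i‖ = 1 := fun i => norm_reflected hz.1 w i
  have hne1 : 1 - q * u 0 ≠ 0 := one_sub_mul_ne_zero hq0 hq1 (hnorm 0)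
  have hne2 : 1 - q * (u 0)⁻¹ ≠ 0 :=
    one_sub_mul_ne_zero hq0 hq1 (by rw [norm_inv, hnorm, inv_one])
  have e0 : ∀ f : Fin (n + 1) → ℂ, extendSeq f 0 = f 0 := fun f => extendSeq_val f 0
  have hw : planeWave (fun i => extendSeq (Function.update u 0 (u 0)⁻¹) (i + 1)) X =
      planeWave (fun i => extendSeq u (i + 1)) X := by
    refine planeWave_congr fun i hi => ?_
    rw [extendSeq_of_lt _ (by omega), extendSeq_of_lt _ (by omega),
      Function.update_of_ne (by simp [Fin.ext_iff])]
  have hA : ∀ y : ℂ, 1 - q * y ≠ 0 →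
      finiteAmplitude q N (Function.update u 0 y) * (1 / (1 - q * y)) =
      (y ^ (-(N : ℤ)) * ∏ l ∈ Ioi (0 : Fin (n + 1)), finitePair q y (u l)) *
        ((∏ i ∈ univ.erase (0 : Fin (n + 1)), (1 - q * u i) * u i ^ (-(N : ℤ))) *
          ∏ i ∈ univ.erase (0 : Fin (n + 1)), ∏ l ∈ Ioi i, finitePair q (u i) (u l)) := by
    intro y hy
    rw [finiteAmplitude, ← mul_prod_erase univ _ (mem_univ (0 : Fin (n + 1))),
      ← mul_prod_erase univ (fun i => ∏ l ∈ Ioi i, _) (mem_univ (0 : Fin (n + 1)))]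
    simp only [Function.update_self]
    have h1 : ∏ i ∈ univ.erase (0 : Fin (n + 1)), (1 - q * Function.update u 0 y i) *
        Function.update u 0 y i ^ (-(N : ℤ)) =
        ∏ i ∈ univ.erase (0 : Fin (n + 1)), (1 - q * u i) * u i ^ (-(N : ℤ)) :=
      prod_congr rfl fun i hi => by rw [Function.update_of_ne (ne_of_mem_erase hi)]
    have h2 : ∏ l ∈ Ioi (0 : Fin (n + 1)), finitePair q y (Function.update u 0 y l) =
        ∏ l ∈ Ioi (0 : Fin (n + 1)), finitePair q y (u l) :=
      prod_congr rfl fun i hi => by rw [Function.update_of_ne (mem_Ioi.1 hi).ne']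
    have h3 : ∏ i ∈ univ.erase (0 : Fin (n + 1)), ∏ l ∈ Ioi i,
        finitePair q (Function.update u 0 y i) (Function.update u 0 y l) =
        ∏ i ∈ univ.erase (0 : Fin (n + 1)), ∏ l ∈ Ioi i, finitePair q (u i) (u l) :=
      prod_congr rfl fun i hi => prod_congr rfl fun l hl => by
        rw [Function.update_of_ne (ne_of_mem_erase hi),
          Function.update_of_ne (lt_of_le_of_lt (Fin.zero_le i) (mem_Ioi.1 hl)).ne']
    rw [h1, h2, h3]
    field_simp
  have hbethe : (u 0)⁻¹ ^ (-(N : ℤ)) * ∏ l ∈ Ioi (0 : Fin (n + 1)), finitePair q (u 0)⁻¹ (u l) =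
      u 0 ^ (-(N : ℤ)) * ∏ l ∈ Ioi (0 : Fin (n + 1)), finitePair q (u 0) (u l) := by
    have h := hz.reflected w 0
    rw [← hu] at h
    have hI : univ.erase (0 : Fin (n + 1)) = Ioi 0 := by
      ext i; simp
    have hB : ∏ l ∈ Ioi (0 : Fin (n + 1)), scatB q (u 0) (u l) ≠ 0 :=
      prod_ne_zero_iff.2 fun l _ => scatB_ne_zero hq0 hq1 (hnorm _) (hnorm _)
    rw [hI, prod_div_distrib, eq_div_iff hB] at h
    simp only [finitePair, inv_inv, prod_mul_distrib, ← h]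
    rw [zpow_neg, zpow_neg, zpow_natCast, zpow_natCast, inv_pow, inv_inv]
    have : u 0 ^ N ≠ 0 := pow_ne_zero _ (hne 0)
    field_simp
    ring
  rw [reflectedSign_reflectAt, reflected_reflectAt, ← hu, hw, e0, e0, Function.update_self]
  have h1 := hA (u 0)⁻¹ hne2
  have h2 := hA (u 0) hne1
  rw [hbethe, ← h2, Function.update_eq_self] at h1
  linear_combination (-reflectedSign w * planeWave (fun i => extendSeq u (i + 1)) X) * h1

/-- The amplitude's factor `(1 - q u) u^{-N}` of the last momentum cancels against `u^N / (1 - q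
u)`. The rest depends on `u` only through pair factors with `u` as second argument, which are
invariant under reflection. -/
theorem right_boundary_eq_zero {q : ℝ} (hq0 : 0 < q) (hq1 : q < 1) {N n : ℕ}
    {z : Fin (n + 1) → ℂ} (hz : ∀ j, ‖z j‖ = 1) {X : Finset ℤ} (hX : #X = n) (c : ℂ) :
    ∑ w : Equiv.Perm (Fin (n + 1)) × (Fin (n + 1) → ℤˣ),
      reflectedSign w * finiteAmplitude q N (reflected z w) *
        (c * extendSeq (reflected z w) n ^ (N : ℤ) / (1 - q * extendSeq (reflected z w) n) *
          planeWave (extendSeq (reflected z w)) X) = 0 := by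
  refine sum_eq_zero_of_antisymm _ (reflectAt (Fin.last n)) fun w => ?_
  set u := reflected z w with hu
  have hne : ∀ i, u i ≠ 0 := fun i => reflected_ne_zero hz w i
  have hnorm : ∀ i, ‖u i‖ = 1 := fun i => norm_reflected hz w i
  have hne1 : 1 - q * u (Fin.last n) ≠ 0 := one_sub_mul_ne_zero hq0 hq1 (hnorm _)
  have hne2 : 1 - q * (u (Fin.last n))⁻¹ ≠ 0 :=
    one_sub_mul_ne_zero hq0 hq1 (by rw [norm_inv, hnorm, inv_one])
  have e0 : ∀ f : Fin (n + 1) → ℂ, extendSeq f n = f (Fin.last n) :=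
    fun f => extendSeq_val f (Fin.last n)
  have hw : planeWave (extendSeq (Function.update u (Fin.last n) (u (Fin.last n))⁻¹)) X =
      planeWave (extendSeq u) X := by
    refine planeWave_congr fun i hi => ?_
    rw [extendSeq_of_lt _ (by omega), extendSeq_of_lt _ (by omega),
      Function.update_of_ne (by simp only [ne_eq, Fin.ext_iff, Fin.val_last]; omega)]
  have hA : ∀ y : ℂ, y ≠ 0 → 1 - q * y ≠ 0 →
      (∀ x ≠ 0, finitePair q x y = finitePair q x (u (Fin.last n))) →
      finiteAmplitude q N (Function.update u (Fin.last n) y) * (y ^ (N : ℤ) / (1 - q * y)) =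
      (∏ i ∈ univ.erase (Fin.last n), (1 - q * u i) * u i ^ (-(N : ℤ))) *
          ∏ i, ∏ l ∈ Ioi i, finitePair q (u i) (u l) := by
    intro y hy0 hy hp
    rw [finiteAmplitude, ← mul_prod_erase univ _ (mem_univ (Fin.last n))]
    simp only [Function.update_self]
    have h1 : ∏ i ∈ univ.erase (Fin.last n), (1 - q * Function.update u (Fin.last n) y i) *
        Function.update u (Fin.last n) y i ^ (-(N : ℤ)) =
        ∏ i ∈ univ.erase (Fin.last n), (1 - q * u i) * u i ^ (-(N : ℤ)) :=
      prod_congr rfl fun i hi => by rw [Function.update_of_ne (ne_of_mem_erase hi)]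
    have h3 : ∏ i, ∏ l ∈ Ioi i, finitePair q (Function.update u (Fin.last n) y i)
        (Function.update u (Fin.last n) y l) =
        ∏ i, ∏ l ∈ Ioi i, finitePair q (u i) (u l) :=
      prod_congr rfl fun i _ => prod_congr rfl fun l hl => by
        rw [Function.update_of_ne ((mem_Ioi.1 hl).trans_le (Fin.le_last l)).ne]
        by_cases h : l = Fin.last n
        · rw [h, Function.update_self, hp _ (hne i)]
        · rw [Function.update_of_ne h]
    rw [h1, h3, zpow_neg]
    have : y ^ (N : ℤ) ≠ 0 := zpow_ne_zero _ hy0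
    field_simp
  rw [reflectedSign_reflectAt, reflected_reflectAt, ← hu, hw, e0, e0, Function.update_self]
  have h1 := hA (u (Fin.last n))⁻¹ (inv_ne_zero (hne _)) hne2
    fun x hx => finitePair_inv_right hx (hne _)
  have h2 := hA (u (Fin.last n)) (hne _) hne1 fun _ _ => rfl
  rw [← h2, Function.update_eq_self] at h1
  linear_combination (-reflectedSign w * c * planeWave (extendSeq u) X) * h1

/-- Bethe vectors are annihilated by the raising operator. -/
theorem opE_finiteBethe {q : ℝ} (hq0 : 0 < q) (hq1 : q < 1) {N m : ℕ} {z : Fin m → ℂ}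
    (hz : IsBetheSolution q N z) : opE q N (finiteBethe q N z) = 0 := by
  ext X
  rw [PiLp.zero_apply]
  cases m with
  | zero =>
    rw [opE_apply]
    refine sum_eq_zero fun y _ => ?_
    split_ifs
    · rfl
    · rw [inSector_finiteBethe q N z _ (card_ne_zero_of_mem (mem_insert_self y X)), mul_zero]
  | succ n =>
    by_cases hX : #X = n
    · have hX' : #(siteSet 0 X) = n := (card_siteSet 0 X).trans hX
      have hu := fun w i => reflected_ne_zero hz.1 (z := z) w i
      have h := sum_raise_eq hq0.ne' (X := siteSet 0 X)
        (by rw [hX']; exact scatteringWeights_finite (N := N) hz.1)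
        (fun w i hi => by
          rw [extendSeq_of_lt _ (by omega)]
          exact hu _ _)
        (fun w i hi => by
          rw [extendSeq_of_lt _ (by omega)]
          exact one_sub_mul_ne_zero hq0 hq1 (norm_reflected hz.1 w _))
        0 N (fun x hx => le_of_mem_siteSet hx) (fun x hx => lt_of_mem_siteSet hx)
      simp only [zpow_zero, hX', zero_add] at h
      rw [left_boundary_eq_zero hq0 hq1 hz hX', right_boundary_eq_zero hq0 hq1 hz.1 hX',
        sub_zero] at h
      refine Eq.trans ?_ h
      rw [opE_apply, sum_range]
      refine sum_congr rfl fun y _ => ?_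
      have hmem := mem_siteSet (c := 0) (X := X) (y := y)
      have hrank := rank_siteSet 0 X y
      have hins := siteSet_insert 0 X y
      rw [zero_add] at hmem hrank hins
      simp only [hmem]
      split_ifs with hy
      · rfl
      · rw [leftWeight_eq hq0.ne', finiteBethe_apply hz.1 (by rw [card_insert_of_notMem hy, hX]),
          raiseWeight, hrank, hins]
    · exact (inSector_finiteBethe q N z).opE X hX

end XXZ

end

/-! ### The limit of the binomial coefficient, and the domain wall transform of Bethe states. -/

noncomputable section

namespace XXZ

open Finset Filter Topology

/-! ### Half filling and the limit of the central `q`-binomial coefficient -/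

theorem qFactorial_two_mul (Q : ℝ) (p : ℕ) :
    qFactorial Q (2 * p) =
      qFactorial Q p * ∏ k ∈ range p, (1 - Q ^ (p + k + 1)) / (1 - Q) := by
  rw [qFactorial, qFactorial, two_mul, prod_range_add]

/-- Here `K` has the eigenvalue `q^{2p}` on `v`. Hence `K^{-p}` cancels the prefactor `q^{2p²}`, and
the remaining product consists of the factors that lead from `[p]!` to `[2p]!`. -/
theorem inner_descendant_half {q : ℝ} (hq0 : 0 < q) (hq1 : q < 1) {m m' p : ℕ}
    {v v' : SpinChain (2 * (p + m))} (hv : InSector m v) (hE : opE q _ v = 0)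
    (hv' : InSector m' v') (hE' : opE q _ v' = 0) :
    inner ℂ (descendant q _ p v') (descendant q _ p v) =
      inner ℂ v' v * ((qBinom (q ^ 2) (2 * p) p : ℝ) : ℂ) := by
  have hq' : (q : ℂ) ≠ 0 := by exact_mod_cast hq0.ne'
  rw [inner_descendant hq0 hq1 hv hE hv' hE', if_pos rfl, kacOp_of_inSector hq0 hv,
    inner_smul_right]
  have hf : ((qFactorial (q ^ 2) p : ℝ) : ℂ) ≠ 0 := by
    exact_mod_cast qFactorial_ne_zero hq0 hq1 p
  have hprod : ∏ k ∈ range p, (1 - (q : ℂ) ^ (2 * (((2 * (p + m) : ℕ) : ℤ) - 2 * m) - 2 * p +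
      2 * (k + 1))) / (1 - (q : ℂ) ^ 2) =
      ((∏ k ∈ range p, (1 - (q ^ 2) ^ (p + k + 1)) / (1 - q ^ 2) : ℝ) : ℂ) := by
    push_cast
    refine prod_congr rfl fun k _ => ?_
    rw [← pow_mul, ← zpow_natCast (q : ℂ) (2 * (p + k + 1))]
    congr 3
    push_cast
    ring
  have hpow : (q : ℂ) ^ (-(p : ℤ) * (((2 * (p + m) : ℕ) : ℤ) - 2 * m)) =
      ((q : ℂ) ^ (2 * p ^ 2))⁻¹ := by
    rw [← zpow_natCast, ← zpow_neg]
    congr 1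
    push_cast
    ring
  rw [hprod, hpow, qBinom, qFactorial_two_mul, show 2 * p - p = p by omega]
  push_cast
  have : (q : ℂ) ^ (2 * p ^ 2) ≠ 0 := pow_ne_zero _ hq'
  field_simp

theorem multipliable_factor {q : ℝ} (hq0 : 0 < q) (hq1 : q < 1) :
    Multipliable (fun k : ℕ => 1 / (1 - q ^ (2 * (k + 1)))) := by
  have hq2 : q ^ 2 < 1 := by nlinarith
  have h1 : ∀ k : ℕ, q ^ (2 * (k + 1)) ≤ q ^ 2 := fun k =>
    pow_le_pow_of_le_one hq0.le hq1.le (by omega)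
  have h2 : ∀ k : ℕ, 1 / (1 - q ^ (2 * (k + 1))) =
      1 + q ^ (2 * (k + 1)) / (1 - q ^ (2 * (k + 1))) := fun k => by
    have : 1 - q ^ (2 * (k + 1)) ≠ 0 := by linarith [h1 k]
    field_simp
    ring
  simp only [h2]
  refine Real.multipliable_one_add_of_summable ?_
  refine Summable.of_nonneg_of_le (f := fun k : ℕ => q ^ 2 / (1 - q ^ 2) * (q ^ 2) ^ k)
    (fun k => ?_) (fun k => ?_) ?_
  · exact div_nonneg (by positivity) (by linarith [h1 k])
  · rw [div_mul_eq_mul_div, ← pow_succ', ← pow_mul]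
    exact div_le_div_of_nonneg_left (by positivity) (by linarith) (by linarith [h1 k])
  · exact (summable_geometric_of_lt_one (by positivity) hq2).mul_left _

/-- The constant `∏_{k ≥ 1} 1 / (1 - q^{2k})`. -/
def dwConst (q : ℝ) : ℝ := ∏' k : ℕ, 1 / (1 - q ^ (2 * (k + 1)))

theorem tendsto_partialProd {q : ℝ} (hq0 : 0 < q) (hq1 : q < 1) :
    Tendsto (fun n => ∏ k ∈ range n, 1 / (1 - q ^ (2 * (k + 1)))) atTop (𝓝 (dwConst q)) :=
  (multipliable_factor hq0 hq1).hasProd.tendsto_prod_nat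

theorem one_le_dwConst {q : ℝ} (hq0 : 0 < q) (hq1 : q < 1) : 1 ≤ dwConst q := by
  refine ge_of_tendsto' (tendsto_partialProd hq0 hq1) fun n => ?_
  refine Finset.prod_induction _ (fun x : ℝ => 1 ≤ x) (fun a b => one_le_mul_of_one_le_of_one_le)
    le_rfl fun k _ => ?_
  have : q ^ (2 * (k + 1)) < 1 := pow_lt_one₀ hq0.le hq1 (by omega)
  rw [le_div_iff₀ (by linarith)]
  have : 0 < q ^ (2 * (k + 1)) := by positivity
  linarith

/-- If `G n` is the partial product of the constant, then `[n]! = (1 - q²)^{-n} / G n`, so the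
central coefficient is `G p * G p / G (2p)`. -/
theorem tendsto_qBinom {q : ℝ} (hq0 : 0 < q) (hq1 : q < 1) :
    Tendsto (fun p : ℕ => qBinom (q ^ 2) (2 * p) p) atTop (𝓝 (dwConst q)) := by
  have hP : dwConst q ≠ 0 := by linarith [one_le_dwConst hq0 hq1]
  set G : ℕ → ℝ := fun n => ∏ k ∈ range n, 1 / (1 - q ^ (2 * (k + 1))) with hG
  have hG1 := tendsto_partialProd hq0 hq1
  have hG2 : Tendsto (fun p => G (2 * p)) atTop (𝓝 (dwConst q)) :=
    hG1.comp (tendsto_id.const_mul_atTop' (by norm_num))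
  have h := (hG1.mul hG1).div hG2 hP
  rw [mul_div_cancel_right₀ _ hP] at h
  refine h.congr fun p => ?_
  have hne : (1 - q ^ 2) ≠ 0 := by nlinarith
  have hq : ∀ n, qFactorial (q ^ 2) n = (G n)⁻¹ * ((1 - q ^ 2) ^ n)⁻¹ := by
    intro n
    rw [qFactorial, prod_div_distrib, prod_const, card_range, hG, ← prod_inv_distrib,
      div_eq_mul_inv]
    congr 1
    exact prod_congr rfl fun k _ => by rw [one_div, inv_inv, pow_mul]
  have hGne : ∀ n, G n ≠ 0 := fun n => prod_ne_zero_iff.2 fun k _ => by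
    have : q ^ (2 * (k + 1)) < 1 := pow_lt_one₀ hq0.le hq1 (by omega)
    exact one_div_ne_zero (by linarith)
  rw [qBinom, show 2 * p - p = p by omega, hq, hq]
  have h1 := hGne p
  have h2 := hGne (2 * p)
  have h3 : (1 - q ^ 2) ^ p ≠ 0 := pow_ne_zero _ hne
  change G p * G p / G (2 * p) = _
  rw [two_mul] at h2 ⊢
  rw [pow_add]
  field_simp

/-! ### The transform from the ferromagnetic to the domain wall vacuum -/

/-- The number `[k] = 1 + q⁻² + ⋯ + q^{-2(k-1)}`. -/
def qNumber (q : ℝ) (k : ℕ) : ℂ := ∑ i ∈ range k, ((q : ℂ)⁻¹ ^ 2) ^ i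

/-- The raising operator of the half line `c, c + 1, …`. -/
def raiseHalf (q : ℝ) (c : ℤ) (ψ : Finset ℤ → ℂ) (X : Finset ℤ) : ℂ :=
  ∑' n : ℕ, if c + (n : ℤ) ∈ X then 0 else
    raiseWeight q X (c + n) * ψ (insert (c + (n : ℤ)) X)

/-- The value at `X` of the sum of `ψ` over the positions of `k` further particles to the left of
`c`, with the weights `q^y`, as determined by the highest weight condition. -/
def tailSum (q : ℝ) (c : ℤ) (ψ : Finset ℤ → ℂ) : ℕ → Finset ℤ → ℂ
  | 0 => ψ
  | k + 1 => fun X =>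
      -(((q : ℂ)⁻¹ ^ 2) ^ k / qNumber q (k + 1)) * raiseHalf q c (tailSum q c ψ k) X

/-- The sum over the positions of `k` particles at `x_l`, `s < l`, with the weights `w_l`, where
the particles with `l > r` are summed by `S`. -/
def peelSum (w : ℕ → ℂ) (x : ℕ → ℤ) (r : ℕ) (S : ℕ → Finset ℤ → ℂ) : ℕ → ℕ → Finset ℤ → ℂ
  | 0, _, X => S 0 X
  | k + 1, s, X => (∑ l ∈ Ioc s r, w l * peelSum w x r S k l (insert (x l) X)) + S (k + 1) X

/-- The position `δ_l - l`. -/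
def dwPos (δ : YoungDiagram) (l : ℕ) : ℤ := (part δ l : ℤ) - (l : ℤ)

/-- The weight `q^{-(δ_l + l)}`. -/
def dwWeight (q : ℝ) (δ : YoungDiagram) (l : ℕ) : ℂ := ((q : ℂ) ^ (part δ l + l))⁻¹

/-- The component at `Ω_DW(δ)` of the transform of a wave function of `m` magnons. -/
def dwTransform (q : ℝ) (m : ℕ) (ψ : Finset ℤ → ℂ) (δ : YoungDiagram) : ℂ :=
  (q : ℂ) ^ ((m + 1).choose 2 + δ.card) *
    peelSum (dwWeight q δ) (dwPos δ) (δ.colLen 0) (tailSum q (-(δ.colLen 0 : ℤ)) ψ) m 0 ∅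

theorem qNumber_ne_zero {q : ℝ} (hq0 : 0 < q) (k : ℕ) : qNumber q (k + 1) ≠ 0 := by
  have : qNumber q (k + 1) = ((∑ i ∈ range (k + 1), (q⁻¹ ^ 2) ^ i : ℝ) : ℂ) := by
    simp [qNumber]
  rw [this]
  exact_mod_cast (sum_pos (fun i _ => by positivity) (by simp)).ne'

theorem part_antitone (δ : YoungDiagram) {l l' : ℕ} (h : l ≤ l') : part δ l' ≤ part δ l :=
  δ.rowLen_anti _ _ (by omega)

theorem dwPos_strictAnti (δ : YoungDiagram) {l l' : ℕ} (h : l < l') : dwPos δ l' < dwPos δ l := by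
  have := part_antitone δ h.le
  simp only [dwPos]
  omega

/-! #### Bounds -/

theorem norm_raiseWeight_le {q : ℝ} (hq0 : 0 < q) (hq1 : q < 1) (X : Finset ℤ) (c : ℤ) (n : ℕ) :
    ‖raiseWeight q X (c + n)‖ ≤ q ^ (c - 2 * (#X : ℤ)) * q ^ n := by
  rw [raiseWeight, norm_zpow, Complex.norm_real, Real.norm_of_nonneg hq0.le, ← zpow_natCast,
    ← zpow_add₀ hq0.ne']
  refine zpow_le_zpow_right_of_le_one₀ hq0 hq1.le ?_
  have := rank_le_card X (c + n)
  omega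

theorem norm_raise_term_le {q : ℝ} (hq0 : 0 < q) (hq1 : q < 1) {c : ℤ} {ψ : Finset ℤ → ℂ}
    {C : ℝ} {X : Finset ℤ} (hψ : ∀ Y, #Y = #X + 1 → ‖ψ Y‖ ≤ C) (hC : 0 ≤ C) (n : ℕ) :
    ‖if c + (n : ℤ) ∈ X then 0 else raiseWeight q X (c + n) * ψ (insert (c + (n : ℤ)) X)‖ ≤
      q ^ (c - 2 * (#X : ℤ)) * C * q ^ n := by
  split_ifs with h
  · rw [norm_zero]
    positivity
  · rw [norm_mul, mul_right_comm]
    exact mul_le_mul (norm_raiseWeight_le hq0 hq1 X c n)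
      (hψ _ (card_insert_of_notMem h)) (norm_nonneg _) (by positivity)

theorem summable_raise {q : ℝ} (hq0 : 0 < q) (hq1 : q < 1) {c : ℤ} {ψ : Finset ℤ → ℂ}
    {C : ℝ} {X : Finset ℤ} (hψ : ∀ Y, #Y = #X + 1 → ‖ψ Y‖ ≤ C) (hC : 0 ≤ C) :
    Summable fun n : ℕ => if c + (n : ℤ) ∈ X then 0 else
      raiseWeight q X (c + n) * ψ (insert (c + (n : ℤ)) X) :=
  Summable.of_norm_bounded ((summable_geometric_of_lt_one hq0.le hq1).mul_left _)
    (norm_raise_term_le hq0 hq1 hψ hC)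

theorem norm_raiseHalf_le {q : ℝ} (hq0 : 0 < q) (hq1 : q < 1) {c : ℤ} {ψ : Finset ℤ → ℂ}
    {C : ℝ} {X : Finset ℤ} (hψ : ∀ Y, #Y = #X + 1 → ‖ψ Y‖ ≤ C) (hC : 0 ≤ C) :
    ‖raiseHalf q c ψ X‖ ≤ q ^ (c - 2 * (#X : ℤ)) * (1 - q)⁻¹ * C := by
  have h := tsum_of_norm_bounded ((hasSum_geometric_of_lt_one hq0.le hq1).mul_left _)
    (norm_raise_term_le (c := c) hq0 hq1 hψ hC)
  rwa [mul_right_comm] at h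

/-- The norm of the functional `ψ ↦ tailSum q c ψ k X`, for `#X = n`. -/
def tailBound (q : ℝ) (c : ℤ) : ℕ → ℕ → ℝ
  | 0, _ => 1
  | k + 1, n => ‖((q : ℂ)⁻¹ ^ 2) ^ k / qNumber q (k + 1)‖ *
      (q ^ (c - 2 * (n : ℤ)) * (1 - q)⁻¹ * tailBound q c k (n + 1))

theorem tailBound_nonneg {q : ℝ} (hq0 : 0 < q) (hq1 : q < 1) (c : ℤ) (k n : ℕ) :
    0 ≤ tailBound q c k n := by
  induction k generalizing n with
  | zero => exact zero_le_one
  | succ k ih =>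
    have : 0 ≤ (1 - q)⁻¹ := inv_nonneg.2 (by linarith)
    have := ih (n + 1)
    rw [tailBound]
    positivity

theorem norm_tailSum_le {q : ℝ} (hq0 : 0 < q) (hq1 : q < 1) {c : ℤ} {ψ : Finset ℤ → ℂ}
    {C : ℝ} (hC : 0 ≤ C) (hψ : ∀ Y, ‖ψ Y‖ ≤ C) (k : ℕ) (X : Finset ℤ) :
    ‖tailSum q c ψ k X‖ ≤ tailBound q c k #X * C := by
  induction k generalizing X with
  | zero => simpa [tailSum, tailBound] using hψ X
  | succ k ih =>
    rw [tailSum, tailBound, norm_mul, norm_neg, mul_assoc]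
    refine mul_le_mul_of_nonneg_left ?_ (norm_nonneg _)
    rw [mul_assoc _ (tailBound _ _ _ _)]
    exact norm_raiseHalf_le hq0 hq1 (fun Y hY => hY ▸ ih Y)
      (mul_nonneg (tailBound_nonneg hq0 hq1 _ _ _) hC)

/-! #### The transform of Bethe states -/

/-- The list `[v_{k-1}, …, v_0]`. -/
def revList (v : ℕ → ℂ) : ℕ → List ℂ
  | 0 => []
  | k + 1 => v k :: revList v k

theorem revList_congr {v v' : ℕ → ℂ} {k : ℕ} (h : ∀ i < k, v i = v' i) :
    revList v k = revList v' k := by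
  induction k with
  | zero => rfl
  | succ k ih => rw [revList, revList, h k (by omega), ih fun i hi => h i (by omega)]

theorem ofFn_rev_eq_revList {m : ℕ} (u : Fin m → ℂ) :
    List.ofFn (fun a : Fin m => u a.rev) = revList (extendSeq u) m := by
  have h : ∀ (m : ℕ) (v : ℕ → ℂ), List.ofFn (fun a : Fin m => v (m - 1 - a)) = revList v m := by
    intro m v
    induction m with
    | zero => rfl
    | succ m ih =>
      rw [List.ofFn_succ, revList, ← ih]
      congr 1
      congr 1
      funext i
      congr 1
      simp only [Fin.val_succ]
      omega
  rw [← h]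
  congr 1
  funext a
  rw [extendSeq_of_lt _ (by omega)]
  congr 1
  ext
  simp only [Fin.val_rev]
  omega

/-- The product `∏_{i<k} q v_i`. -/
def prefixProd (q : ℝ) (v : ℕ → ℂ) (k : ℕ) : ℂ := ∏ i ∈ range k, (q : ℂ) * v i

theorem prod_map_revList (q : ℝ) (v : ℕ → ℂ) (k : ℕ) :
    ((revList v k).map fun w => (q : ℂ) * w).prod = prefixProd q v k := by
  induction k with
  | zero => rfl
  | succ k ih => rw [revList, List.map_cons, List.prod_cons, ih, prefixProd, prefixProd,
      prod_range_succ, mul_comm]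

theorem nestedGeomSeries_revList (q : ℝ) (v : ℕ → ℂ) (r k : ℕ) :
    nestedGeomSeries r ((revList v k).map fun w => (q : ℂ) * w) =
      (prefixProd q v k ^ r)⁻¹ * ∏ i ∈ range k, -(1 / (1 - prefixProd q v (i + 1))) := by
  have h : ∀ r k, nestedGeomSeries r ((revList v (k + 1)).map fun w => (q : ℂ) * w) =
      geomSeries r (prefixProd q v (k + 1)) *
        nestedGeomSeries 0 ((revList v k).map fun w => (q : ℂ) * w) := by
    intro r k
    rw [← prod_map_revList]
    rfl
  have h0 : ∀ k, nestedGeomSeries 0 ((revList v k).map fun w => (q : ℂ) * w) =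
      ∏ i ∈ range k, -(1 / (1 - prefixProd q v (i + 1))) := by
    intro k
    induction k with
    | zero => simp [revList, nestedGeomSeries]
    | succ k ih =>
      rw [h, ih, prod_range_succ, geomSeries, pow_zero, inv_one]
      ring
  cases k with
  | zero => simp [revList, nestedGeomSeries, prefixProd]
  | succ k =>
    rw [h, h0, prod_range_succ, geomSeries]
    ring

/-- The rational identity behind the summation of `k + 1` particles on a half line. -/
theorem qNumber_eq_sum {q : ℝ} (hq : q ≠ 0) (v : ℕ → ℂ) (k : ℕ)
    (hv : ∀ i ≤ k, 1 - q * v i ≠ 0) :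
    qNumber q (k + 1) = ((q : ℂ)⁻¹ ^ 2) ^ k * (1 - prefixProd q v (k + 1)) / (1 - q * v k) +
      ∑ b ∈ range k, ((q : ℂ)⁻¹ ^ 2) ^ b * (1 - prefixProd q v (b + 1)) *
        (pairFactor q (v (b + 1)) (v b) / ((1 - q * v b) * (1 - q * v (b + 1)))) := by
  have hq' : (q : ℂ) ≠ 0 := by exact_mod_cast hq
  induction k with
  | zero =>
    have := hv 0 le_rfl
    simp [qNumber, prefixProd, div_self this]
  | succ k ih =>
    have h0 := hv k (by omega)
    have h1 := hv (k + 1) le_rfl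
    -- Writing the new pair factor as a difference moves the leading term from momentum `k` to
    -- momentum `k + 1`.
    rw [qNumber, sum_range_succ, ← qNumber, ih fun i hi => hv i (by omega),
      sum_range_succ, ← one_div_sub_eq_pairFactor hq h0 h1]
    have hW : prefixProd q v (k + 1 + 1) = prefixProd q v (k + 1) * (q * v (k + 1)) := by
      rw [prefixProd, prod_range_succ, ← prefixProd]
    rw [hW]
    generalize prefixProd q v (k + 1) = W
    generalize (∑ b ∈ range k, ((q : ℂ)⁻¹ ^ 2) ^ b * (1 - prefixProd q v (b + 1)) *
        (pairFactor q (v (b + 1)) (v b) / ((1 - q * v b) * (1 - q * v (b + 1))))) = S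
    rw [pow_succ ((q : ℂ)⁻¹ ^ 2) k]
    generalize ((q : ℂ)⁻¹ ^ 2) ^ k = t
    field_simp
    ring

/-- In the term `b` of the previous identity the denominator of the prefix product of length `b + 1`
cancels. That prefix is the only one affected by exchanging the momenta `b` and `b + 1`, so apart
from its pair factor the term is symmetric in them. -/
theorem qNumber_mul_prod {q : ℝ} (hq : q ≠ 0) (v : ℕ → ℂ) (k : ℕ)
    (hv : ∀ i ≤ k, 1 - q * v i ≠ 0) (hW : ∀ i ≤ k, 1 - prefixProd q v (i + 1) ≠ 0) :
    qNumber q (k + 1) * ∏ i ∈ range (k + 1), -(1 / (1 - prefixProd q v (i + 1))) =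
      -(((q : ℂ)⁻¹ ^ 2) ^ k * (∏ i ∈ range k, -(1 / (1 - prefixProd q v (i + 1)))) /
        (1 - q * v k)) -
      ∑ b ∈ range k, ((q : ℂ)⁻¹ ^ 2) ^ b *
        (pairFactor q (v (b + 1)) (v b) / ((1 - q * v b) * (1 - q * v (b + 1)))) *
        ∏ i ∈ (range (k + 1)).erase b, -(1 / (1 - prefixProd q v (i + 1))) := by
  rw [qNumber_eq_sum hq v k hv, add_mul, sum_mul, sub_eq_add_neg (-(_ / _)),
    ← sum_neg_distrib]
  congr 1
  · rw [prod_range_succ]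
    have := hW k le_rfl
    field_simp
  · refine sum_congr rfl fun b hb => ?_
    have hb' := mem_range.1 hb
    rw [← mul_prod_erase (range (k + 1)) _ (mem_range.2 (show b < k + 1 by omega))]
    have := hW b (by omega)
    field_simp

theorem prefixProd_comp_swap (q : ℝ) (v : ℕ → ℂ) {b i : ℕ} (hi : i ≠ b) :
    prefixProd q (v ∘ Equiv.swap b (b + 1)) (i + 1) = prefixProd q v (i + 1) := by
  refine prod_nbij' (Equiv.swap b (b + 1)) (Equiv.swap b (b + 1)) ?_ ?_ (by simp) (by simp)
    (by simp)
  all_goals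
    intro j hj
    simp only [mem_range, Equiv.swap_apply_def] at hj ⊢
    split_ifs <;> omega

/-- The parameters of a Bethe state that are admissible for its transform. -/
structure IsAdmissible (q : ℝ) {m : ℕ} (z : Fin m → ℂ) : Prop where
  ne_zero : ∀ a, z a ≠ 0
  one_sub_ne_zero : ∀ a, 1 - q * z a ≠ 0
  -- These are the denominators of the nested geometric series, for all orders of summation.
  one_sub_prod_ne_zero : ∀ S : Finset (Fin m), S.Nonempty → 1 - ∏ a ∈ S, (q : ℂ) * z a ≠ 0
  -- The rightmost momentum controls the decay at `+∞`; only permutations with nonzero amplitude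
  -- matter.
  norm_last : ∀ (π : Equiv.Perm (Fin m)) (i : Fin m), (i : ℕ) + 1 = m →
    amplitude q (fun i => z (π i)) ≠ 0 → ‖(q : ℂ) * z (π i)‖ < 1
  bounded : ∃ C, ∀ X, ‖betheState q z X‖ ≤ C

/-- The signed amplitude of a permutation. -/
def signedAmplitude (q : ℝ) {m : ℕ} (z : Fin m → ℂ) (π : Equiv.Perm (Fin m)) : ℂ :=
  ((Equiv.Perm.sign π : ℤˣ) : ℂ) * amplitude q (fun i => z (π i))

/-- The permuted momenta. -/
def permSeq {m : ℕ} (z : Fin m → ℂ) (π : Equiv.Perm (Fin m)) : ℕ → ℂ :=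
  extendSeq fun i => z (π i)

theorem exists_swap_signedAmplitude (q : ℝ) {m : ℕ} (z : Fin m → ℂ) {a : ℕ} (ha : a + 1 < m) :
    ∃ τ : Equiv.Perm (Equiv.Perm (Fin m)), ∀ π,
      permSeq z (τ π) = permSeq z π ∘ Equiv.swap a (a + 1) ∧
      signedAmplitude q z (τ π) * pairFactor q (permSeq z π a) (permSeq z π (a + 1)) =
        -(signedAmplitude q z π * pairFactor q (permSeq z π (a + 1)) (permSeq z π a)) := by
  set σ : Equiv.Perm (Fin m) := Equiv.swap ⟨a, by omega⟩ ⟨a + 1, ha⟩ with hσ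
  refine ⟨Equiv.mulRight σ, fun π => ⟨?_, ?_⟩⟩
  · rw [permSeq, permSeq, extendSeq_comp_swap _ ha]
    rfl
  · obtain ⟨P, h1, h2⟩ := exists_prod_pairs_swap (pairFactor q) (fun i => z (π i))
      (a := ⟨a, by omega⟩) (b := ⟨a + 1, ha⟩) rfl
    have e1 : amplitude q (fun i => z (π i)) =
        ∏ i, ∏ j ∈ Ioi i, pairFactor q (z (π i)) (z (π j)) := rfl
    have e2 : amplitude q (fun i => z ((Equiv.mulRight σ π) i)) = ∏ i, ∏ j ∈ Ioi i,
        pairFactor q (((fun i => z (π i)) ∘ σ) i) (((fun i => z (π i)) ∘ σ) j) := rfl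
    rw [signedAmplitude, signedAmplitude, e1, e2, h1, h2, Equiv.coe_mulRight,
      Equiv.Perm.sign_mul, hσ, Equiv.Perm.sign_swap (by simp [Fin.ext_iff]), permSeq,
      extendSeq_of_lt _ ha, extendSeq_of_lt _ (show a < m by omega)]
    simp only [mul_neg, mul_one, Units.val_neg, Int.cast_neg]
    ring

theorem betheState_eq (q : ℝ) {m : ℕ} (z : Fin m → ℂ) {X : Finset ℤ} (h : #X = m) :
    betheState q z X = ∑ π, signedAmplitude q z π * planeWave (permSeq z π) X := by
  rw [betheState, dif_pos h, wave]
  refine sum_congr rfl fun π _ => ?_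
  rw [permSeq, ← prod_orderEmbOfFin h, signedAmplitude, mul_assoc]

/-- The Bethe state with `k` particles to the left of `-r` summed over. -/
def partialState (q : ℝ) {m : ℕ} (z : Fin m → ℂ) (r k : ℕ) (X : Finset ℤ) : ℂ :=
  ∑ π, signedAmplitude q z π *
    nestedGeomSeries r ((revList (permSeq z π) k).map fun w => (q : ℂ) * w) *
      planeWave (fun i => permSeq z π (k + i)) X

theorem IsAdmissible.permSeq_ne_zero {q : ℝ} {m : ℕ} {z : Fin m → ℂ} (hz : IsAdmissible q z)
    (π : Equiv.Perm (Fin m)) {i : ℕ} (hi : i < m) : permSeq z π i ≠ 0 := by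
  rw [permSeq, extendSeq_of_lt _ hi]
  exact hz.ne_zero _

theorem IsAdmissible.one_sub_permSeq {q : ℝ} {m : ℕ} {z : Fin m → ℂ} (hz : IsAdmissible q z)
    (π : Equiv.Perm (Fin m)) {i : ℕ} (hi : i < m) : 1 - q * permSeq z π i ≠ 0 := by
  rw [permSeq, extendSeq_of_lt _ hi]
  exact hz.one_sub_ne_zero _

theorem IsAdmissible.one_sub_prefixProd {q : ℝ} {m : ℕ} {z : Fin m → ℂ}
    (hz : IsAdmissible q z) (π : Equiv.Perm (Fin m)) {i : ℕ} (hi : i < m) :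
    1 - prefixProd q (permSeq z π) (i + 1) ≠ 0 := by
  have h := hz.one_sub_prod_ne_zero ((Iic (⟨i, hi⟩ : Fin m)).map π.toEmbedding)
    (by simp)
  rw [prod_map] at h
  convert h using 2
  rw [prefixProd]
  refine prod_bij' (fun (j : ℕ) hj => (⟨j, by simp only [mem_range] at hj; omega⟩ : Fin m))
    (fun j _ => (j : ℕ)) ?_ ?_ (by simp) (by simp) ?_
  · intro j hj
    simp only [mem_range] at hj
    simp only [mem_Iic, Fin.mk_le_mk]
    omega
  · intro j hj
    simp only [mem_Iic, Fin.le_def] at hj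
    simp only [mem_range]
    omega
  · intro j hj
    simp only [mem_range] at hj
    rw [permSeq, extendSeq_of_lt _ (by omega)]
    rfl

/-- After `k` momenta are summed away, the others still form a superposition of plane waves with
scattering weights: exchanging two of the remaining momenta leaves the nested series in the first
`k` unchanged. The general telescoping identity therefore applies. -/
theorem sum_raise_partialState {q : ℝ} (hq0 : 0 < q) {m : ℕ} {z : Fin m → ℂ}
    (hz : IsAdmissible q z) {r k : ℕ} {X : Finset ℤ} (hX : #X + k + 1 = m)
    (hc : ∀ x ∈ X, -(r : ℤ) ≤ x) {n : ℕ} (hn : ∀ x ∈ X, x < -(r : ℤ) + n) :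
    ∑ i ∈ range n, (if -(r : ℤ) + (i : ℤ) ∈ X then 0 else raiseWeight q X (-(r : ℤ) + i) *
      partialState q z r k (insert (-(r : ℤ) + (i : ℤ)) X)) =
    ∑ π, signedAmplitude q z π *
      nestedGeomSeries r ((revList (permSeq z π) k).map fun w => (q : ℂ) * w) *
        (((q : ℂ) * permSeq z π k) ^ (-(r : ℤ)) / (1 - q * permSeq z π k) *
          planeWave (fun i => permSeq z π (k + 1 + i)) X) -
    ∑ π, signedAmplitude q z π *
      nestedGeomSeries r ((revList (permSeq z π) k).map fun w => (q : ℂ) * w) *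
        ((q : ℂ) ^ (-(r : ℤ) + n - 2 * (#X : ℤ)) * permSeq z π (k + #X) ^ (-(r : ℤ) + n) /
          (1 - q * permSeq z π (k + #X)) * planeWave (fun i => permSeq z π (k + i)) X) := by
  have h := sum_raise_eq hq0.ne' (X := X) (W := Equiv.Perm (Fin m))
    (α := fun π => signedAmplitude q z π *
      nestedGeomSeries r ((revList (permSeq z π) k).map fun w => (q : ℂ) * w))
    (v := fun π i => permSeq z π (k + i)) ?_
    (fun π i hi => hz.permSeq_ne_zero π (by omega))
    (fun π i hi => hz.one_sub_permSeq π (by omega)) (-(r : ℤ)) n hc hn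
  · simp only [add_zero] at h
    refine h.trans ?_
    congr 1
    refine sum_congr rfl fun π _ => ?_
    simp only [add_assoc, add_comm 1]
  · intro a ha
    obtain ⟨τ, hτ⟩ := exists_swap_signedAmplitude q z (a := k + a) (by omega)
    refine ⟨τ, fun π => ⟨?_, ?_⟩⟩
    · funext i
      simp only [(hτ π).1, Function.comp_apply]
      congr 1
      simp only [Equiv.swap_apply_def]
      split_ifs <;> omega
    · have hl : revList (permSeq z (τ π)) k = revList (permSeq z π) k := by
        refine revList_congr fun i hi => ?_
        rw [(hτ π).1, Function.comp_apply,
          Equiv.swap_apply_of_ne_of_ne (by omega) (by omega)]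
      have h2 := (hτ π).2
      simp only [hl, ← add_assoc]
      linear_combination h2 *
        nestedGeomSeries r ((revList (permSeq z π) k).map fun w => (q : ℂ) * w)

/-- The term at the right end is proportional to the `n`-th power of `q` times the last momentum,
which has norm below one unless the amplitude vanishes. -/
theorem tendsto_boundary {q : ℝ} (hq0 : 0 < q) {m : ℕ} {z : Fin m → ℂ}
    (hz : IsAdmissible q z) {r k : ℕ} {X : Finset ℤ} (hX : #X + k + 1 = m) :
    Tendsto (fun n : ℕ => ∑ π, signedAmplitude q z π *
      nestedGeomSeries r ((revList (permSeq z π) k).map fun w => (q : ℂ) * w) *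
        ((q : ℂ) ^ (-(r : ℤ) + n - 2 * (#X : ℤ)) * permSeq z π (k + #X) ^ (-(r : ℤ) + n) /
          (1 - q * permSeq z π (k + #X)) * planeWave (fun i => permSeq z π (k + i)) X))
      atTop (𝓝 0) := by
  have hq' : (q : ℂ) ≠ 0 := by exact_mod_cast hq0.ne'
  rw [← sum_const_zero (s := (univ : Finset (Equiv.Perm (Fin m))))]
  refine tendsto_finsetSum _ fun π _ => ?_
  by_cases hA : amplitude q (fun i => z (π i)) = 0
  · simp [signedAmplitude, hA]
  · have hlast := hz.norm_last π ⟨k + #X, by omega⟩ (by simp only; omega) hA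
    have hv : permSeq z π (k + #X) = z (π ⟨k + #X, by omega⟩) := extendSeq_of_lt _ _
    have hvne : permSeq z π (k + #X) ≠ 0 := hz.permSeq_ne_zero π (by omega)
    rw [← hv] at hlast
    have h0 := tendsto_pow_atTop_nhds_zero_of_norm_lt_one hlast
    have h1 := h0.const_mul (signedAmplitude q z π *
      nestedGeomSeries r ((revList (permSeq z π) k).map fun w => (q : ℂ) * w) *
        ((q : ℂ) ^ (-(r : ℤ) - 2 * (#X : ℤ)) * permSeq z π (k + #X) ^ (-(r : ℤ)) /
          (1 - q * permSeq z π (k + #X)) * planeWave (fun i => permSeq z π (k + i)) X))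
    rw [mul_zero] at h1
    refine h1.congr fun n => ?_
    rw [zpow_add₀ hvne, show -(r : ℤ) + n - 2 * (#X : ℤ) = -(r : ℤ) - 2 * (#X : ℤ) + n by ring,
      zpow_add₀ hq', zpow_natCast, zpow_natCast, mul_pow]
    ring

/-- For each permutation, the rational identity expresses the difference between the series for `k +
1` particles and the left boundary term as a sum over `b < k`. Each of these terms is antisymmetric
under the exchange of the momenta `b` and `b + 1`, so it disappears in the sum over permutations. -/
theorem raise_partialState_eq {q : ℝ} (hq0 : 0 < q) {m : ℕ} {z : Fin m → ℂ}
    (hz : IsAdmissible q z) {r k : ℕ} {X : Finset ℤ} (hX : #X + k + 1 = m) :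
    qNumber q (k + 1) * partialState q z r (k + 1) X +
      ((q : ℂ)⁻¹ ^ 2) ^ k * ∑ π, signedAmplitude q z π *
      nestedGeomSeries r ((revList (permSeq z π) k).map fun w => (q : ℂ) * w) *
        (((q : ℂ) * permSeq z π k) ^ (-(r : ℤ)) / (1 - q * permSeq z π k) *
          planeWave (fun i => permSeq z π (k + 1 + i)) X) = 0 := by
  set c : Equiv.Perm (Fin m) → ℂ := fun π => (prefixProd q (permSeq z π) (k + 1) ^ r)⁻¹ *
    planeWave (fun i => permSeq z π (k + 1 + i)) X with hc
  have h1 : ∀ π, qNumber q (k + 1) * (signedAmplitude q z π *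
      nestedGeomSeries r ((revList (permSeq z π) (k + 1)).map fun w => (q : ℂ) * w) *
        planeWave (fun i => permSeq z π (k + 1 + i)) X) +
      ((q : ℂ)⁻¹ ^ 2) ^ k * (signedAmplitude q z π *
      nestedGeomSeries r ((revList (permSeq z π) k).map fun w => (q : ℂ) * w) *
        (((q : ℂ) * permSeq z π k) ^ (-(r : ℤ)) / (1 - q * permSeq z π k) *
          planeWave (fun i => permSeq z π (k + 1 + i)) X)) =
      -∑ b ∈ range k, ((q : ℂ)⁻¹ ^ 2) ^ b * (signedAmplitude q z π *
        pairFactor q (permSeq z π (b + 1)) (permSeq z π b) *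
        (c π * (∏ i ∈ (range (k + 1)).erase b,
            -(1 / (1 - prefixProd q (permSeq z π) (i + 1)))) /
          ((1 - q * permSeq z π b) * (1 - q * permSeq z π (b + 1))))) := by
    intro π
    have h2 := qNumber_mul_prod hq0.ne' (permSeq z π) k
      (fun i hi => hz.one_sub_permSeq π (by omega))
      (fun i hi => hz.one_sub_prefixProd π (by omega))
    rw [nestedGeomSeries_revList, nestedGeomSeries_revList, zpow_neg, zpow_natCast]
    have h3 : (prefixProd q (permSeq z π) (k + 1) ^ r)⁻¹ =
        (prefixProd q (permSeq z π) k ^ r)⁻¹ * (((q : ℂ) * permSeq z π k) ^ r)⁻¹ := by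
      rw [prefixProd, prod_range_succ, ← prefixProd, mul_pow, mul_inv]
    have h4 : ∑ b ∈ range k, ((q : ℂ)⁻¹ ^ 2) ^ b * (signedAmplitude q z π *
        pairFactor q (permSeq z π (b + 1)) (permSeq z π b) *
        (c π * (∏ i ∈ (range (k + 1)).erase b,
            -(1 / (1 - prefixProd q (permSeq z π) (i + 1)))) /
          ((1 - q * permSeq z π b) * (1 - q * permSeq z π (b + 1))))) =
        signedAmplitude q z π * c π * ∑ b ∈ range k, ((q : ℂ)⁻¹ ^ 2) ^ b *
        (pairFactor q (permSeq z π (b + 1)) (permSeq z π b) /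
          ((1 - q * permSeq z π b) * (1 - q * permSeq z π (b + 1)))) *
        ∏ i ∈ (range (k + 1)).erase b, -(1 / (1 - prefixProd q (permSeq z π) (i + 1))) := by
      rw [mul_sum]
      exact sum_congr rfl fun b _ => by ring
    rw [h4, hc]
    dsimp only
    rw [h3] at *
    linear_combination (signedAmplitude q z π * ((prefixProd q (permSeq z π) k ^ r)⁻¹ *
      (((q : ℂ) * permSeq z π k) ^ r)⁻¹) *
        planeWave (fun i => permSeq z π (k + 1 + i)) X) * h2
  rw [partialState, mul_sum, mul_sum, ← sum_add_distrib]
  simp only [h1]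
  rw [sum_neg_distrib, sum_comm, neg_eq_zero]
  refine sum_eq_zero fun b hb => ?_
  rw [mem_range] at hb
  rw [← mul_sum]
  apply mul_eq_zero_of_right
  obtain ⟨τ, hτ⟩ := exists_swap_signedAmplitude q z (a := b) (by omega)
  refine sum_eq_zero_of_antisymm _ τ fun π => ?_
  obtain ⟨h5, h6⟩ := hτ π
  have h7 : c (τ π) = c π := by
    simp only [hc, h5]
    rw [prefixProd_comp_swap q _ (by omega)]
    congr 1
    refine planeWave_congr fun i _ => ?_
    rw [Function.comp_apply, Equiv.swap_apply_of_ne_of_ne (by omega) (by omega)]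
  have h8 : ∏ i ∈ (range (k + 1)).erase b,
      -(1 / (1 - prefixProd q (permSeq z (τ π)) (i + 1))) = ∏ i ∈ (range (k + 1)).erase b,
      -(1 / (1 - prefixProd q (permSeq z π) (i + 1))) :=
    prod_congr rfl fun i hi => by rw [h5, prefixProd_comp_swap q _ (ne_of_mem_erase hi)]
  rw [h7, h8, h5]
  simp only [Function.comp_apply, Equiv.swap_apply_left, Equiv.swap_apply_right]
  rw [h6]
  ring

/-- This justifies the values assigned to possibly divergent geometric series: they solve the
recursion that consists of convergent sums over the right half line. Those sums telescope to a left
boundary term, the right one tending to zero, and `raise_partialState_eq` identifies the left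
boundary term with the next nested series. -/
theorem tailSum_betheState {q : ℝ} (hq0 : 0 < q) (hq1 : q < 1) {m : ℕ} {z : Fin m → ℂ}
    (hz : IsAdmissible q z) (r k : ℕ) {X : Finset ℤ} (hX : #X + k = m)
    (hc : ∀ x ∈ X, -(r : ℤ) ≤ x) :
    tailSum q (-(r : ℤ)) (betheState q z) k X = partialState q z r k X := by
  induction k generalizing X with
  | zero =>
    rw [tailSum, betheState_eq q z (by omega), partialState]
    simp [revList, nestedGeomSeries]
  | succ k ih =>
    obtain ⟨C, hC⟩ := hz.bounded
    have hC0 : 0 ≤ C := (norm_nonneg _).trans (hC ∅)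
    have hsum := summable_raise hq0 hq1 (c := -(r : ℤ)) (X := X)
      (ψ := tailSum q (-(r : ℤ)) (betheState q z) k)
      (fun Y hY => hY ▸ norm_tailSum_le hq0 hq1 hC0 hC k Y)
      (mul_nonneg (tailBound_nonneg hq0 hq1 _ _ _) hC0)
    have hterm : ∀ n : ℕ, (if -(r : ℤ) + (n : ℤ) ∈ X then 0 else
        raiseWeight q X (-(r : ℤ) + n) *
          tailSum q (-(r : ℤ)) (betheState q z) k (insert (-(r : ℤ) + (n : ℤ)) X)) =
        if -(r : ℤ) + (n : ℤ) ∈ X then 0 else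
        raiseWeight q X (-(r : ℤ) + n) *
          partialState q z r k (insert (-(r : ℤ) + (n : ℤ)) X) := by
      intro n
      split_ifs with h
      · rfl
      · rw [ih (by rw [card_insert_of_notMem h]; omega)]
        intro x hx
        rcases mem_insert.1 hx with rfl | hx
        · omega
        · exact hc x hx
    have hlim := hsum.hasSum.tendsto_sum_nat
    simp only [hterm] at hlim
    have hev : ∀ᶠ n : ℕ in atTop, ∀ x ∈ X, x < -(r : ℤ) + n := by
      rw [Filter.eventually_all_finset]
      intro x _
      filter_upwards [eventually_ge_atTop (x + r + 1).toNat] with n hn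
      omega
    have hlim2 := hlim.congr' (hev.mono fun n hn =>
      sum_raise_partialState hq0 hz (show #X + k + 1 = m by omega) hc hn)
    have hlim3 := tendsto_nhds_unique hlim2 (tendsto_const_nhds.sub
      (tendsto_boundary hq0 hz (show #X + k + 1 = m by omega)))
    rw [sub_zero] at hlim3
    have hid := raise_partialState_eq hq0 hz (r := r) (show #X + k + 1 = m by omega)
    rw [← hlim3] at hid
    have hne := qNumber_ne_zero hq0 k
    simp only [tailSum, raiseHalf, hterm]
    field_simp
    linear_combination -hid

theorem dwTransform_betheState {q : ℝ} (hq0 : 0 < q) (hq1 : q < 1) {m : ℕ} {z : Fin m → ℂ}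
    (hz : IsAdmissible q z) (δ : YoungDiagram) :
    dwTransform q m (betheState q z) δ = dwState q z δ := by
  set r := δ.colLen 0 with hr
  -- Since `δ_l - l` decreases in `l`, particles are placed from right to left. A new particle lies
  -- to the left of all of `X` and takes momentum number `k`, which accounts for the reversed list.
  have key : ∀ (k s : ℕ) (X : Finset ℤ), #X + k = m → (∀ x ∈ X, -(r : ℤ) ≤ x) →
      (∀ l, s < l → ∀ x ∈ X, dwPos δ l < x) →
      peelSum (dwWeight q δ) (dwPos δ) r (tailSum q (-(r : ℤ)) (betheState q z)) k s X =
        ∑ π, signedAmplitude q z π * planeWave (fun i => permSeq z π (k + i)) X *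
          dwSum q δ (revList (permSeq z π) k) s := by
    intro k
    induction k with
    | zero =>
      intro s X hX _ _
      rw [peelSum, tailSum, betheState_eq q z (by omega)]
      simp [revList, dwSum]
    | succ k ih =>
      intro s X hX hc hs
      rw [peelSum, tailSum_betheState hq0 hq1 hz r (k + 1) hX hc, partialState]
      have h1 : ∀ l ∈ Ioc s r, dwWeight q δ l * peelSum (dwWeight q δ) (dwPos δ) r
          (tailSum q (-(r : ℤ)) (betheState q z)) k l (insert (dwPos δ l) X) =
          ∑ π, signedAmplitude q z π * planeWave (fun i => permSeq z π (k + 1 + i)) X *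
            (permSeq z π k ^ ((part δ l : ℤ) - (l : ℤ)) / (q : ℂ) ^ (part δ l + l) *
              dwSum q δ (revList (permSeq z π) k) l) := by
        intro l hl
        rw [mem_Ioc] at hl
        have hlt : ∀ x ∈ X, dwPos δ l < x := hs l hl.1
        rw [ih l _ (by rw [card_insert_of_notMem fun h => lt_irrefl _ (hlt _ h)]; omega), mul_sum]
        · refine sum_congr rfl fun π _ => ?_
          rw [planeWave_insert_of_lt _ hlt, dwWeight, add_zero]
          simp only [dwPos, add_assoc, add_comm 1]
          ring
        · intro x hx
          rcases mem_insert.1 hx with rfl | hx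
          · simp only [dwPos]
            omega
          · exact hc x hx
        · intro l' hl' x hx
          rcases mem_insert.1 hx with rfl | hx
          · exact dwPos_strictAnti δ hl'
          · exact hs l' (hl.1.trans hl') x hx
      rw [sum_congr rfl h1, sum_comm, ← sum_add_distrib]
      refine sum_congr rfl fun π _ => ?_
      rw [revList, dwSum, mul_add, mul_sum, ← hr]
      congr 1
      ring
  rw [dwTransform, dwState, key m 0 ∅ (by simp) (by simp) (by simp)]
  congr 1
  refine sum_congr rfl fun π _ => ?_
  rw [ofFn_rev_eq_revList (fun a => z (π a)), signedAmplitude, planeWave, prod_empty, permSeq]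
  ring

end XXZ

end

/-! ### Half filled configurations as diagrams, descendants as transforms, and approximate highest
weight vectors. -/

noncomputable section

namespace XXZ

open Finset

/-! ### Sums over subsets -/

theorem sum_powersetCard_insert {α : Type*} [DecidableEq α] (S : Finset α) (k : ℕ)
    (g : α → Finset α → ℂ) :
    ∑ Y ∈ powersetCard k S, ∑ y ∈ S \ Y, g y (insert y Y) =
      ∑ Y ∈ powersetCard (k + 1) S, ∑ y ∈ Y, g y Y := by
  rw [sum_sigma', sum_sigma']
  refine sum_bij' (fun p _ => ⟨insert p.2 p.1, p.2⟩) (fun p _ => ⟨p.1.erase p.2, p.2⟩)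
    ?_ ?_ ?_ ?_ ?_
  · rintro ⟨Y, y⟩ h
    simp only [mem_sigma, mem_powersetCard, mem_sdiff] at h ⊢
    obtain ⟨⟨h1, h2⟩, h3, h4⟩ := h
    exact ⟨⟨insert_subset h3 h1, by rw [card_insert_of_notMem h4, h2]⟩, mem_insert_self _ _⟩
  · rintro ⟨Y, y⟩ h
    simp only [mem_sigma, mem_powersetCard, mem_sdiff] at h ⊢
    obtain ⟨⟨h1, h2⟩, h3⟩ := h
    exact ⟨⟨(erase_subset _ _).trans h1, by rw [card_erase_of_mem h3, h2]; rfl⟩, h1 h3,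
      notMem_erase _ _⟩
  · rintro ⟨Y, y⟩ h
    simp only [mem_sigma, mem_powersetCard, mem_sdiff] at h
    simp [erase_insert h.2.2]
  · rintro ⟨Y, y⟩ h
    simp only [mem_sigma, mem_powersetCard] at h
    simp [insert_erase h.2]
  · rintro ⟨Y, y⟩ h
    rfl

theorem sum_pow_card_lt {α : Type*} [LinearOrder α] (t : ℂ) (Y : Finset α) :
    ∑ y ∈ Y, t ^ #{x ∈ Y | x < y} = ∑ i ∈ range #Y, t ^ i := by
  induction Y using Finset.induction_on_max with
  | empty => simp
  | insert a s h ih =>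
    have ha : a ∉ s := fun h' => lt_irrefl _ (h a h')
    rw [sum_insert ha, card_insert_of_notMem ha, sum_range_succ, ← ih, add_comm]
    congr 1
    · refine sum_congr rfl fun y hy => ?_
      rw [filter_insert, if_neg (h y hy).not_gt]
    · rw [filter_insert, if_neg (lt_irrefl a), filter_true_of_mem h]

theorem sum_card_le {α : Type*} [LinearOrder α] (Y : Finset α) :
    ∑ y ∈ Y, #{x ∈ Y | x ≤ y} = (#Y + 1).choose 2 := by
  induction Y using Finset.induction_on_max with
  | empty => simp
  | insert a s h ih =>
    have ha : a ∉ s := fun h' => lt_irrefl _ (h a h')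
    rw [sum_insert ha, card_insert_of_notMem ha, Nat.choose_succ_succ' (#s + 1) 1, ← ih]
    congr 1
    · rw [filter_true_of_mem, card_insert_of_notMem ha, Nat.choose_one_right]
      intro x hx
      rcases mem_insert.1 hx with rfl | hx
      · exact le_rfl
      · exact (h x hx).le
    · refine sum_congr rfl fun y hy => ?_
      rw [filter_insert, if_neg (h y hy).not_ge]

theorem sum_powersetCard_min (g : Finset ℕ → ℂ) (k s L : ℕ) :
    ∑ A ∈ powersetCard (k + 1) (Ioc s L), g A =
      ∑ l ∈ Ioc s L, ∑ A ∈ powersetCard k (Ioc l L), g (insert l A) := by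
  rw [sum_sigma']
  symm
  refine sum_bij (fun p _ => insert p.1 p.2) ?_ ?_ ?_ ?_
  · rintro ⟨l, A⟩ h
    simp only [mem_sigma, mem_powersetCard, mem_Ioc] at h ⊢
    obtain ⟨⟨h1, h2⟩, h3, h4⟩ := h
    refine ⟨insert_subset (mem_Ioc.2 ⟨h1, h2⟩) (h3.trans (Ioc_subset_Ioc_left h1.le)), ?_⟩
    rw [card_insert_of_notMem fun h => by simpa using h3 h, h4]
  · rintro ⟨l, A⟩ h ⟨l', A'⟩ h' heq
    simp only [mem_sigma, mem_powersetCard, mem_Ioc] at h h' heq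
    have hA : ∀ a ∈ A, l < a := fun a ha => (mem_Ioc.1 (h.2.1 ha)).1
    have hA' : ∀ a ∈ A', l' < a := fun a ha => (mem_Ioc.1 (h'.2.1 ha)).1
    have e1 : l ∈ insert l' A' := heq ▸ mem_insert_self _ _
    have e2 : l' ∈ insert l A := heq ▸ mem_insert_self _ _
    have hl : l = l' := by
      rcases mem_insert.1 e1 with e1 | e1
      · exact e1
      · rcases mem_insert.1 e2 with e2 | e2
        · exact e2.symm
        · exact absurd (hA _ e2) (hA' _ e1).not_gt
    subst hl
    congr 1
    have := congrArg (fun B => B.erase l) heq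
    simpa only [erase_insert fun h => lt_irrefl _ (hA _ h),
      erase_insert fun h => lt_irrefl _ (hA' _ h)] using this
  · intro B hB
    rw [mem_powersetCard] at hB
    have hne : B.Nonempty := card_pos.1 (by omega)
    have hmin := min'_mem B hne
    refine ⟨⟨B.min' hne, B.erase (B.min' hne)⟩, ?_, insert_erase hmin⟩
    simp only [mem_sigma, mem_powersetCard]
    refine ⟨hB.1 hmin, fun a ha => ?_, by rw [card_erase_of_mem hmin, hB.2]; rfl⟩
    rw [mem_erase] at ha
    exact mem_Ioc.2 ⟨lt_of_le_of_ne (min'_le B a ha.2) ha.1.symm, (mem_Ioc.1 (hB.1 ha.2)).2⟩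
  · rintro ⟨l, A⟩ h
    rfl

theorem prod_zpow_eq_zpow_sum {q : ℂ} (hq : q ≠ 0) {α : Type*} (s : Finset α) (f : α → ℤ) :
    ∏ i ∈ s, q ^ f i = q ^ ∑ i ∈ s, f i := by
  classical
  induction s using Finset.induction_on with
  | empty => simp
  | insert a s ha ih => rw [prod_insert ha, sum_insert ha, zpow_add₀ hq, ih]

theorem two_mul_choose_two (n : ℕ) : 2 * ((n.choose 2 : ℕ) : ℤ) = n * (n - 1) := by
  induction n with
  | zero => simp
  | succ n ih =>
    rw [Nat.choose_succ_succ' n 1, Nat.choose_one_right]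
    push_cast
    linarith

/-! ### Powers of the lowering operator -/

/-- Fix the set `Y` of spins that are lowered. Adding `y` last gives, relative to the weight in the
original configuration, the factor `q⁻²` for each element of `Y` to the left of `y`. Summing over
the choice of `y` gives a `q`-number of `#Y`, and iteration gives the product. -/
theorem opF_pow_apply {q : ℝ} (hq : q ≠ 0) {N : ℕ} (p : ℕ) (v : SpinChain N)
    (D : Finset (Fin N)) :
    (opF q N ^ p) v D = (∏ i ∈ range p, qNumber q (i + 1)) * ∑ Y ∈ powersetCard p D,
      (∏ y ∈ Y, leftWeight q y (D \ Y)) * v (D \ Y) := by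
  have hq' : (q : ℂ) ≠ 0 := by exact_mod_cast hq
  induction p generalizing D with
  | zero => simp
  | succ p ih =>
    rw [pow_succ', Module.End.mul_apply, opF_apply, ← sum_filter, filter_mem_eq_inter, univ_inter]
    simp only [ih, mul_sum]
    rw [sum_comm' (t' := powersetCard p D) (s' := fun Y => D \ Y)]
    · have h1 : ∀ Y ∈ powersetCard p D, ∀ y ∈ D \ Y,
          leftWeight q y D * ((∏ i ∈ range p, qNumber q (i + 1)) *
            ((∏ y' ∈ Y, leftWeight q y' (D.erase y \ Y)) * v (D.erase y \ Y))) =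
          (fun y Y' => (∏ i ∈ range p, qNumber q (i + 1)) *
            (((∏ y' ∈ Y', leftWeight q y' (D \ Y')) * v (D \ Y')) *
              ((q : ℂ)⁻¹ ^ 2) ^ #{x ∈ Y' | x < y})) y (insert y Y) := by
        intro Y hY y hy
        rw [mem_sdiff] at hy
        have hD : D.erase y \ Y = D \ insert y Y := by
          ext x; simp only [mem_sdiff, mem_erase, mem_insert]; tauto
        have hw : leftWeight q y D = leftWeight q y (D \ insert y Y) *
            ((q : ℂ)⁻¹ ^ 2) ^ #{x ∈ insert y Y | x < y} := by
          have hsub : insert y Y ⊆ D := insert_subset hy.1 (mem_powersetCard.1 hY).1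
          have hc : #{x ∈ D | x < y} = #{x ∈ D \ insert y Y | x < y} +
              #{x ∈ insert y Y | x < y} := by
            rw [← card_union_of_disjoint, ← filter_union, sdiff_union_of_subset hsub]
            exact disjoint_filter_filter sdiff_disjoint
          rw [leftWeight_eq hq, leftWeight_eq hq, hc, ← pow_mul, inv_pow, ← zpow_natCast,
            ← zpow_neg, ← zpow_add₀ hq']
          congr 1
          push_cast
          ring
        rw [hD, hw]
        dsimp only
        rw [prod_insert hy.2]
        ring
      rw [sum_congr rfl fun Y hY => sum_congr rfl (h1 Y hY), sum_powersetCard_insert D p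
        (fun y Y' => (∏ i ∈ range p, qNumber q (i + 1)) *
            (((∏ y' ∈ Y', leftWeight q y' (D \ Y')) * v (D \ Y')) *
              ((q : ℂ)⁻¹ ^ 2) ^ #{x ∈ Y' | x < y}))]
      refine sum_congr rfl fun Y hY => ?_
      rw [← mul_sum, ← mul_sum, sum_pow_card_lt, (mem_powersetCard.1 hY).2, prod_range_succ,
        ← qNumber]
      ring
    · intro y Y
      simp only [mem_powersetCard, mem_sdiff, subset_erase]
      tauto

theorem sum_powersetCard_compl {α : Type*} [DecidableEq α] {D : Finset α} {p m : ℕ}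
    (hD : #D = p + m) (g : Finset α → ℂ) :
    ∑ Y ∈ powersetCard p D, g (D \ Y) = ∑ X ∈ powersetCard m D, g X := by
  refine sum_nbij' (fun Y => D \ Y) (fun X => D \ X) ?_ ?_ ?_ ?_ (fun _ _ => rfl)
  · intro Y hY
    rw [mem_powersetCard] at hY ⊢
    exact ⟨sdiff_subset, by rw [card_sdiff_of_subset hY.1]; omega⟩
  · intro Y hY
    rw [mem_powersetCard] at hY ⊢
    exact ⟨sdiff_subset, by rw [card_sdiff_of_subset hY.1]; omega⟩
  · intro Y hY
    exact Finset.sdiff_sdiff_eq_self (mem_powersetCard.1 hY).1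
  · intro Y hY
    exact Finset.sdiff_sdiff_eq_self (mem_powersetCard.1 hY).1

theorem prod_qNumber {q : ℝ} (hq0 : 0 < q) (hq1 : q < 1) (p : ℕ) :
    ∏ i ∈ range p, qNumber q (i + 1) =
      ((q : ℂ) ^ (2 * p.choose 2))⁻¹ * ((qFactorial (q ^ 2) p : ℝ) : ℂ) := by
  have hq' : (q : ℂ) ≠ 0 := by exact_mod_cast hq0.ne'
  have hq2 : 1 - (q : ℂ) ^ 2 ≠ 0 := by
    rw [sub_ne_zero]
    norm_cast
    nlinarith
  have h : ∀ i, qNumber q (i + 1) =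
      ((q : ℂ) ^ (2 * i))⁻¹ * ((1 - ((q : ℂ) ^ 2) ^ (i + 1)) / (1 - (q : ℂ) ^ 2)) := by
    intro i
    induction i with
    | zero => simp [qNumber, div_self hq2]
    | succ i ih =>
      rw [qNumber, sum_range_succ, ← qNumber, ih]
      simp only [← pow_mul, inv_pow]
      have e1 : (q : ℂ) ^ (2 * (i + 1)) = q ^ (2 * i) * q ^ 2 := by ring
      have e2 : (q : ℂ) ^ (2 * (i + 1 + 1)) = q ^ (2 * i) * q ^ 4 := by ring
      rw [e1, e2]
      have : (q : ℂ) ^ (2 * i) ≠ 0 := pow_ne_zero _ hq'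
      generalize (q : ℂ) ^ (2 * i) = t at *
      field_simp
      ring
  simp only [h, prod_mul_distrib, qFactorial]
  push_cast
  congr 1
  rw [prod_inv_distrib, prod_pow_eq_pow_sum, ← mul_sum, sum_range_id, Nat.choose_two_right]

/-- On a half filled configuration every power of `K` acts as one. The product of `q`-numbers from
`F^p` cancels the `q`-factorial and leaves `q^{-2 p(p-1)/2}`, half of which is cancelled by the
normalization. -/
theorem descendant_apply {q : ℝ} (hq0 : 0 < q) (hq1 : q < 1) {p m L : ℕ}
    (hL : L = p + m) (v : SpinChain (2 * L)) {D : Finset (Fin (2 * L))} (hD : #D = L) :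
    descendant q _ p v D = ((q : ℂ) ^ p.choose 2)⁻¹ * ∑ X ∈ powersetCard m D,
      (∏ y ∈ D \ X, leftWeight q y X) * v X := by
  subst hL
  have hq' : (q : ℂ) ≠ 0 := by exact_mod_cast hq0.ne'
  have hf : ((qFactorial (q ^ 2) p : ℝ) : ℂ) ≠ 0 := by
    exact_mod_cast qFactorial_ne_zero hq0 hq1 p
  have h1 : ∑ Y ∈ powersetCard p D, (∏ y ∈ Y, leftWeight q y (D \ Y)) * v (D \ Y) =
      ∑ X ∈ powersetCard m D, (∏ y ∈ D \ X, leftWeight q y X) * v X := by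
    rw [← sum_powersetCard_compl hD fun X => (∏ y ∈ D \ X, leftWeight q y X) * v X]
    exact sum_congr rfl fun Y hY => by rw [Finset.sdiff_sdiff_eq_self (mem_powersetCard.1 hY).1]
  rw [descendant, PiLp.smul_apply, opK_apply hq0, opF_pow_apply hq0.ne', h1, hD,
    prod_qNumber hq0 hq1, smul_eq_mul]
  have h0 : (((2 * (p + m) : ℕ) : ℝ) - 2 * ((p + m : ℕ) : ℝ)) = 0 := by push_cast; ring
  rw [h0, mul_zero, Real.rpow_zero, two_mul (p.choose 2), pow_add]
  push_cast
  have : (q : ℂ) ^ p.choose 2 ≠ 0 := pow_ne_zero _ hq'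
  field_simp

/-! ### Highest weight wave functions on a finite interval -/

/-- A wave function on the subsets of `[-L, L)` that is annihilated by the raising operator. -/
structure IsHighestWeight (q : ℝ) (L : ℕ) (ψ : Finset ℤ → ℂ) : Prop where
  support : ∀ Z, ¬ Z ⊆ Ico (-(L : ℤ)) L → ψ Z = 0
  raise : ∀ Z, ∑ y ∈ Ico (-(L : ℤ)) L,
    (if y ∈ Z then 0 else raiseWeight q Z y * ψ (insert y Z)) = 0

/-- The sum over the positions of `k` particles to the left of `-r`. -/
def leftSum (q : ℝ) (L r : ℕ) (ψ : Finset ℤ → ℂ) (k : ℕ) (X : Finset ℤ) : ℂ :=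
  ∑ Y ∈ powersetCard k (Ico (-(L : ℤ)) (-(r : ℤ))), (∏ y ∈ Y, (q : ℂ) ^ y) * ψ (Y ∪ X)

theorem raiseWeight_union {q : ℝ} (hq : q ≠ 0) {X Y : Finset ℤ} (h : Disjoint Y X) (y : ℤ) :
    raiseWeight q (Y ∪ X) y = (q : ℂ) ^ y * ((q : ℂ)⁻¹ ^ 2) ^ rank Y y *
      ((q : ℂ)⁻¹ ^ 2) ^ rank X y := by
  have hq' : (q : ℂ) ≠ 0 := by exact_mod_cast hq
  have hr : rank (Y ∪ X) y = rank Y y + rank X y := by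
    rw [rank, filter_union, card_union_of_disjoint (disjoint_filter_filter h), rank, rank]
  rw [raiseWeight, hr, mul_assoc, ← pow_add, ← pow_mul, inv_pow, ← zpow_natCast, ← zpow_neg,
    ← zpow_add₀ hq']
  congr 1

theorem IsHighestWeight.raiseHalf_leftSum {q : ℝ} {L r : ℕ} {ψ : Finset ℤ → ℂ}
    (h : IsHighestWeight q L ψ) (k : ℕ) (X : Finset ℤ) :
    raiseHalf q (-(r : ℤ)) (leftSum q L r ψ k) X = ∑ y ∈ Ico (-(r : ℤ)) L,
      if y ∈ X then 0 else raiseWeight q X y * leftSum q L r ψ k (insert y X) := by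
  rw [raiseHalf, tsum_eq_sum (s := range (r + L))]
  · refine sum_nbij' (fun n : ℕ => -(r : ℤ) + n) (fun y => (y + r).toNat) ?_ ?_ ?_ ?_ ?_
    · intro n hn
      simp only [mem_range, mem_Ico] at hn ⊢
      omega
    · intro y hy
      simp only [mem_range, mem_Ico] at hy ⊢
      omega
    · intro n hn
      omega
    · intro y hy
      simp only [mem_Ico] at hy ⊢
      omega
    · intro n hn
      rfl
  · intro n hn
    rw [mem_range] at hn
    split_ifs with hX
    · rfl
    · rw [leftSum, sum_eq_zero, mul_zero]
      intro Y _
      rw [h.support, mul_zero]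
      intro hs
      have := hs (mem_union_right _ (mem_insert_self (-(r : ℤ) + n) X))
      rw [mem_Ico] at this
      omega

/-- Multiply the highest weight equation at `Y ∪ X` by `∏ q^y` and sum over the `k`-element sets `Y`
to the left of `-r`. Raising on the left turns `Y` into a set of `k + 1` particles, each obtained
with total multiplicity `qNumber q (k + 1)`. Raising at a site `≥ -r` passes all `k` left particles
and costs `q^{-2k}`. -/
theorem IsHighestWeight.qNumber_mul_leftSum {q : ℝ} (hq : q ≠ 0) {L r : ℕ} {ψ : Finset ℤ → ℂ}
    (h : IsHighestWeight q L ψ) (hr : r ≤ L) (k : ℕ) {X : Finset ℤ} (hX : ∀ x ∈ X, -(r : ℤ) ≤ x) :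
    qNumber q (k + 1) * leftSum q L r ψ (k + 1) X +
      ((q : ℂ)⁻¹ ^ 2) ^ k * raiseHalf q (-(r : ℤ)) (leftSum q L r ψ k) X = 0 := by
  set S := Ico (-(L : ℤ)) (-(r : ℤ)) with hS
  have hdisj : ∀ Y ⊆ S, Disjoint Y X := fun Y hY => disjoint_left.2 fun y hy hx => by
    have := mem_Ico.1 (hY hy)
    have := hX y hx
    omega
  have hleft : ∀ Y ∈ powersetCard k S, ∑ y ∈ S,
      (if y ∈ Y ∪ X then 0 else raiseWeight q (Y ∪ X) y * ψ (insert y (Y ∪ X))) =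
      ∑ y ∈ S \ Y, (q : ℂ) ^ y * ((q : ℂ)⁻¹ ^ 2) ^ #{x ∈ insert y Y | x < y} *
        ψ (insert y Y ∪ X) := by
    intro Y hY
    rw [sdiff_eq_filter, sum_filter]
    refine sum_congr rfl fun y hy => ?_
    have hyX : y ∉ X := fun hx => by
      have := mem_Ico.1 hy
      have := hX y hx
      omega
    by_cases hyY : y ∈ Y
    · simp [hyY]
    · rw [if_neg (by simp [hyY, hyX]), if_pos hyY,
        raiseWeight_union hq (hdisj Y (mem_powersetCard.1 hY).1), insert_union, filter_insert,
        if_neg (lt_irrefl y)]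
      have : rank X y = 0 := rank_eq_zero fun x hx => by
        have := mem_Ico.1 hy
        have := hX x hx
        omega
      rw [this, pow_zero, mul_one]
      rfl
  have hright : ∀ Y ∈ powersetCard k S, ∑ y ∈ Ico (-(r : ℤ)) L,
      (if y ∈ Y ∪ X then 0 else raiseWeight q (Y ∪ X) y * ψ (insert y (Y ∪ X))) =
      ∑ y ∈ Ico (-(r : ℤ)) L, if y ∈ X then 0 else
        ((q : ℂ)⁻¹ ^ 2) ^ k * (raiseWeight q X y * ψ (Y ∪ insert y X)) := by
    intro Y hY
    obtain ⟨hYS, hYk⟩ := mem_powersetCard.1 hY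
    refine sum_congr rfl fun y hy => ?_
    have hyY : y ∉ Y := fun hx => by
      have := mem_Ico.1 hy
      have := mem_Ico.1 (hYS hx)
      omega
    by_cases hyX : y ∈ X
    · simp [hyX]
    · rw [if_neg (by simp [hyY, hyX]), if_neg hyX, raiseWeight_union hq (hdisj Y hYS),
        union_insert]
      have h1 : rank Y y = k := by
        rw [← hYk]
        refine rank_eq_card fun x hx => ?_
        have := mem_Ico.1 hy
        have := mem_Ico.1 (hYS hx)
        omega
      have h2 : raiseWeight q X y = (q : ℂ) ^ y * ((q : ℂ)⁻¹ ^ 2) ^ rank X y := by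
        have := raiseWeight_union hq (disjoint_empty_left X) y
        rwa [empty_union, show rank ∅ y = 0 from rfl, pow_zero, mul_one] at this
      rw [h1, h2]
      ring
  have hsum : ∑ Y ∈ powersetCard k S, (∏ y ∈ Y, (q : ℂ) ^ y) * (∑ y ∈ Ico (-(L : ℤ)) L,
      (if y ∈ Y ∪ X then 0 else raiseWeight q (Y ∪ X) y * ψ (insert y (Y ∪ X)))) = 0 :=
    sum_eq_zero fun Y _ => by rw [h.raise, mul_zero]
  have hsplit : Ico (-(L : ℤ)) L = S ∪ Ico (-(r : ℤ)) L :=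
    (Ico_union_Ico_eq_Ico (by omega) (by omega)).symm
  have hd : Disjoint S (Ico (-(r : ℤ)) L) := Ico_disjoint_Ico_consecutive _ _ _
  rw [hsplit] at hsum
  simp only [sum_union hd, mul_add, sum_add_distrib] at hsum
  rw [← hsum]
  congr 1
  · symm
    calc _ = ∑ Y ∈ powersetCard k S, ∑ y ∈ S \ Y, (fun y Y' => ((∏ y ∈ Y', (q : ℂ) ^ y) *
          ψ (Y' ∪ X)) * ((q : ℂ)⁻¹ ^ 2) ^ #{x ∈ Y' | x < y}) y (insert y Y) := by
          refine sum_congr rfl fun Y hY => ?_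
          rw [hleft Y hY, mul_sum]
          refine sum_congr rfl fun y hy => ?_
          rw [Finset.mem_sdiff] at hy
          dsimp only
          rw [prod_insert hy.2]
          ring
      _ = _ := by
          rw [sum_powersetCard_insert S k (fun y Y' => ((∏ y ∈ Y', (q : ℂ) ^ y) *
            ψ (Y' ∪ X)) * ((q : ℂ)⁻¹ ^ 2) ^ #{x ∈ Y' | x < y}), leftSum, mul_sum]
          refine sum_congr rfl fun Y hY => ?_
          rw [← mul_sum, sum_pow_card_lt, (mem_powersetCard.1 hY).2, ← qNumber, mul_comm]
  · have hc : ∀ Y ∈ powersetCard k S, (∏ y ∈ Y, (q : ℂ) ^ y) * (∑ y ∈ Ico (-(r : ℤ)) L,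
        if y ∈ Y ∪ X then 0 else raiseWeight q (Y ∪ X) y * ψ (insert y (Y ∪ X))) = _ :=
      fun Y hY => by rw [hright Y hY, mul_sum]
    rw [h.raiseHalf_leftSum, mul_sum, sum_congr rfl hc, sum_comm]
    refine sum_congr rfl fun y _ => ?_
    by_cases hy : y ∈ X
    · simp [hy]
    · simp only [if_neg hy, leftSum, mul_sum]
      refine sum_congr rfl fun Y _ => ?_
      ring

/-- Both sides satisfy the same recursion. The left side sums over a region that grows with `L`,
while the right side does not mention `L`; this is what makes the limit of long chains accessible.
-/
theorem IsHighestWeight.leftSum_eq_tailSum {q : ℝ} (hq0 : 0 < q) {L r : ℕ} {ψ : Finset ℤ → ℂ}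
    (h : IsHighestWeight q L ψ) (hr : r ≤ L) (k : ℕ) {X : Finset ℤ}
    (hX : ∀ x ∈ X, -(r : ℤ) ≤ x) :
    leftSum q L r ψ k X = tailSum q (-(r : ℤ)) ψ k X := by
  induction k generalizing X with
  | zero => simp [leftSum, tailSum]
  | succ k ih =>
    have h1 := h.qNumber_mul_leftSum hq0.ne' hr k hX
    have h2 : raiseHalf q (-(r : ℤ)) (leftSum q L r ψ k) X =
        raiseHalf q (-(r : ℤ)) (tailSum q (-(r : ℤ)) ψ k) X := by
      refine tsum_congr fun n => ?_
      split_ifs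
      · rfl
      · rw [ih]
        intro x hx
        rcases mem_insert.1 hx with rfl | hx
        · omega
        · exact hX x hx
    rw [h2] at h1
    rw [tailSum]
    have := qNumber_ne_zero hq0 k
    field_simp
    linear_combination h1

/-! ### Sums over the positions given by a diagram -/

theorem part_eq_zero {δ : YoungDiagram} {l : ℕ} (h : δ.colLen 0 < l) : part δ l = 0 := by
  by_contra h'
  have : (l - 1, 0) ∈ δ := YoungDiagram.mem_iff_lt_rowLen.2 (Nat.pos_of_ne_zero h')
  rw [YoungDiagram.mem_iff_lt_colLen] at this
  omega

theorem dwPos_injective (δ : YoungDiagram) : Function.Injective (dwPos δ) := fun a b hab => by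
  by_contra hne
  rcases lt_or_gt_of_ne hne with h | h
  · exact (dwPos_strictAnti δ h).ne hab.symm
  · exact (dwPos_strictAnti δ h).ne hab

/-- The positions `δ_l - l` as an embedding. -/
def dwEmb (δ : YoungDiagram) : ℕ ↪ ℤ := ⟨dwPos δ, dwPos_injective δ⟩

theorem dwEmb_apply (δ : YoungDiagram) (l : ℕ) : dwEmb δ l = dwPos δ l := rfl

/-- Split according to the smallest index `l`. If `l ≤ r`, that particle is placed and induction
continues. If `l > r`, all rows involved are empty, so the positions are `-l` with weights `q^{-l}`,
and the sum is a `leftSum`. -/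
theorem IsHighestWeight.sum_eq_peelSum {q : ℝ} (hq0 : 0 < q) {L : ℕ} {ψ : Finset ℤ → ℂ}
    (h : IsHighestWeight q L ψ) {δ : YoungDiagram} (hr : δ.colLen 0 ≤ L) (k s : ℕ)
    (hs : s ≤ δ.colLen 0) {X : Finset ℤ} (hX : ∀ x ∈ X, -(δ.colLen 0 : ℤ) ≤ x) :
    ∑ A ∈ powersetCard k (Ioc s L), (∏ a ∈ A, dwWeight q δ a) * ψ (A.map (dwEmb δ) ∪ X) =
      peelSum (dwWeight q δ) (dwPos δ) (δ.colLen 0) (tailSum q (-(δ.colLen 0 : ℤ)) ψ) k s X := by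
  induction k generalizing s X with
  | zero => simp [peelSum, tailSum]
  | succ k ih =>
    set r := δ.colLen 0 with hrdef
    have hstep : ∀ s, ∑ A ∈ powersetCard (k + 1) (Ioc s L),
        (∏ a ∈ A, dwWeight q δ a) * ψ (A.map (dwEmb δ) ∪ X) =
        ∑ l ∈ Ioc s L, dwWeight q δ l * ∑ A ∈ powersetCard k (Ioc l L),
          (∏ a ∈ A, dwWeight q δ a) * ψ (A.map (dwEmb δ) ∪ insert (dwPos δ l) X) := by
      intro s
      rw [sum_powersetCard_min]
      refine sum_congr rfl fun l _ => ?_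
      rw [mul_sum]
      refine sum_congr rfl fun A hA => ?_
      have hl : l ∉ A := fun hl => by simpa using (mem_powersetCard.1 hA).1 hl
      rw [prod_insert hl, map_insert, dwEmb_apply, insert_union, union_insert, mul_assoc]
    have hsplit : Ioc s L = Ioc s r ∪ Ioc r L := (Ioc_union_Ioc_eq_Ioc hs hr).symm
    rw [hstep, hsplit, sum_union (Ioc_disjoint_Ioc_of_le le_rfl), ← hstep, peelSum]
    congr 1
    · refine sum_congr rfl fun l hl => ?_
      rw [mem_Ioc] at hl
      rw [ih l hl.2]
      intro x hx
      rcases mem_insert.1 hx with rfl | hx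
      · rw [dwPos]
        omega
      · exact hX x hx
    · rw [← h.leftSum_eq_tailSum hq0 hr _ hX, leftSum]
      have hmap : Ico (-(L : ℤ)) (-(r : ℤ)) =
          (Ioc r L).map (dwEmb δ) := by
        ext y
        simp only [mem_Ico, mem_map, mem_Ioc, dwEmb_apply]
        constructor
        · intro hy
          refine ⟨(-y).toNat, by omega, ?_⟩
          rw [dwPos, part_eq_zero (by omega)]
          omega
        · rintro ⟨l, hl, rfl⟩
          rw [dwPos, part_eq_zero (by omega)]
          omega
      rw [hmap, powersetCard_map, sum_map]
      refine sum_congr rfl fun A hA => ?_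
      rw [RelEmbedding.coe_toEmbedding, mapEmbedding_apply, prod_map]
      congr 1
      refine prod_congr rfl fun a ha => ?_
      have := mem_Ioc.1 ((mem_powersetCard.1 hA).1 ha)
      rw [dwWeight, dwEmb_apply, dwPos, part_eq_zero (by omega)]
      simp

theorem card_eq_sum_part {δ : YoungDiagram} {L : ℕ} (h : δ.colLen 0 ≤ L) :
    δ.card = ∑ l ∈ Ioc 0 L, part δ l := by
  have h1 : δ.card = ∑ i ∈ range L, #(δ.row i) := by
    refine card_eq_sum_card_fiberwise (f := Prod.fst) fun c hc => ?_
    have hc' : (c.1, c.2) ∈ δ := hc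
    have : (c.1, 0) ∈ δ := δ.up_left_mem le_rfl (Nat.zero_le _) hc'
    rw [YoungDiagram.mem_iff_lt_colLen] at this
    simp only [coe_range, Set.mem_Iio]
    omega
  rw [h1]
  refine sum_nbij' (fun i => i + 1) (fun l => l - 1) ?_ ?_ ?_ ?_ ?_
  · intro i hi
    simp only [mem_range, mem_Ioc] at hi ⊢
    omega
  · intro l hl
    simp only [mem_range, mem_Ioc] at hl ⊢
    omega
  · intro i hi
    simp
  · intro l hl
    simp only [mem_Ioc] at hl
    omega
  · intro i hi
    rw [← YoungDiagram.rowLen_eq_card]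
    rfl

/-- Each `a ∈ A` counts the numbers `1, …, a`: those in `A` and those outside. The former add up to
a triangular number, the latter to the number of inversions. -/
theorem sum_eq_choose_add_inversions {A : Finset ℕ} {L : ℕ} (hA : A ⊆ Ioc 0 L) :
    ∑ a ∈ A, a = (#A + 1).choose 2 + ∑ b ∈ Ioc 0 L \ A, #{a ∈ A | b < a} := by
  have h1 : ∑ b ∈ Ioc 0 L \ A, #{a ∈ A | b < a} = ∑ a ∈ A, #{b ∈ Ioc 0 L \ A | b < a} :=
    sum_card_bipartiteAbove_eq_sum_card_bipartiteBelow _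
  rw [h1, ← sum_card_le, ← sum_add_distrib]
  refine sum_congr rfl fun a ha => ?_
  have haL := mem_Ioc.1 (hA ha)
  rw [← card_union_of_disjoint]
  · have : {x ∈ A | x ≤ a} ∪ {b ∈ Ioc 0 L \ A | b < a} = Ioc 0 a := by
      ext x
      simp only [mem_union, mem_filter, Finset.mem_sdiff, mem_Ioc]
      constructor
      · rintro (⟨hx, h⟩ | ⟨⟨hx, _⟩, h⟩)
        · exact ⟨(mem_Ioc.1 (hA hx)).1, h⟩
        · exact ⟨hx.1, h.le⟩
      · intro hx
        by_cases hxA : x ∈ A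
        · exact Or.inl ⟨hxA, hx.2⟩
        · exact Or.inr ⟨⟨⟨hx.1, by omega⟩, hxA⟩, lt_of_le_of_ne hx.2 fun h => hxA (h ▸ ha)⟩
    rw [this, Nat.card_Ioc, Nat.sub_zero]
  · exact disjoint_left.2 fun x hx hx' =>
      (Finset.mem_sdiff.1 (mem_filter.1 hx').1).2 (mem_filter.1 hx).1

theorem sum_Ioc_id (L : ℕ) : ∑ l ∈ Ioc 0 L, l = (L + 1).choose 2 := by
  have := sum_eq_choose_add_inversions (A := Ioc 0 L) (L := L) subset_rfl
  simpa using this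

/-- The power of `q` in a descendant, from its normalization and the weights of the lowered spins,
is compared with the prefactor and the weights of the domain wall state. The inversion count is
eliminated by the preceding lemma, and the rest is `∑ δ_l = |δ|` with triangular numbers. -/
theorem exponent_eq {δ : YoungDiagram} {p m : ℕ} (hδ : δ.colLen 0 ≤ p + m) {A : Finset ℕ}
    (hA : A ∈ powersetCard m (Ioc 0 (p + m))) :
    -(p.choose 2 : ℤ) + ∑ b ∈ Ioc 0 (p + m) \ A,
      (dwPos δ b + (p + m : ℕ) - 2 * (#{a ∈ A | b < a} : ℤ)) =
    ((m + 1).choose 2 : ℕ) + (δ.card : ℕ) - ∑ a ∈ A, ((part δ a + a : ℕ) : ℤ) := by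
  obtain ⟨hAs, hAm⟩ := mem_powersetCard.1 hA
  have h1 := sum_eq_choose_add_inversions hAs
  have h2 := sum_Ioc_id (p + m)
  have h3 := card_eq_sum_part hδ
  have h4 : #(Ioc 0 (p + m) \ A) = p := by
    rw [card_sdiff_of_subset hAs, Nat.card_Ioc]
    omega
  rw [← sum_sdiff hAs] at h2 h3
  rw [hAm] at h1
  simp only [dwPos, sum_sub_distrib, sum_add_distrib, sum_const, h4, ← mul_sum, nsmul_eq_mul]
  have e1 := two_mul_choose_two p
  have e2 := two_mul_choose_two (m + 1)
  have e3 := two_mul_choose_two (p + m + 1)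
  have h1' := congrArg (Nat.cast : ℕ → ℤ) h1
  have h2' := congrArg (Nat.cast : ℕ → ℤ) h2
  have h3' := congrArg (Nat.cast : ℕ → ℤ) h3
  push_cast at h1' h2' h3' e1 e2 e3 ⊢
  simp only [sum_add_distrib]
  linarith

/-! ### Diagrams in a box and half filled chains -/

/-- The diagram `δ` fits into the `L × L` box. -/
def InBox (L : ℕ) (δ : YoungDiagram) : Prop := δ.colLen 0 ≤ L ∧ δ.rowLen 0 ≤ L

/-- The positions `δ_l - l`, `l = 1, …, L`, as a set of sites of the chain on `[-L, L)`. -/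
def boxSet (L : ℕ) (δ : YoungDiagram) : Finset (Fin (2 * L)) :=
  {i | -(L : ℤ) + ((i : ℕ) : ℤ) ∈ (Ioc 0 L).map (dwEmb δ)}

/-- The diagram whose rows count the empty sites to the left of the occupied sites. -/
def diagramOf {N : ℕ} (D : Finset (Fin N)) : YoungDiagram where
  cells := {c ∈ range N ×ˢ range (N + 1) | ∃ x ∈ D, c.1 ≤ #{y ∈ D | x < y} ∧
    c.2 < #{y ∈ Dᶜ | y < x}}
  isLowerSet := by
    rintro ⟨i, j⟩ ⟨i', j'⟩ hle hmem
    obtain ⟨h1, h2⟩ := Prod.mk_le_mk.1 hle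
    simp only [coe_filter, mem_product, mem_range, Set.mem_ofPred_eq] at hmem ⊢
    obtain ⟨h3, x, hx, h4, h5⟩ := hmem
    exact ⟨⟨by omega, by omega⟩, x, hx, by omega, by omega⟩

theorem mem_diagramOf {N : ℕ} {D : Finset (Fin N)} {i j : ℕ} :
    (i, j) ∈ diagramOf D ↔ ∃ x ∈ D, i ≤ #{y ∈ D | x < y} ∧ j < #{y ∈ Dᶜ | y < x} := by
  have : (i, j) ∈ diagramOf D ↔ (i, j) ∈ (diagramOf D).cells := Iff.rfl
  rw [this, diagramOf]
  simp only [mem_filter, mem_product, mem_range, and_iff_right_iff_imp]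
  rintro ⟨x, hx, h1, h2⟩
  have h3 : #{y ∈ D | x < y} < #D := card_lt_card ⟨filter_subset _ _, fun h => by simpa using h hx⟩
  have h4 : #D ≤ N := by simpa using card_le_univ D
  have h5 : #{y ∈ Dᶜ | y < x} ≤ N := by simpa using card_le_univ {y ∈ Dᶜ | y < x}
  omega

/-- A witness in the definition of the diagram with at least as many occupied sites to its right as
`d` lies at or to the left of `d`, so it sees no more empty sites on its left than `d` does. -/
theorem rowLen_diagramOf {N : ℕ} {D : Finset (Fin N)} {d : Fin N} (hd : d ∈ D) :
    (diagramOf D).rowLen #{y ∈ D | d < y} = #{y ∈ Dᶜ | y < d} := by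
  refine eq_of_forall_lt_iff fun j => ?_
  rw [← YoungDiagram.mem_iff_lt_rowLen, mem_diagramOf]
  constructor
  · rintro ⟨x, hx, h1, h2⟩
    have hxd : x ≤ d := by
      by_contra! h
      refine absurd h1 (not_le.2 (card_lt_card ⟨fun y hy => ?_, fun h' => ?_⟩))
      · rw [mem_filter] at hy ⊢
        exact ⟨hy.1, h.trans hy.2⟩
      · simpa using h' (mem_filter.2 ⟨hx, h⟩)
    refine h2.trans_le (card_le_card fun y hy => ?_)
    rw [mem_filter] at hy ⊢
    exact ⟨hy.1, hy.2.trans_le hxd⟩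
  · exact fun h => ⟨d, hd, le_rfl, h⟩

theorem card_lt_add_card_compl_lt {N : ℕ} (D : Finset (Fin N)) (d : Fin N) :
    #{y ∈ D | y < d} + #{y ∈ Dᶜ | y < d} = d := by
  rw [← card_union_of_disjoint (disjoint_filter_filter disjoint_compl_right), ← filter_union,
    union_compl]
  have : ({y | y < d} : Finset (Fin N)) = Iio d := by ext; simp
  rw [this, Fin.card_Iio]

theorem card_lt_add_card_gt {α : Type*} [LinearOrder α] {D : Finset α} {d : α} (hd : d ∈ D) :
    #{y ∈ D | y < d} + #{y ∈ D | d < y} + 1 = #D := by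
  rw [← card_union_of_disjoint, ← card_insert_of_notMem (a := d)]
  · congr 1
    ext x
    simp only [mem_insert, mem_union, mem_filter]
    constructor
    · rintro (rfl | h | h)
      exacts [hd, h.1, h.1]
    · intro hx
      rcases lt_trichotomy x d with h | h | h
      exacts [Or.inr (Or.inl ⟨hx, h⟩), Or.inl h, Or.inr (Or.inr ⟨hx, h⟩)]
  · simp
  · exact disjoint_filter.2 fun x _ h h' => lt_asymm h h'

theorem dwPos_diagramOf {L : ℕ} {D : Finset (Fin (2 * L))} (hD : #D = L) {d : Fin (2 * L)}
    (hd : d ∈ D) :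
    dwPos (diagramOf D) (#{y ∈ D | d < y} + 1) = -(L : ℤ) + ((d : ℕ) : ℤ) := by
  have h1 := card_lt_add_card_compl_lt D d
  have h2 := card_lt_add_card_gt hd
  rw [dwPos, part, Nat.add_sub_cancel, rowLen_diagramOf hd]
  omega

theorem siteSet_eq_map_dwEmb_diagramOf {L : ℕ} {D : Finset (Fin (2 * L))} (hD : #D = L) :
    siteSet (-(L : ℤ)) D = (Ioc 0 L).map (dwEmb (diagramOf D)) := by
  refine eq_of_subset_of_card_le (fun x hx => ?_) ?_
  · simp only [siteSet, mem_map, siteEmb_apply] at hx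
    obtain ⟨d, hd, rfl⟩ := hx
    rw [mem_map]
    refine ⟨#{y ∈ D | d < y} + 1, ?_, dwPos_diagramOf hD hd⟩
    have h2 := card_lt_add_card_gt hd
    rw [mem_Ioc]
    omega
  · rw [card_map, card_siteSet, hD, Nat.card_Ioc, Nat.sub_zero]

theorem inBox_diagramOf {L : ℕ} {D : Finset (Fin (2 * L))} (hD : #D = L) :
    InBox L (diagramOf D) := by
  constructor
  · by_contra! h
    rw [← YoungDiagram.mem_iff_lt_colLen, mem_diagramOf] at h
    obtain ⟨x, hx, h1, _⟩ := h
    have := card_lt_add_card_gt hx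
    omega
  · by_contra! h
    rw [← YoungDiagram.mem_iff_lt_rowLen, mem_diagramOf] at h
    obtain ⟨x, hx, _, h1⟩ := h
    have h2 : #{y ∈ Dᶜ | y < x} ≤ #Dᶜ := card_filter_le _ _
    rw [card_compl, hD, Fintype.card_fin] at h2
    omega

theorem siteSet_boxSet {L : ℕ} {δ : YoungDiagram} (h : InBox L δ) :
    siteSet (-(L : ℤ)) (boxSet L δ) = (Ioc 0 L).map (dwEmb δ) := by
  ext x
  constructor
  · intro hx
    simp only [siteSet, mem_map, siteEmb_apply, boxSet, mem_filter, mem_univ, true_and] at hx ⊢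
    obtain ⟨i, hi, rfl⟩ := hx
    exact hi
  · intro hx
    obtain ⟨l, hl, hlx⟩ := mem_map.1 hx
    rw [mem_Ioc] at hl
    rw [dwEmb_apply, dwPos] at hlx
    have h1 : part δ l ≤ L := (δ.rowLen_anti 0 _ (Nat.zero_le _)).trans h.2
    have h2 : x = -(L : ℤ) + (((x + L).toNat : ℕ) : ℤ) := by omega
    have h3 : (x + L).toNat < 2 * L := by omega
    rw [h2]
    refine (mem_siteSet (y := ⟨(x + L).toNat, h3⟩)).2 ?_
    rw [boxSet, mem_filter]
    refine ⟨mem_univ _, ?_⟩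
    simp only
    rwa [← h2]

theorem card_boxSet {L : ℕ} {δ : YoungDiagram} (h : InBox L δ) : #(boxSet L δ) = L := by
  rw [← card_siteSet (-(L : ℤ)), siteSet_boxSet h, card_map, Nat.card_Ioc, Nat.sub_zero]

theorem dwPos_eq_of_map_eq {L : ℕ} {δ δ' : YoungDiagram}
    (h : (Ioc 0 L).map (dwEmb δ) = (Ioc 0 L).map (dwEmb δ')) {l : ℕ} (hl : l ∈ Ioc 0 L) :
    dwPos δ l = dwPos δ' l := by
  have hc : ∀ δ : YoungDiagram, #((Ioc 0 L).map (dwEmb δ)) = L := fun δ => by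
    rw [card_map, Nat.card_Ioc, Nat.sub_zero]
  have hu : ∀ δ : YoungDiagram, (fun i : Fin L => dwPos δ (L - i)) =
      ((Ioc 0 L).map (dwEmb δ)).orderEmbOfFin (hc δ) := by
    intro δ
    refine orderEmbOfFin_unique (hc δ) (fun i => ?_) fun i j hij => ?_
    · refine mem_map_of_mem (dwEmb δ) (mem_Ioc.2 ?_)
      omega
    · rw [Fin.lt_def] at hij
      exact dwPos_strictAnti δ (by omega)
  rw [mem_Ioc] at hl
  have h1 := congrFun (hu δ) ⟨L - l, by omega⟩
  have h2 := congrFun (hu δ') ⟨L - l, by omega⟩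
  simp only [h] at h1 h2
  rw [← h2] at h1
  rwa [Nat.sub_sub_self hl.2] at h1

theorem eq_of_map_dwEmb_eq {L : ℕ} {δ δ' : YoungDiagram} (hδ : InBox L δ) (hδ' : InBox L δ')
    (h : (Ioc 0 L).map (dwEmb δ) = (Ioc 0 L).map (dwEmb δ')) : δ = δ' := by
  have hr : ∀ i, δ.rowLen i = δ'.rowLen i := by
    intro i
    by_cases hi : i < L
    · have := dwPos_eq_of_map_eq h (l := i + 1) (mem_Ioc.2 (by omega))
      simp only [dwPos, part, Nat.add_sub_cancel] at this
      omega
    · have h1 := part_eq_zero (δ := δ) (l := i + 1) (by have := hδ.1; omega)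
      have h2 := part_eq_zero (δ := δ') (l := i + 1) (by have := hδ'.1; omega)
      rw [part, Nat.add_sub_cancel] at h1 h2
      rw [h1, h2]
  ext ⟨i, j⟩
  rw [YoungDiagram.mem_cells, YoungDiagram.mem_cells, YoungDiagram.mem_iff_lt_rowLen,
    YoungDiagram.mem_iff_lt_rowLen, hr]

theorem siteSet_injective (c : ℤ) (N : ℕ) :
    Function.Injective (siteSet c : Finset (Fin N) → Finset ℤ) :=
  Finset.map_injective _

theorem boxSet_diagramOf {L : ℕ} {D : Finset (Fin (2 * L))} (hD : #D = L) :
    boxSet L (diagramOf D) = D :=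
  siteSet_injective (-(L : ℤ)) _
    (by rw [siteSet_boxSet (inBox_diagramOf hD), siteSet_eq_map_dwEmb_diagramOf hD])

theorem diagramOf_boxSet {L : ℕ} {δ : YoungDiagram} (h : InBox L δ) :
    diagramOf (boxSet L δ) = δ :=
  eq_of_map_dwEmb_eq (inBox_diagramOf (card_boxSet h)) h
    (by rw [← siteSet_eq_map_dwEmb_diagramOf (card_boxSet h), siteSet_boxSet h])

/-- The diagrams in the `L × L` box. -/
def boxDiagrams (L : ℕ) : Finset YoungDiagram := by
  classical
  exact (powersetCard L (univ : Finset (Fin (2 * L)))).image diagramOf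

theorem mem_boxDiagrams {L : ℕ} {δ : YoungDiagram} : δ ∈ boxDiagrams L ↔ InBox L δ := by
  classical
  rw [boxDiagrams, mem_image]
  constructor
  · rintro ⟨D, hD, rfl⟩
    exact inBox_diagramOf (mem_powersetCard.1 hD).2
  · exact fun h => ⟨boxSet L δ, mem_powersetCard.2 ⟨subset_univ _, card_boxSet h⟩,
      diagramOf_boxSet h⟩

theorem sum_boxDiagrams {E : Type*} [AddCommMonoid E] (L : ℕ) (g : Finset (Fin (2 * L)) → E) :
    ∑ δ ∈ boxDiagrams L, g (boxSet L δ) = ∑ D ∈ powersetCard L univ, g D := by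
  classical
  rw [boxDiagrams, sum_image]
  · exact sum_congr rfl fun D hD => by rw [boxSet_diagramOf (mem_powersetCard.1 hD).2]
  · intro D hD D' hD' h
    rw [← boxSet_diagramOf (mem_powersetCard.1 hD).2, h, boxSet_diagramOf (mem_powersetCard.1 hD').2]

/-! ### Descendants at half filling -/

/-- A vector of the chain on `[c, c + N)` as a function on the finite subsets of `ℤ`. -/
def extendChain (c : ℤ) {N : ℕ} (v : SpinChain N) (Z : Finset ℤ) : ℂ :=
  if Z ⊆ Ico c (c + N) then v {i | c + ((i : ℕ) : ℤ) ∈ Z} else 0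

theorem extendChain_siteSet (c : ℤ) {N : ℕ} (v : SpinChain N) (X : Finset (Fin N)) :
    extendChain c v (siteSet c X) = v X := by
  have h : siteSet c X ⊆ Ico c (c + N) := fun x hx =>
    mem_Ico.2 ⟨le_of_mem_siteSet hx, lt_of_mem_siteSet hx⟩
  have h' : ({i | c + ((i : ℕ) : ℤ) ∈ siteSet c X} : Finset (Fin N)) = X := by
    ext i
    simp [mem_siteSet]
  rw [extendChain, if_pos h, h']

theorem exists_siteSet_eq {c : ℤ} {N : ℕ} {Z : Finset ℤ} (h : Z ⊆ Ico c (c + N)) :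
    ∃ X : Finset (Fin N), siteSet c X = Z := by
  refine ⟨({i | c + ((i : ℕ) : ℤ) ∈ Z} : Finset (Fin N)), ?_⟩
  ext x
  simp only [siteSet, mem_map, siteEmb_apply, mem_filter, mem_univ, true_and]
  constructor
  · rintro ⟨i, hi, rfl⟩
    exact hi
  · intro hx
    have := mem_Ico.1 (h hx)
    have e : c + (((x - c).toNat : ℕ) : ℤ) = x := by omega
    exact ⟨⟨(x - c).toNat, by omega⟩, by simpa only [e] using hx, e⟩

theorem leftWeight_eq_raiseWeight {q : ℝ} (hq : q ≠ 0) (c : ℤ) {N : ℕ} (y : Fin N)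
    (X : Finset (Fin N)) :
    leftWeight q y X = (q : ℂ) ^ (-c) * raiseWeight q (siteSet c X) (c + ((y : ℕ) : ℤ)) := by
  have hq' : (q : ℂ) ≠ 0 := by exact_mod_cast hq
  rw [leftWeight_eq hq, raiseWeight, rank_siteSet, ← zpow_add₀ hq']
  congr 1
  ring

theorem isHighestWeight_extendChain {q : ℝ} (hq : q ≠ 0) {L : ℕ} {v : SpinChain (2 * L)}
    (hv : opE q _ v = 0) : IsHighestWeight q L (extendChain (-(L : ℤ)) v) := by
  have hq' : (q : ℂ) ≠ 0 := by exact_mod_cast hq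
  have hI : Ico (-(L : ℤ)) (-(L : ℤ) + (2 * L : ℕ)) = Ico (-(L : ℤ)) L := by
    congr 1
    push_cast
    ring
  refine ⟨fun Z hZ => ?_, fun Z => ?_⟩
  · rw [extendChain, hI, if_neg hZ]
  · by_cases hZ : Z ⊆ Ico (-(L : ℤ)) L
    · obtain ⟨X, rfl⟩ := exists_siteSet_eq (hI ▸ hZ)
      have h1 : opE q _ v X = 0 := by rw [hv]; rfl
      rw [opE_apply] at h1
      have h2 : ∑ y : Fin (2 * L), (if y ∈ X then 0 else leftWeight q y X * v (insert y X)) =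
          (q : ℂ) ^ (-(-(L : ℤ))) * ∑ y ∈ Ico (-(L : ℤ)) L,
            (if y ∈ siteSet (-(L : ℤ)) X then 0 else raiseWeight q (siteSet (-(L : ℤ)) X) y *
              extendChain (-(L : ℤ)) v (insert y (siteSet (-(L : ℤ)) X))) := by
        rw [mul_sum]
        refine sum_bij (fun y _ => -(L : ℤ) + ((y : ℕ) : ℤ)) ?_ ?_ ?_ ?_
        · intro y _
          rw [mem_Ico]
          omega
        · intro y _ y' _ h
          exact Fin.ext (by omega)
        · intro y hy
          rw [mem_Ico] at hy
          refine ⟨⟨(y + L).toNat, by omega⟩, mem_univ _, ?_⟩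
          simp only
          omega
        · intro y _
          simp only [mem_siteSet]
          by_cases hy : y ∈ X
          · simp [hy]
          · rw [if_neg hy, if_neg hy, ← siteSet_insert, extendChain_siteSet,
              leftWeight_eq_raiseWeight hq (-(L : ℤ))]
            ring
      rw [h2] at h1
      exact (mul_eq_zero.1 h1).resolve_left (zpow_ne_zero _ hq')
    · refine sum_eq_zero fun y _ => ?_
      split_ifs
      · rfl
      · rw [extendChain, hI, if_neg fun h => hZ ((subset_insert _ _).trans h), mul_zero]

theorem sum_powersetCard_siteSet {c : ℤ} {N : ℕ} (D : Finset (Fin N)) (m : ℕ)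
    (g : Finset ℤ → ℂ) :
    ∑ X ∈ powersetCard m D, g (siteSet c X) = ∑ Z ∈ powersetCard m (siteSet c D), g Z := by
  rw [siteSet, powersetCard_map, sum_map]
  rfl

theorem card_filter_dwEmb_lt (δ : YoungDiagram) (A : Finset ℕ) (b : ℕ) :
    rank (A.map (dwEmb δ)) (dwPos δ b) = #{a ∈ A | b < a} := by
  rw [rank, filter_map, card_map]
  congr 1
  ext a
  simp only [mem_filter, Function.comp_apply, dwEmb_apply]
  refine and_congr_right fun _ => ⟨fun h => ?_, fun h => dwPos_strictAnti δ h⟩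
  by_contra! h'
  rcases h'.eq_or_lt with rfl | h'
  · exact lt_irrefl _ h
  · exact lt_asymm h (dwPos_strictAnti δ h')

/-- The link between finite chains and the transform. The component of the descendant is a sum over
which `m` of the `L` occupied positions carry the magnons of `v`. After shifting the origin by `L`
the powers of `q` agree by `exponent_eq`, and the highest weight property turns the sum over
positions into `peelSum`. -/
theorem descendant_boxSet {q : ℝ} (hq0 : 0 < q) (hq1 : q < 1) {p m L : ℕ}
    (hL : L = p + m) {v : SpinChain (2 * L)} (hE : opE q _ v = 0) {δ : YoungDiagram}
    (hδ : InBox L δ) :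
    descendant q _ p v (boxSet L δ) = dwTransform q m (extendChain (-(L : ℤ)) v) δ := by
  have hq' : (q : ℂ) ≠ 0 := by exact_mod_cast hq0.ne'
  set ψ := extendChain (-(L : ℤ)) v with hψ
  have hw : ∀ X ∈ powersetCard m (boxSet L δ),
      (∏ y ∈ boxSet L δ \ X, leftWeight q y X) * v X =
      (fun Z => (∏ y ∈ (Ioc 0 L).map (dwEmb δ) \ Z, (q : ℂ) ^ (L : ℤ) * raiseWeight q Z y) *
        ψ Z) (siteSet (-(L : ℤ)) X) := by
    intro X hX
    have e : (Ioc 0 L).map (dwEmb δ) \ siteSet (-(L : ℤ)) X =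
        (boxSet L δ \ X).map (siteEmb (-(L : ℤ)) (2 * L)) := by
      rw [Finset.map_sdiff, ← siteSet_boxSet hδ]
      rfl
    dsimp only
    rw [hψ, extendChain_siteSet, e, prod_map]
    congr 1
    refine prod_congr rfl fun y _ => ?_
    rw [leftWeight_eq_raiseWeight hq0.ne' (-(L : ℤ)), neg_neg, siteEmb_apply]
  rw [descendant_apply hq0 hq1 hL v (card_boxSet hδ), sum_congr rfl hw,
    sum_powersetCard_siteSet (boxSet L δ) m (fun Z => (∏ y ∈ (Ioc 0 L).map (dwEmb δ) \ Z,
      (q : ℂ) ^ (L : ℤ) * raiseWeight q Z y) * ψ Z),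
    siteSet_boxSet hδ, powersetCard_map, sum_map, dwTransform,
    ← (isHighestWeight_extendChain hq0.ne' hE).sum_eq_peelSum hq0 hδ.1 m 0 (Nat.zero_le _)
      (by simp), mul_sum, mul_sum]
  refine sum_congr rfl fun A hA => ?_
  rw [RelEmbedding.coe_toEmbedding, mapEmbedding_apply, union_empty, ← mul_assoc, ← mul_assoc,
    ← Finset.map_sdiff, prod_map]
  congr 1
  have h1 : ∀ b ∈ Ioc 0 L \ A, (q : ℂ) ^ (L : ℤ) *
      raiseWeight q (A.map (dwEmb δ)) (dwEmb δ b) =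
      (q : ℂ) ^ (dwPos δ b + (L : ℕ) - 2 * (#{a ∈ A | b < a} : ℤ)) := by
    intro b _
    rw [raiseWeight, dwEmb_apply, card_filter_dwEmb_lt, ← zpow_add₀ hq']
    congr 1
    ring
  have h2 : ∏ a ∈ A, dwWeight q δ a = (q : ℂ) ^ (-∑ a ∈ A, ((part δ a + a : ℕ) : ℤ)) := by
    rw [← sum_neg_distrib, ← prod_zpow_eq_zpow_sum hq']
    refine prod_congr rfl fun a _ => ?_
    rw [dwWeight, zpow_neg, zpow_natCast]
  have hexp := exponent_eq (hL ▸ hδ.1) (hL ▸ hA)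
  rw [← hL] at hexp
  rw [prod_congr rfl h1, prod_zpow_eq_zpow_sum hq', h2, ← zpow_natCast, ← zpow_neg,
    ← zpow_add₀ hq', hexp, ← zpow_natCast, ← zpow_add₀ hq']
  congr 1

/-! ### The transform is linear and bounded -/

theorem raiseHalf_sub {q : ℝ} (hq0 : 0 < q) (hq1 : q < 1) {c : ℤ} {φ ψ : Finset ℤ → ℂ}
    {C : ℝ} {X : Finset ℤ} (hφ : ∀ Y, #Y = #X + 1 → ‖φ Y‖ ≤ C)
    (hψ : ∀ Y, #Y = #X + 1 → ‖ψ Y‖ ≤ C) (hC : 0 ≤ C) :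
    raiseHalf q c (φ - ψ) X = raiseHalf q c φ X - raiseHalf q c ψ X := by
  rw [raiseHalf, raiseHalf, raiseHalf,
    ← (summable_raise hq0 hq1 hφ hC).tsum_sub (summable_raise hq0 hq1 hψ hC)]
  refine tsum_congr fun n => ?_
  split_ifs
  · rw [sub_zero]
  · rw [Pi.sub_apply, mul_sub]

theorem tailSum_sub {q : ℝ} (hq0 : 0 < q) (hq1 : q < 1) {c : ℤ} {φ ψ : Finset ℤ → ℂ}
    {C : ℝ} (hC : 0 ≤ C) (hφ : ∀ Y, ‖φ Y‖ ≤ C) (hψ : ∀ Y, ‖ψ Y‖ ≤ C) (k : ℕ) :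
    tailSum q c (φ - ψ) k = tailSum q c φ k - tailSum q c ψ k := by
  induction k with
  | zero => rfl
  | succ k ih =>
    funext X
    rw [Pi.sub_apply, tailSum, tailSum, tailSum, ih]
    dsimp only
    rw [raiseHalf_sub hq0 hq1
      (fun Y hY => hY ▸ norm_tailSum_le hq0 hq1 hC hφ k Y)
      (fun Y hY => hY ▸ norm_tailSum_le hq0 hq1 hC hψ k Y)
      (mul_nonneg (tailBound_nonneg hq0 hq1 _ _ _) hC), mul_sub]

theorem peelSum_sub (w : ℕ → ℂ) (x : ℕ → ℤ) (r : ℕ) (S S' : ℕ → Finset ℤ → ℂ) (k s : ℕ)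
    (X : Finset ℤ) :
    peelSum w x r (fun k => S k - S' k) k s X = peelSum w x r S k s X - peelSum w x r S' k s X := by
  induction k generalizing s X with
  | zero => rfl
  | succ k ih =>
    simp only [peelSum, ih, mul_sub, sum_sub_distrib, Pi.sub_apply]
    ring

theorem dwTransform_sub {q : ℝ} (hq0 : 0 < q) (hq1 : q < 1) {m : ℕ} {φ ψ : Finset ℤ → ℂ}
    {C : ℝ} (hφ : ∀ Y, ‖φ Y‖ ≤ C) (hψ : ∀ Y, ‖ψ Y‖ ≤ C) (δ : YoungDiagram) :
    dwTransform q m (φ - ψ) δ = dwTransform q m φ δ - dwTransform q m ψ δ := by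
  have hC : 0 ≤ C := (norm_nonneg _).trans (hφ ∅)
  have h : tailSum q (-(δ.colLen 0 : ℤ)) (φ - ψ) = fun k =>
      tailSum q (-(δ.colLen 0 : ℤ)) φ k - tailSum q (-(δ.colLen 0 : ℤ)) ψ k :=
    funext fun k => tailSum_sub hq0 hq1 hC hφ hψ k
  rw [dwTransform, h, peelSum_sub, mul_sub]
  rfl

/-- For a fixed diagram there are finitely many explicit placements, each followed by absolutely
convergent sums. The resulting continuity in the supremum norm, with `D` independent of `ψ`, allows
limits in single components. -/
theorem exists_norm_peelSum_le {q : ℝ} (hq0 : 0 < q) (hq1 : q < 1) (w : ℕ → ℂ) (x : ℕ → ℤ)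
    (r : ℕ) (c : ℤ) (k s : ℕ) (X : Finset ℤ) :
    ∃ D : ℝ, ∀ (ψ : Finset ℤ → ℂ) (C : ℝ), (∀ Y, ‖ψ Y‖ ≤ C) →
      ‖peelSum w x r (tailSum q c ψ) k s X‖ ≤ D * C := by
  induction k generalizing s X with
  | zero =>
    refine ⟨1, fun ψ C hψ => ?_⟩
    rw [peelSum, one_mul]
    exact hψ X
  | succ k ih =>
    choose D hD using ih
    refine ⟨∑ l ∈ Ioc s r, ‖w l‖ * D l (insert (x l) X) + tailBound q c (k + 1) #X,
      fun ψ C hψ => ?_⟩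
    rw [peelSum, add_mul, sum_mul]
    refine (norm_add_le _ _).trans (add_le_add ((norm_sum_le _ _).trans (sum_le_sum fun l _ => ?_))
      (norm_tailSum_le hq0 hq1 ((norm_nonneg _).trans (hψ ∅)) hψ _ _))
    rw [norm_mul, mul_assoc]
    exact mul_le_mul_of_nonneg_left (hD _ _ ψ C hψ) (norm_nonneg _)

theorem exists_norm_dwTransform_le {q : ℝ} (hq0 : 0 < q) (hq1 : q < 1) (m : ℕ)
    (δ : YoungDiagram) :
    ∃ D : ℝ, ∀ (ψ : Finset ℤ → ℂ) (C : ℝ), (∀ Y, ‖ψ Y‖ ≤ C) →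
      ‖dwTransform q m ψ δ‖ ≤ D * C := by
  obtain ⟨D, hD⟩ := exists_norm_peelSum_le hq0 hq1 (dwWeight q δ) (dwPos δ) (δ.colLen 0)
    (-(δ.colLen 0 : ℤ)) m 0 ∅
  refine ⟨‖(q : ℂ) ^ ((m + 1).choose 2 + δ.card)‖ * D, fun ψ C hψ => ?_⟩
  rw [dwTransform, norm_mul, mul_assoc]
  exact mul_le_mul_of_nonneg_left (hD ψ C hψ) (norm_nonneg _)

/-! ### Projection to the highest weight vectors -/

/-- By the commutation relation `‖F w‖² = q⁻² ‖E w‖² + (1 - q^{2(N-2k)}) / (1 - q²) ‖w‖²`, and below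
half filling `N - 2k ≥ 1` makes the last coefficient at least one. -/
theorem norm_sq_opF {q : ℝ} (hq0 : 0 < q) (hq1 : q < 1) {N k : ℕ} (hk : 2 * k < N)
    {w : SpinChain N} (hw : InSector k w) : ‖w‖ ^ 2 ≤ ‖opF q N w‖ ^ 2 := by
  have h1 : inner ℂ (opF q N w) (opF q N w) =
      (q : ℂ)⁻¹ ^ 2 * inner ℂ (opE q N w) (opE q N w) +
        (1 - (q : ℂ) ^ 2)⁻¹ * ((1 - ((q ^ (2 * ((N : ℝ) - 2 * k)) : ℝ) : ℂ)) * inner ℂ w w) := by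
    rw [inner_opF, opE_opF hq0 hq1, opK_of_inSector hq0 hw, sub_smul_self, inner_add_right,
      inner_smul_right, inner_smul_right, inner_smul_right, ← inner_conj_symm w (opF q N _),
      inner_opF, inner_conj_symm]
  have h3 : q ^ (2 * ((N : ℝ) - 2 * k)) ≤ q ^ 2 := by
    rw [← Real.rpow_natCast q 2]
    refine Real.rpow_le_rpow_of_exponent_ge hq0 hq1.le ?_
    have : (2 * k + 1 : ℝ) ≤ N := by exact_mod_cast hk
    push_cast
    linarith
  rw [inner_self_eq_norm_sq_to_K, inner_self_eq_norm_sq_to_K, inner_self_eq_norm_sq_to_K] at h1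
  generalize q ^ (2 * ((N : ℝ) - 2 * k)) = t at h1 h3
  have h2 : ‖opF q N w‖ ^ 2 = q⁻¹ ^ 2 * ‖opE q N w‖ ^ 2 +
      (1 - q ^ 2)⁻¹ * ((1 - t) * ‖w‖ ^ 2) := by
    apply Complex.ofReal_injective
    push_cast
    exact h1
  have h4 : 0 < 1 - q ^ 2 := by nlinarith
  have h5 : ‖w‖ ^ 2 = (1 - q ^ 2)⁻¹ * ((1 - q ^ 2) * ‖w‖ ^ 2) := by
    field_simp
  rw [h2]
  have h6 : 0 ≤ q⁻¹ ^ 2 * ‖opE q N w‖ ^ 2 := by positivity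
  have h7 : (1 - q ^ 2)⁻¹ * ((1 - q ^ 2) * ‖w‖ ^ 2) ≤
      (1 - q ^ 2)⁻¹ * ((1 - t) * ‖w‖ ^ 2) := by
    gcongr
  linarith

/-- The vectors with `k` down spins. -/
def sector (N k : ℕ) : Submodule ℂ (SpinChain N) where
  carrier := {v | InSector k v}
  add_mem' {v w} hv hw X hX := by rw [PiLp.add_apply, hv X hX, hw X hX, add_zero]
  zero_mem' _ _ := rfl
  smul_mem' c v hv X hX := by rw [PiLp.smul_apply, hv X hX, smul_zero]

/-- `E F` maps the finite-dimensional sector to itself, and it is injective because `(w, E F w) = ‖F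
w‖² ≥ ‖w‖²`. -/
theorem exists_opE_opF_eq {q : ℝ} (hq0 : 0 < q) (hq1 : q < 1) {N k : ℕ} (hk : 2 * k < N)
    {u : SpinChain N} (hu : InSector k u) :
    ∃ w, InSector k w ∧ opE q N (opF q N w) = u := by
  have hmap : ∀ w ∈ sector N k, (opE q N * opF q N) w ∈ sector N k := fun w hw =>
    InSector.opE (InSector.opF hw)
  have hinj : Function.Injective ((opE q N * opF q N).restrict hmap) := by
    rw [← LinearMap.ker_eq_bot, LinearMap.ker_eq_bot']
    rintro ⟨w, hw⟩ h
    have h' : opE q N (opF q N w) = 0 := congrArg Subtype.val h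
    have h1 : ‖opF q N w‖ ^ 2 = 0 := by
      have h2 : inner ℂ (opF q N w) (opF q N w) = 0 := by rw [inner_opF, h', inner_zero_right]
      rw [inner_self_eq_zero] at h2
      simp [h2]
    have h2 := norm_sq_opF hq0 hq1 hk hw
    have h3 : w = 0 := by
      rw [h1] at h2
      exact norm_eq_zero.1 (by nlinarith [norm_nonneg w])
    exact Subtype.ext h3
  obtain ⟨⟨w, hw⟩, h⟩ := (LinearMap.injective_iff_surjective.1 hinj) ⟨u, hu⟩
  exact ⟨w, hw, congrArg Subtype.val h⟩

/-- Subtract `F w`, where `E F w = E u`. Then `‖F w‖² = (w, E u) ≤ ‖w‖ ‖E u‖ ≤ ‖F w‖ ‖E u‖`, so the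
correction is no larger than the defect, with a constant independent of the length. -/
theorem exists_highestWeight_near {q : ℝ} (hq0 : 0 < q) (hq1 : q < 1) {N m : ℕ}
    (hm : 2 * m ≤ N) {u : SpinChain N} (hu : InSector m u) :
    ∃ v, InSector m v ∧ opE q N v = 0 ∧ ‖u - v‖ ≤ ‖opE q N u‖ := by
  rcases m with _ | k
  · refine ⟨u, hu, ?_, by simp⟩
    ext X
    rw [opE_apply]
    refine sum_eq_zero fun y _ => ?_
    rw [hu (insert y X) (card_pos.2 (insert_nonempty _ _)).ne', mul_zero, ite_self]
  · obtain ⟨w, hw, h⟩ := exists_opE_opF_eq (u := opE q N u) hq0 hq1 (by omega) hu.opE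
    refine ⟨u - opF q N w, (sector N (k + 1)).sub_mem hu hw.opF, by rw [map_sub, h, sub_self], ?_⟩
    rw [sub_sub_cancel]
    have h1 := norm_sq_opF hq0 hq1 (by omega) hw
    have h2 : ‖w‖ ≤ ‖opF q N w‖ := le_of_sq_le_sq h1 (norm_nonneg _)
    have h3 : ‖opF q N w‖ * ‖opF q N w‖ ≤ ‖w‖ * ‖opE q N u‖ := by
      have h4 : ‖inner ℂ (opF q N w) (opF q N w)‖ = ‖opF q N w‖ * ‖opF q N w‖ := by
        rw [inner_self_eq_norm_sq_to_K]
        simp [sq]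
      rw [← h4, inner_opF, h]
      exact norm_inner_le_norm _ _
    by_cases h5 : ‖opF q N w‖ = 0
    · rw [h5]
      exact norm_nonneg _
    · have h6 : 0 < ‖opF q N w‖ := lt_of_le_of_ne (norm_nonneg _) (Ne.symm h5)
      refine le_of_mul_le_mul_left (h3.trans ?_) h6
      gcongr

theorem norm_raise_site_le {q : ℝ} (hq0 : 0 < q) (hq1 : q < 1) {N m : ℕ} {u : SpinChain N}
    (hu : InSector m u) (y : Fin N) :
    ‖(WithLp.toLp 2 fun X => if y ∈ X then 0 else leftWeight q y X * u (insert y X) :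
      SpinChain N)‖ ≤ q ^ ((y : ℤ) - 2 * m) * ‖u‖ := by
  have hpos : 0 ≤ q ^ ((y : ℤ) - 2 * m) := by positivity
  refine le_of_sq_le_sq ?_ (by positivity)
  rw [mul_pow, EuclideanSpace.norm_sq_eq, EuclideanSpace.norm_sq_eq, mul_sum]
  calc _ = ∑ X with y ∉ X, ‖leftWeight q y X * u (insert y X)‖ ^ 2 := by
        rw [sum_filter]
        refine sum_congr rfl fun X _ => ?_
        by_cases h : y ∈ X <;> simp [h]
    _ ≤ ∑ X with y ∉ X, (q ^ ((y : ℤ) - 2 * m)) ^ 2 * ‖u (insert y X)‖ ^ 2 := by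
        refine sum_le_sum fun X _ => ?_
        by_cases hX : #(insert y X) = m
        · rw [norm_mul, mul_pow]
          gcongr
          rw [leftWeight_eq hq0.ne', norm_zpow, Complex.norm_real, Real.norm_of_nonneg hq0.le]
          refine zpow_le_zpow_right_of_le_one₀ hq0 hq1.le ?_
          have h2 : #{x ∈ X | x < y} ≤ m :=
            (card_filter_le _ _).trans (hX ▸ card_le_card (subset_insert _ _))
          omega
        · rw [hu _ hX]
          simp
    _ = ∑ X ∈ (univ.filter fun X : Finset (Fin N) => y ∉ X).image (insert y),
          (q ^ ((y : ℤ) - 2 * m)) ^ 2 * ‖u X‖ ^ 2 := by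
        rw [sum_image]
        intro X hX X' hX' h
        simp only [coe_filter, mem_univ, true_and] at hX hX'
        have := congrArg (fun Y : Finset (Fin N) => Y.erase y) h
        simpa only [erase_insert (show y ∉ X from hX), erase_insert (show y ∉ X' from hX')]
          using this
    _ ≤ _ := sum_le_sum_of_subset_of_nonneg (subset_univ _) fun _ _ _ => by positivity

/-- Removing a spin at `y` carries a weight of at most `q^{y - 2m}`. If the first `M` sites are
always empty, only `y ≥ M` contributes, and the geometric tail is of order `q^M`. -/
theorem norm_opE_le {q : ℝ} (hq0 : 0 < q) (hq1 : q < 1) {N m M : ℕ} {u : SpinChain N}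
    (hu : InSector m u) (hM : ∀ X : Finset (Fin N), ∀ y ∈ X, (y : ℕ) < M → u X = 0) :
    ‖opE q N u‖ ≤ q ^ M * (q ^ (-2 * (m : ℤ)) * (1 - q)⁻¹ * ‖u‖) := by
  have h1 : opE q N u = ∑ y : Fin N,
      (WithLp.toLp 2 fun X => if y ∈ X then 0 else leftWeight q y X * u (insert y X) :
        SpinChain N) := by
    ext X
    rw [WithLp.ofLp_sum, Finset.sum_apply]
    rfl
  have h2 : ∀ y : Fin N,
      ‖(WithLp.toLp 2 fun X => if y ∈ X then 0 else leftWeight q y X * u (insert y X) :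
        SpinChain N)‖ ≤ if M ≤ (y : ℕ) then q ^ ((y : ℤ) - 2 * m) * ‖u‖ else 0 := by
    intro y
    split_ifs with hy
    · exact norm_raise_site_le hq0 hq1 hu y
    · rw [norm_le_zero_iff]
      ext X
      dsimp only
      rw [hM (insert y X) y (mem_insert_self _ _) (by omega), mul_zero, ite_self]
      rfl
  rw [h1]
  refine (norm_sum_le_of_le _ fun y _ => h2 y).trans ?_
  rw [Fin.sum_univ_eq_sum_range (fun y : ℕ =>
    if M ≤ y then q ^ ((y : ℤ) - 2 * m) * ‖u‖ else 0) N, ← sum_filter, ← sum_mul]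
  have h3 : ∑ y ∈ range N with M ≤ y, q ^ ((y : ℤ) - 2 * m) ≤
      q ^ M * (q ^ (-2 * (m : ℤ)) * (1 - q)⁻¹) := by
    have h4 : ∑ y ∈ range N with M ≤ y, q ^ ((y : ℤ) - 2 * m) ≤
        ∑ n ∈ range N, q ^ M * q ^ (-2 * (m : ℤ)) * q ^ n := by
      have h5 : ∑ n ∈ range N, q ^ M * q ^ (-2 * (m : ℤ)) * q ^ n =
          ∑ y ∈ (range N).image (fun n => M + n), q ^ ((y : ℤ) - 2 * m) := by
        rw [sum_image (by simp)]
        refine sum_congr rfl fun n _ => ?_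
        rw [← zpow_natCast, ← zpow_natCast, ← zpow_add₀ hq0.ne', ← zpow_add₀ hq0.ne']
        congr 1
        push_cast
        ring
      rw [h5]
      refine sum_le_sum_of_subset_of_nonneg (fun y hy => ?_) fun _ _ _ => by positivity
      simp only [mem_filter, mem_range, mem_image] at hy ⊢
      exact ⟨y - M, by omega, by omega⟩
    refine h4.trans ?_
    rw [← mul_sum, mul_assoc]
    gcongr
    rw [← tsum_geometric_of_lt_one hq0.le hq1]
    exact (summable_geometric_of_lt_one hq0.le hq1).sum_le_tsum _ fun _ _ => by positivity
  calc _ ≤ _ := mul_le_mul_of_nonneg_right h3 (norm_nonneg _)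
    _ = _ := by ring

end XXZ

end

/-! ### The transform as a multiple of an isometry; momenta and decay of bound states. -/

noncomputable section

namespace XXZ

open Finset Filter Topology

/-! ### Embedding of finite chains into the infinite chain -/

theorem memℓp_extendChain (c : ℤ) {N : ℕ} (v : SpinChain N) : Memℓp (extendChain c v) 2 := by
  refine (memℓp_zero (Set.Finite.subset (finite_toSet (Ico c (c + N)).powerset) ?_)).of_exponent_ge
    zero_le
  intro Z hZ
  rw [mem_coe, mem_powerset]
  by_contra h
  exact hZ (if_neg h)

/-- A vector of the chain on `[c, c + N)` as a vector of the infinite chain. -/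
def embedChain (c : ℤ) {N : ℕ} (v : SpinChain N) : lp (fun _ : Finset ℤ => ℂ) 2 :=
  ⟨extendChain c v, memℓp_extendChain c v⟩

theorem embedChain_apply (c : ℤ) {N : ℕ} (v : SpinChain N) (Z : Finset ℤ) :
    embedChain c v Z = extendChain c v Z := rfl

theorem embedChain_sub (c : ℤ) {N : ℕ} (v w : SpinChain N) :
    embedChain c (v - w) = embedChain c v - embedChain c w := by
  ext Z
  rw [lp.coeFn_sub, Pi.sub_apply, embedChain_apply, embedChain_apply, embedChain_apply,
    extendChain, extendChain, extendChain]
  split_ifs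
  · rfl
  · rw [sub_zero]

theorem inner_embedChain (c : ℤ) {N : ℕ} (v w : SpinChain N) :
    inner ℂ (embedChain c v) (embedChain c w) = inner ℂ v w := by
  rw [lp.inner_eq_tsum, PiLp.inner_apply, ← tsum_fintype (L := .unconditional _),
    ← (siteSet_injective c N).tsum_eq]
  · refine tsum_congr fun X => ?_
    rw [embedChain_apply, embedChain_apply, extendChain_siteSet, extendChain_siteSet]
  · intro Z hZ
    by_contra h
    refine hZ ?_
    have : ¬ Z ⊆ Ico c (c + N) := fun h' => h (exists_siteSet_eq h')
    dsimp only
    rw [embedChain_apply, extendChain, if_neg this, inner_zero_left]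

theorem norm_embedChain (c : ℤ) {N : ℕ} (v : SpinChain N) : ‖embedChain c v‖ = ‖v‖ := by
  rw [norm_eq_sqrt_re_inner (𝕜 := ℂ), inner_embedChain, ← norm_eq_sqrt_re_inner]

/-- A vector of the infinite chain with `m` down spins is a limit of highest weight vectors of
finite chains. -/
theorem exists_highestWeight_seq {q : ℝ} (hq0 : 0 < q) (hq1 : q < 1) {m : ℕ}
    (ψ : lp (fun _ : Finset ℤ => ℂ) 2) (hψ : ∀ X, #X ≠ m → ψ X = 0) :
    ∃ v : ∀ M : ℕ, SpinChain (2 * (2 * M)), (∀ M, InSector m (v M)) ∧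
      (∀ M, opE q _ (v M) = 0) ∧
      Tendsto (fun M => embedChain (-((2 * M : ℕ) : ℤ)) (v M)) atTop (𝓝 ψ) := by
  -- The chain is `[-2M, 2M)`, but the truncation keeps only spins in `[-M, 2M)`. The `M` empty
  -- sites on the left make `E u` of order `q^M`; on the right no margin is needed.
  let u : ∀ M : ℕ, SpinChain (2 * (2 * M)) := fun M => WithLp.toLp 2 fun X =>
    if siteSet (-((2 * M : ℕ) : ℤ)) X ⊆ Ico (-(M : ℤ)) (2 * M : ℕ) then
      ψ (siteSet (-((2 * M : ℕ) : ℤ)) X) else 0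
  have hu : ∀ M X, u M X = if siteSet (-((2 * M : ℕ) : ℤ)) X ⊆ Ico (-(M : ℤ)) (2 * M : ℕ) then
      ψ (siteSet (-((2 * M : ℕ) : ℤ)) X) else 0 := fun _ _ => rfl
  have hus : ∀ M, InSector m (u M) := by
    intro M X hX
    rw [hu]
    split_ifs
    · exact hψ _ (by rwa [card_siteSet])
    · rfl
  -- The vector zero serves for the finitely many `M` with more than half of the spins down.
  have hv : ∀ M, ∃ v, InSector m v ∧ opE q _ v = 0 ∧
      (2 * m ≤ 2 * (2 * M) → ‖u M - v‖ ≤ ‖opE q _ (u M)‖) := by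
    intro M
    by_cases hM : 2 * m ≤ 2 * (2 * M)
    · obtain ⟨v, h1, h2, h3⟩ := exists_highestWeight_near hq0 hq1 hM (hus M)
      exact ⟨v, h1, h2, fun _ => h3⟩
    · exact ⟨0, fun _ _ => rfl, map_zero _, fun h => absurd h hM⟩
  choose v hv1 hv2 hv3 using hv
  refine ⟨v, hv1, hv2, ?_⟩
  have hU : Tendsto (fun M : ℕ => embedChain (-((2 * M : ℕ) : ℤ)) (u M)) atTop (𝓝 ψ) := by
    have hI : Tendsto (fun M : ℕ => (Ico (-(M : ℤ)) (2 * M : ℕ)).powerset) atTop atTop := by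
      refine tendsto_finset_powerset_atTop_atTop.comp
        (tendsto_atTop_finset_of_monotone (fun a b hab => ?_) fun x => ⟨x.natAbs + 1, ?_⟩)
      · exact Ico_subset_Ico (by omega) (by omega)
      · rw [mem_Ico]
        omega
    refine ((lp.hasSum_single (by simp) ψ).comp hI).congr fun M => ?_
    ext Z
    rw [Function.comp_apply, lp.coeFn_sum, Finset.sum_apply]
    simp only [lp.single_apply, Pi.single_apply, sum_ite_eq, mem_powerset]
    rw [embedChain_apply]
    by_cases hZ : Z ⊆ Ico (-(M : ℤ)) (2 * M : ℕ)
    · have hZ' : Z ⊆ Ico (-((2 * M : ℕ) : ℤ)) (-((2 * M : ℕ) : ℤ) + (2 * (2 * M) : ℕ)) :=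
        hZ.trans (Ico_subset_Ico (by omega) (by omega))
      obtain ⟨X, rfl⟩ := exists_siteSet_eq hZ'
      rw [extendChain_siteSet, hu]
    · rw [if_neg hZ]
      symm
      by_cases hZ' : Z ⊆ Ico (-((2 * M : ℕ) : ℤ)) (-((2 * M : ℕ) : ℤ) + (2 * (2 * M) : ℕ))
      · obtain ⟨X, rfl⟩ := exists_siteSet_eq hZ'
        rw [extendChain_siteSet, hu, if_neg hZ]
      · rw [extendChain, if_neg hZ']
  have hdiff : Tendsto (fun M : ℕ => embedChain (-((2 * M : ℕ) : ℤ)) (u M) -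
      embedChain (-((2 * M : ℕ) : ℤ)) (v M)) atTop (𝓝 0) := by
    have hb : Tendsto (fun M : ℕ => q ^ M * (q ^ (-2 * (m : ℤ)) * (1 - q)⁻¹ *
        ‖embedChain (-((2 * M : ℕ) : ℤ)) (u M)‖)) atTop
        (𝓝 (0 * (q ^ (-2 * (m : ℤ)) * (1 - q)⁻¹ * ‖ψ‖))) :=
      (tendsto_pow_atTop_nhds_zero_of_lt_one hq0.le hq1).mul (hU.norm.const_mul _)
    rw [zero_mul] at hb
    refine squeeze_zero_norm' ?_ hb
    filter_upwards [eventually_ge_atTop m] with M hM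
    rw [← embedChain_sub, norm_embedChain, norm_embedChain]
    refine (hv3 M (by omega)).trans (norm_opE_le hq0 hq1 (hus M) fun X y hy hyM => ?_)
    rw [hu, if_neg]
    intro h
    have := mem_Ico.1 (h (mem_siteSet.2 hy))
    omega
  simpa using hU.sub hdiff

/-! ### The transform is an isometry up to a constant -/

theorem norm_sq_descendant {q : ℝ} (hq0 : 0 < q) (hq1 : q < 1) {m p L : ℕ} (hL : L = p + m)
    {v : SpinChain (2 * L)} (hv : InSector m v) (hE : opE q _ v = 0) :
    ‖descendant q _ p v‖ ^ 2 = ‖v‖ ^ 2 * qBinom (q ^ 2) (2 * p) p := by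
  subst hL
  have h := inner_descendant_half hq0 hq1 hv hE hv hE
  rw [inner_self_eq_norm_sq_to_K, inner_self_eq_norm_sq_to_K] at h
  apply Complex.ofReal_injective
  push_cast
  exact h

theorem tendsto_dwTransform {q : ℝ} (hq0 : 0 < q) (hq1 : q < 1) (m : ℕ)
    {φ : ℕ → lp (fun _ : Finset ℤ => ℂ) 2} {ψ : lp (fun _ : Finset ℤ => ℂ) 2}
    (h : Tendsto φ atTop (𝓝 ψ)) (δ : YoungDiagram) :
    Tendsto (fun M => dwTransform q m (φ M) δ) atTop (𝓝 (dwTransform q m ψ δ)) := by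
  obtain ⟨D, hD⟩ := exists_norm_dwTransform_le hq0 hq1 m δ
  rw [tendsto_iff_norm_sub_tendsto_zero] at h ⊢
  have h' := h.const_mul D
  rw [mul_zero] at h'
  refine squeeze_zero (fun _ => norm_nonneg _) (fun M => ?_) h'
  have h0 : (2 : ENNReal) ≠ 0 := by simp
  rw [← dwTransform_sub hq0 hq1 (C := max ‖φ M‖ ‖ψ‖)
    (fun Y => (lp.norm_apply_le_norm h0 (φ M) Y).trans (le_max_left _ _))
    (fun Y => (lp.norm_apply_le_norm h0 ψ Y).trans (le_max_right _ _)), ← lp.coeFn_sub]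
  exact hD _ _ fun Y => lp.norm_apply_le_norm h0 _ Y

theorem eventually_inBox (δ : YoungDiagram) : ∀ᶠ M : ℕ in atTop, InBox (2 * M) δ := by
  filter_upwards [eventually_ge_atTop (δ.colLen 0), eventually_ge_atTop (δ.rowLen 0)] with M h1 h2
  exact ⟨by omega, by omega⟩

/-- Finitely many diagrams lie in the box of every long chain. There the transforms of the
approximating highest weight vectors are components of descendants, whose norms are known, and the
bound survives the limit. It yields both square summability and continuity of the transform in the
`ℓ²` norm. -/
theorem sum_norm_sq_dwTransform_le {q : ℝ} (hq0 : 0 < q) (hq1 : q < 1) {m : ℕ}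
    (ψ : lp (fun _ : Finset ℤ => ℂ) 2) (hψ : ∀ X, #X ≠ m → ψ X = 0) (S : Finset YoungDiagram) :
    ∑ δ ∈ S, ‖dwTransform q m ψ δ‖ ^ 2 ≤ dwConst q * ‖ψ‖ ^ 2 := by
  classical
  obtain ⟨v, hv1, hv2, hv3⟩ := exists_highestWeight_seq hq0 hq1 ψ hψ
  have h1 : Tendsto (fun M : ℕ => ∑ δ ∈ S,
      ‖dwTransform q m (embedChain (-((2 * M : ℕ) : ℤ)) (v M)) δ‖ ^ 2) atTop
      (𝓝 (∑ δ ∈ S, ‖dwTransform q m ψ δ‖ ^ 2)) :=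
    tendsto_finsetSum _ fun δ _ => ((tendsto_dwTransform hq0 hq1 m hv3 δ).norm).pow 2
  have h2 : Tendsto (fun M : ℕ => qBinom (q ^ 2) (2 * (2 * M - m)) (2 * M - m) *
      ‖embedChain (-((2 * M : ℕ) : ℤ)) (v M)‖ ^ 2) atTop (𝓝 (dwConst q * ‖ψ‖ ^ 2)) := by
    refine Tendsto.mul ((tendsto_qBinom hq0 hq1).comp ?_) (hv3.norm.pow 2)
    exact tendsto_atTop_mono (fun M => by omega) (tendsto_sub_atTop_nat m)
  refine le_of_tendsto_of_tendsto h1 h2 ?_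
  have h3 : ∀ᶠ M : ℕ in atTop, ∀ δ ∈ S, InBox (2 * M) δ :=
    (eventually_all_finset S).2 fun δ _ => eventually_inBox δ
  filter_upwards [h3, eventually_ge_atTop m] with M hM hm
  have hL : 2 * M = (2 * M - m) + m := by omega
  calc ∑ δ ∈ S, ‖dwTransform q m (embedChain (-((2 * M : ℕ) : ℤ)) (v M)) δ‖ ^ 2
      ≤ ∑ δ ∈ boxDiagrams (2 * M), ‖descendant q _ (2 * M - m) (v M) (boxSet (2 * M) δ)‖ ^ 2 := by
        refine le_trans (sum_le_sum fun δ hδ => ?_) (sum_le_sum_of_subset_of_nonneg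
          (fun δ hδ => mem_boxDiagrams.2 (hM δ hδ)) fun _ _ _ => by positivity)
        rw [descendant_boxSet hq0 hq1 hL (hv2 M) (hM δ hδ)]
        rfl
    _ ≤ ‖descendant q _ (2 * M - m) (v M)‖ ^ 2 := by
        rw [sum_boxDiagrams (2 * M) fun D => ‖descendant q _ (2 * M - m) (v M) D‖ ^ 2,
          EuclideanSpace.norm_sq_eq]
        exact sum_le_sum_of_subset_of_nonneg (subset_univ _) fun _ _ _ => by positivity
    _ = _ := by rw [norm_sq_descendant hq0 hq1 hL (hv1 M) (hv2 M), norm_embedChain, mul_comm]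

theorem memℓp_dwTransform {q : ℝ} (hq0 : 0 < q) (hq1 : q < 1) {m : ℕ}
    (ψ : lp (fun _ : Finset ℤ => ℂ) 2) (hψ : ∀ X, #X ≠ m → ψ X = 0) :
    Memℓp (dwTransform q m ψ) 2 := by
  refine memℓp_gen' (C := dwConst q * ‖ψ‖ ^ 2) fun S => ?_
  simpa using sum_norm_sq_dwTransform_le hq0 hq1 ψ hψ S

theorem tendsto_boxDiagrams : Tendsto (fun M : ℕ => boxDiagrams (2 * M)) atTop atTop := by
  refine tendsto_atTop_finset_of_monotone (fun a b hab δ hδ => ?_) fun δ => ?_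
  · rw [mem_boxDiagrams] at hδ ⊢
    exact ⟨hδ.1.trans (by omega), hδ.2.trans (by omega)⟩
  · obtain ⟨M, hM⟩ := (eventually_inBox δ).exists
    exact ⟨M, mem_boxDiagrams.2 hM⟩

/-- The restriction of a function to a finite set, as a square summable function. -/
def restrictFinset {ι : Type*} (S : Finset ι) (g : ι → ℂ) : lp (fun _ : ι => ℂ) 2 := by
  classical
  exact ∑ i ∈ S, lp.single 2 i (g i)

theorem norm_sq_restrictFinset {ι : Type*} (S : Finset ι) (g : ι → ℂ) :
    ‖restrictFinset S g‖ ^ 2 = ∑ i ∈ S, ‖g i‖ ^ 2 := by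
  classical
  have := lp.norm_sum_single (p := 2) (by simp) g S
  simpa [restrictFinset] using this

theorem restrictFinset_sub {ι : Type*} (S : Finset ι) (g h : ι → ℂ) :
    restrictFinset S (g - h) = restrictFinset S g - restrictFinset S h := by
  classical
  simp only [restrictFinset, Pi.sub_apply, lp.single_sub, sum_sub_distrib]

theorem inner_restrictFinset {ι : Type*} (S : Finset ι) (g h : ι → ℂ) :
    inner ℂ (restrictFinset S g) (restrictFinset S h) = ∑ i ∈ S, inner ℂ (g i) (h i) := by
  classical
  simp only [restrictFinset, sum_inner]
  refine sum_congr rfl fun i hi => ?_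
  rw [lp.inner_single_left, lp.coeFn_sum, Finset.sum_apply]
  simp only [lp.single_apply, Pi.single_apply, sum_ite_eq, if_pos hi]

/-- The transform of an approximant is a descendant only inside its box, hence the cut-off. The
error is controlled by the uniform bound applied to `φ M - ψ`, and the boxes exhaust all diagrams.
-/
theorem tendsto_restrict_dwTransform {q : ℝ} (hq0 : 0 < q) (hq1 : q < 1) {m : ℕ}
    (ψ : lp (fun _ : Finset ℤ => ℂ) 2) (hψ : ∀ X, #X ≠ m → ψ X = 0)
    {φ : ℕ → lp (fun _ : Finset ℤ => ℂ) 2} (hφ : ∀ M X, #X ≠ m → φ M X = 0)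
    (h : Tendsto φ atTop (𝓝 ψ)) :
    Tendsto (fun M : ℕ => restrictFinset (boxDiagrams (2 * M)) (dwTransform q m (φ M))) atTop
      (𝓝 ⟨dwTransform q m ψ, memℓp_dwTransform hq0 hq1 ψ hψ⟩) := by
  classical
  have h0 : (2 : ENNReal) ≠ 0 := by simp
  have h1 : Tendsto (fun M : ℕ => restrictFinset (boxDiagrams (2 * M)) (dwTransform q m ψ)) atTop
      (𝓝 ⟨dwTransform q m ψ, memℓp_dwTransform hq0 hq1 ψ hψ⟩) := by
    have := (lp.hasSum_single (E := fun _ : YoungDiagram => ℂ) (p := 2) (by simp)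
      ⟨dwTransform q m ψ, memℓp_dwTransform hq0 hq1 ψ hψ⟩).comp tendsto_boxDiagrams
    refine this.congr fun M => ?_
    rw [restrictFinset]
    rfl
  have h2 : Tendsto (fun M : ℕ => restrictFinset (boxDiagrams (2 * M)) (dwTransform q m (φ M)) -
      restrictFinset (boxDiagrams (2 * M)) (dwTransform q m ψ)) atTop (𝓝 0) := by
    have h3 : Tendsto (fun M => √(dwConst q * ‖φ M - ψ‖ ^ 2)) atTop (𝓝 0) := by
      have := (((tendsto_iff_norm_sub_tendsto_zero.1 h).pow 2).const_mul (dwConst q)).sqrt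
      simpa using this
    refine squeeze_zero_norm (fun M => ?_) h3
    refine Real.le_sqrt_of_sq_le ?_
    rw [← restrictFinset_sub, norm_sq_restrictFinset]
    have h4 : dwTransform q m (φ M) - dwTransform q m ψ = dwTransform q m (φ M - ψ : lp _ _) := by
      funext δ
      rw [lp.coeFn_sub, dwTransform_sub hq0 hq1 (C := max ‖φ M‖ ‖ψ‖)
        (fun Y => (lp.norm_apply_le_norm h0 (φ M) Y).trans (le_max_left _ _))
        (fun Y => (lp.norm_apply_le_norm h0 ψ Y).trans (le_max_right _ _))]
      rfl
    rw [h4]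
    refine sum_norm_sq_dwTransform_le hq0 hq1 _ (fun X hX => ?_) _
    rw [lp.coeFn_sub, Pi.sub_apply, hφ M X hX, hψ X hX, sub_zero]
  simpa using h2.add h1

theorem extendChain_of_inSector {c : ℤ} {N m : ℕ} {v : SpinChain N} (hv : InSector m v)
    (Z : Finset ℤ) (hZ : #Z ≠ m) : extendChain c v Z = 0 := by
  by_cases h : Z ⊆ Ico c (c + N)
  · obtain ⟨X, rfl⟩ := exists_siteSet_eq h
    rw [extendChain_siteSet, hv]
    rwa [card_siteSet] at hZ
  · rw [extendChain, if_neg h]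

theorem InSector.descendant {q : ℝ} (hq0 : 0 < q) {N m : ℕ} {v : SpinChain N}
    (hv : InSector m v) (p : ℕ) : InSector (m + p) (descendant q N p v) := by
  intro X hX
  rw [XXZ.descendant, opK_of_inSector hq0 (hv.opF_pow p), PiLp.smul_apply, PiLp.smul_apply,
    hv.opF_pow p X hX, smul_zero, smul_zero]

/-- The diagrams in the box enumerate the half filled configurations, which support both
descendants. Different `m` and `m'` give different `p` and `p'`, and both sides vanish. -/
theorem inner_restrict_dwTransform {q : ℝ} (hq0 : 0 < q) (hq1 : q < 1) {m m' p p' L : ℕ}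
    (hL : L = p + m) (hL' : L = p' + m') {v v' : SpinChain (2 * L)} (hv : InSector m v)
    (hE : opE q _ v = 0) (hv' : InSector m' v') (hE' : opE q _ v' = 0) :
    inner ℂ (restrictFinset (boxDiagrams L) (dwTransform q m' (embedChain (-(L : ℤ)) v')))
      (restrictFinset (boxDiagrams L) (dwTransform q m (embedChain (-(L : ℤ)) v))) =
    ((qBinom (q ^ 2) (2 * p) p : ℝ) : ℂ) *
      inner ℂ (embedChain (-(L : ℤ)) v') (embedChain (-(L : ℤ)) v) := by
  have h1 : inner ℂ (restrictFinset (boxDiagrams L) (dwTransform q m' (embedChain (-(L : ℤ)) v')))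
      (restrictFinset (boxDiagrams L) (dwTransform q m (embedChain (-(L : ℤ)) v))) =
      inner ℂ (descendant q _ p' v') (descendant q _ p v) := by
    rw [inner_restrictFinset, PiLp.inner_apply]
    have h2 : ∀ δ ∈ boxDiagrams L, inner ℂ (dwTransform q m' (embedChain (-(L : ℤ)) v') δ)
        (dwTransform q m (embedChain (-(L : ℤ)) v) δ) =
        inner ℂ (descendant q _ p' v' (boxSet L δ)) (descendant q _ p v (boxSet L δ)) := by
      intro δ hδ
      rw [mem_boxDiagrams] at hδ
      rw [descendant_boxSet hq0 hq1 hL hE hδ, descendant_boxSet hq0 hq1 hL' hE' hδ]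
      rfl
    rw [sum_congr rfl h2, sum_boxDiagrams L fun D =>
      inner ℂ (descendant q _ p' v' D) (descendant q _ p v D)]
    refine sum_subset (subset_univ _) fun D _ hD => ?_
    have hD' : #D ≠ m + p := fun h => hD (mem_powersetCard.2 ⟨subset_univ _, by omega⟩)
    rw [hv.descendant hq0 p D hD', inner_zero_right]
  rw [h1, inner_embedChain]
  by_cases hp : p = p'
  · subst hp
    obtain rfl : m = m' := by omega
    subst hL
    rw [inner_descendant_half hq0 hq1 hv hE hv' hE', mul_comm]
  · have hm : m ≠ m' := by omega
    rw [inner_descendant hq0 hq1 hv hE hv' hE', if_neg hp, PiLp.inner_apply, sum_eq_zero, mul_zero]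
    intro X _
    by_cases hX : #X = m
    · rw [hv' X (by omega), inner_zero_left]
    · rw [hv X hX, inner_zero_right]

/-- Approximate both vectors by highest weight vectors of the same chains. Scalar products before
and after the transform converge, the ratio being a central binomial coefficient that tends to the
constant. -/
theorem tsum_dwTransform {q : ℝ} (hq0 : 0 < q) (hq1 : q < 1) {m m' : ℕ}
    (ψ ψ' : lp (fun _ : Finset ℤ => ℂ) 2) (hψ : ∀ X, #X ≠ m → ψ X = 0)
    (hψ' : ∀ X, #X ≠ m' → ψ' X = 0) :
    ∑' δ, (starRingEnd ℂ) (dwTransform q m' ψ' δ) * dwTransform q m ψ δ =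
      (∑' X, (starRingEnd ℂ) (ψ' X) * ψ X) * ((dwConst q : ℝ) : ℂ) := by
  obtain ⟨v, hv1, hv2, hv3⟩ := exists_highestWeight_seq hq0 hq1 ψ hψ
  obtain ⟨v', hv1', hv2', hv3'⟩ := exists_highestWeight_seq hq0 hq1 ψ' hψ'
  have h1 := (tendsto_restrict_dwTransform hq0 hq1 ψ' hψ'
    (fun M => extendChain_of_inSector (hv1' M)) hv3').inner (𝕜 := ℂ)
    (tendsto_restrict_dwTransform hq0 hq1 ψ hψ (fun M => extendChain_of_inSector (hv1 M)) hv3)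
  have h2 : Tendsto (fun M : ℕ => ((qBinom (q ^ 2) (2 * (2 * M - m)) (2 * M - m) : ℝ) : ℂ) *
      inner ℂ (embedChain (-((2 * M : ℕ) : ℤ)) (v' M)) (embedChain (-((2 * M : ℕ) : ℤ)) (v M)))
      atTop (𝓝 (((dwConst q : ℝ) : ℂ) * inner ℂ ψ' ψ)) := by
    refine Tendsto.mul ?_ (hv3'.inner hv3)
    refine (Complex.continuous_ofReal.tendsto _).comp ((tendsto_qBinom hq0 hq1).comp ?_)
    exact tendsto_atTop_mono (fun M => by omega) (tendsto_sub_atTop_nat m)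
  have h3 := tendsto_nhds_unique (h1.congr' ?_) h2
  · rw [lp.inner_eq_tsum, lp.inner_eq_tsum] at h3
    simp only [RCLike.inner_apply'] at h3
    rw [mul_comm (∑' X, _), ← h3]
  · filter_upwards [eventually_ge_atTop m, eventually_ge_atTop m'] with M hm hm'
    exact inner_restrict_dwTransform hq0 hq1 (by omega) (p' := 2 * M - m') (by omega) (hv1 M)
      (hv2 M) (hv1' M) (hv2' M)

/-! ### Bound states -/

/-- The numbers `s_b = sinh(iβ + (n/2 - b)η)`, so that `z_{b+1} = s_b / s_{b+1}`. -/
def stringSinh (q : ℝ) (n : ℕ) (β : ℝ) (b : ℕ) : ℂ :=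
  Complex.sinh (Complex.I * β + ((n : ℂ) / 2 - b) * ((-Real.log q : ℝ) : ℂ))

theorem stringMagnon_eq (q : ℝ) (n : ℕ) (β : ℝ) (j : ℕ) :
    stringMagnon q n β (j + 1) = stringSinh q n β j / stringSinh q n β (j + 1) := by
  rw [stringMagnon, stringSinh, stringSinh]
  congr 4
  push_cast
  ring

theorem stringSinh_eq (q : ℝ) (n : ℕ) (β : ℝ) (b : ℕ) :
    stringSinh q n β b =
      ((Real.cos β * Real.sinh (((n : ℝ) / 2 - b) * -Real.log q) : ℝ) : ℂ) +
        ((Real.sin β * Real.cosh (((n : ℝ) / 2 - b) * -Real.log q) : ℝ) : ℂ) * Complex.I := by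
  have h : ((n : ℂ) / 2 - b) * ((-Real.log q : ℝ) : ℂ) =
      ((((n : ℝ) / 2 - b) * -Real.log q : ℝ) : ℂ) := by push_cast; ring
  rw [stringSinh, h, mul_comm Complex.I, Complex.sinh_add, Complex.sinh_mul_I, Complex.cosh_mul_I]
  push_cast
  ring

/-- The relation `cosh² = 1 + sinh²` separates the dependence on `b` from that on `β`. Hence the
modulus depends on `b` only through `|n/2 - b|` and increases with it, for all `β` alike. The norm
estimates on bound states rest on this. -/
theorem norm_sq_stringSinh (q : ℝ) (n : ℕ) (β : ℝ) (b : ℕ) :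
    ‖stringSinh q n β b‖ ^ 2 =
      Real.sinh (((n : ℝ) / 2 - b) * -Real.log q) ^ 2 + Real.sin β ^ 2 := by
  rw [stringSinh_eq, ← Complex.normSq_eq_norm_sq, Complex.normSq_add_mul_I]
  have h1 := Real.cosh_sq (((n : ℝ) / 2 - b) * -Real.log q)
  have h2 := Real.sin_sq_add_cos_sq β
  rw [mul_pow, mul_pow, h1]
  linear_combination Real.sinh (((n : ℝ) / 2 - b) * -Real.log q) ^ 2 * h2

theorem eta_pos {q : ℝ} (hq0 : 0 < q) (hq1 : q < 1) : 0 < -Real.log q :=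
  neg_pos.2 (Real.log_neg hq0 hq1)

theorem stringSinh_ne_zero {q : ℝ} (hq0 : 0 < q) (hq1 : q < 1) {n : ℕ} {β : ℝ}
    (h : Even n → Real.sin β ≠ 0) (b : ℕ) : stringSinh q n β b ≠ 0 := by
  intro h0
  have h1 := norm_sq_stringSinh q n β b
  rw [h0, norm_zero] at h1
  have h2 : Real.sin β = 0 := by
    have := sq_nonneg (Real.sin β)
    have := sq_nonneg (Real.sinh (((n : ℝ) / 2 - b) * -Real.log q))
    exact pow_eq_zero_iff (n := 2) (by norm_num) |>.1 (by linarith)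
  have h3 : Real.sinh (((n : ℝ) / 2 - b) * -Real.log q) = 0 := by
    have := sq_nonneg (Real.sinh (((n : ℝ) / 2 - b) * -Real.log q))
    have := sq_nonneg (Real.sin β)
    exact pow_eq_zero_iff (n := 2) (by norm_num) |>.1 (by linarith)
  rw [Real.sinh_eq_zero, mul_eq_zero] at h3
  rcases h3 with h3 | h3
  · have h4 : (n : ℝ) = ((b + b : ℕ) : ℝ) := by push_cast; linarith
    exact h ⟨b, by exact_mod_cast h4⟩ h2
  · exact (eta_pos hq0 hq1).ne' h3

theorem stringSinh_zero_ne_zero {q : ℝ} (hq0 : 0 < q) (hq1 : q < 1) {n : ℕ} (hn : 0 < n) (β : ℝ) :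
    stringSinh q n β 0 ≠ 0 := by
  intro h0
  have h1 := norm_sq_stringSinh q n β 0
  have h2 : 0 < Real.sinh (((n : ℝ) / 2 - (0 : ℕ)) * -Real.log q) := by
    rw [Real.sinh_pos_iff]
    have := eta_pos hq0 hq1
    have : (0 : ℝ) < n := by exact_mod_cast hn
    push_cast
    rw [sub_zero]
    positivity
  rw [h0, norm_zero] at h1
  have := sq_nonneg (Real.sin β)
  have : 0 < Real.sinh (((n : ℝ) / 2 - (0 : ℕ)) * -Real.log q) ^ 2 := by positivity
  linarith

theorem sq_sinh_le {q : ℝ} {x y : ℝ} (h : |x| ≤ |y|) :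
    Real.sinh (x * -Real.log q) ^ 2 ≤ Real.sinh (y * -Real.log q) ^ 2 := by
  rw [sq_le_sq, Real.abs_sinh, Real.abs_sinh, Real.sinh_le_sinh, abs_mul, abs_mul]
  exact mul_le_mul_of_nonneg_right h (abs_nonneg _)

theorem norm_stringSinh_le {q : ℝ} {n b b' : ℕ} (β : ℝ)
    (h : |(n : ℝ) / 2 - b| ≤ |(n : ℝ) / 2 - b'|) :
    ‖stringSinh q n β b‖ ≤ ‖stringSinh q n β b'‖ := by
  refine le_of_sq_le_sq ?_ (norm_nonneg _)
  rw [norm_sq_stringSinh, norm_sq_stringSinh]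
  have := sq_sinh_le (q := q) h
  linarith

theorem norm_stringSinh_self (q : ℝ) (n : ℕ) (β : ℝ) :
    ‖stringSinh q n β n‖ = ‖stringSinh q n β 0‖ := by
  have h : |(n : ℝ) / 2 - n| = |(n : ℝ) / 2 - (0 : ℕ)| := by
    rw [← abs_neg]
    congr 1
    push_cast
    ring
  exact le_antisymm (norm_stringSinh_le β h.le) (norm_stringSinh_le β h.ge)

/-- The bound states decay exponentially in the distance of neighbouring magnons. -/
theorem exists_norm_stringSinh_le {q : ℝ} (hq0 : 0 < q) (hq1 : q < 1) (n : ℕ) :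
    ∃ r : ℝ, 0 ≤ r ∧ r < 1 ∧ ∀ (β : ℝ) (b : ℕ), 0 < b → b < n →
      ‖stringSinh q n β b / stringSinh q n β 0‖ ≤ r := by
  set A := Real.sinh (((n : ℝ) / 2) * -Real.log q) ^ 2 with hA
  set B := Real.sinh (((n : ℝ) / 2 - 1) * -Real.log q) ^ 2 with hB
  by_cases hn : n < 2
  · exact ⟨0, le_rfl, one_pos, fun β b h1 h2 => by omega⟩
  have hn2 : (2 : ℝ) ≤ n := by exact_mod_cast not_lt.1 hn
  have hη := eta_pos hq0 hq1
  have hAB : B < A := by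
    rw [hA, hB]
    have h1 : 0 ≤ Real.sinh (((n : ℝ) / 2 - 1) * -Real.log q) := by
      rw [Real.sinh_nonneg_iff]
      exact mul_nonneg (by linarith) hη.le
    refine pow_lt_pow_left₀ ?_ h1 (by norm_num)
    rw [Real.sinh_lt_sinh]
    exact mul_lt_mul_of_pos_right (by linarith) hη
  have hB0 : 0 ≤ B := sq_nonneg _
  -- The squared quotient is at most `(B + x) / (A + x)` with `x = sin² β`. As `B < A`, this
  -- increases in `x`, and `x ≤ 1`.
  refine ⟨√((B + 1) / (A + 1)), Real.sqrt_nonneg _, ?_, fun β b h1 h2 => ?_⟩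
  · rw [Real.sqrt_lt' one_pos, one_pow, div_lt_one (by linarith)]
    linarith
  · have h0 := stringSinh_zero_ne_zero hq0 hq1 (by omega) β (n := n)
    refine Real.le_sqrt_of_sq_le ?_
    rw [norm_div, div_pow, div_le_div_iff₀ (by positivity) (by linarith), norm_sq_stringSinh,
      norm_sq_stringSinh]
    have e1 : Real.sinh (((n : ℝ) / 2 - (0 : ℕ)) * -Real.log q) ^ 2 = A := by simp [hA]
    have e2 : Real.sinh (((n : ℝ) / 2 - b) * -Real.log q) ^ 2 ≤ B := by
      refine sq_sinh_le (q := q) ?_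
      have hb1 : (1 : ℝ) ≤ b := by exact_mod_cast h1
      have hb2 : (b : ℝ) + 1 ≤ n := by exact_mod_cast h2
      rw [abs_of_nonneg (show (0 : ℝ) ≤ n / 2 - 1 by linarith)]
      exact abs_le.2 ⟨by linarith, by linarith⟩
    rw [e1]
    have h3 : Real.sin β ^ 2 ≤ 1 := Real.sin_sq_le_one β
    nlinarith [sq_nonneg (Real.sin β)]

theorem exp_log_factor {q : ℝ} (hq0 : 0 < q) :
    Complex.exp ((-Real.log q : ℝ) : ℂ) = (q : ℂ)⁻¹ := by
  rw [← Complex.ofReal_exp, Real.exp_neg, Real.exp_log hq0, Complex.ofReal_inv]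

theorem stringSinh_recurrence {q : ℝ} (hq0 : 0 < q) (n : ℕ) (β : ℝ) (b : ℕ) :
    stringSinh q n β b + stringSinh q n β (b + 2) =
      2 * anisotropy q * stringSinh q n β (b + 1) := by
  have h1 : Complex.cosh ((-Real.log q : ℝ) : ℂ) = anisotropy q := by
    rw [Complex.cosh, Complex.exp_neg, exp_log_factor hq0, inv_inv, anisotropy, add_comm]
  rw [← h1, stringSinh, stringSinh, stringSinh]
  set x := Complex.I * (β : ℂ) + ((n : ℂ) / 2 - ((b + 1 : ℕ) : ℂ)) * ((-Real.log q : ℝ) : ℂ) with hx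
  have e1 : Complex.I * (β : ℂ) + ((n : ℂ) / 2 - b) * ((-Real.log q : ℝ) : ℂ) =
      x + ((-Real.log q : ℝ) : ℂ) := by
    rw [hx]; push_cast; ring
  have e2 : Complex.I * (β : ℂ) + ((n : ℂ) / 2 - ((b + 2 : ℕ) : ℂ)) * ((-Real.log q : ℝ) : ℂ) =
      x - ((-Real.log q : ℝ) : ℂ) := by
    rw [hx]; push_cast; ring
  rw [e1, e2, Complex.sinh_add, Complex.sinh_sub]
  ring

/-- The amplitude vanishes if the order of neighbouring magnons of a bound state is reversed. -/
theorem pairFactor_stringMagnon {q : ℝ} (hq0 : 0 < q) {n : ℕ} {β : ℝ}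
    (h : ∀ b, stringSinh q n β b ≠ 0) (j : ℕ) :
    pairFactor q (stringMagnon q n β (j + 2)) (stringMagnon q n β (j + 1)) = 0 := by
  rw [stringMagnon_eq, stringMagnon_eq, pairFactor]
  have h0 := h j
  have h1 := h (j + 1)
  have h2 := h (j + 2)
  have hr := stringSinh_recurrence hq0 n β j
  rw [show j + 1 + 1 = j + 2 from rfl]
  field_simp
  linear_combination hr

/-- In the variable `u = e^{2iβ}` the momenta are fractional linear. -/
theorem stringSinh_exp {q : ℝ} (hq0 : 0 < q) (n : ℕ) (β : ℝ) (b : ℕ) :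
    2 * stringSinh q n β b = Complex.exp (-(Complex.I * β)) *
      ((q ^ (-((n : ℝ) / 2 - b)) : ℝ) : ℂ) *
        (Complex.exp (2 * (Complex.I * β)) - ((q ^ (n - 2 * b : ℝ) : ℝ) : ℂ)) := by
  have h1 : Complex.exp (((n : ℂ) / 2 - b) * ((-Real.log q : ℝ) : ℂ)) =
      ((q ^ (-((n : ℝ) / 2 - b)) : ℝ) : ℂ) := by
    rw [Real.rpow_def_of_pos hq0, Complex.ofReal_exp]
    congr 1
    push_cast
    ring
  have h2 : Complex.exp (-(((n : ℂ) / 2 - b) * ((-Real.log q : ℝ) : ℂ))) =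
      ((q ^ (-((n : ℝ) / 2 - b)) : ℝ) : ℂ) * ((q ^ (n - 2 * b : ℝ) : ℝ) : ℂ) := by
    rw [← Complex.ofReal_mul, ← Real.rpow_add hq0, Real.rpow_def_of_pos hq0, Complex.ofReal_exp]
    congr 1
    push_cast
    ring
  rw [stringSinh, Complex.sinh, mul_div_cancel₀ _ two_ne_zero, Complex.exp_add, neg_add,
    Complex.exp_add, h1, h2, mul_sub]
  have h3 : Complex.exp (-(Complex.I * β)) * Complex.exp (2 * (Complex.I * β)) =
      Complex.exp (Complex.I * β) := by
    rw [← Complex.exp_add]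
    congr 1
    ring
  linear_combination (-((q ^ (-((n : ℝ) / 2 - b)) : ℝ) : ℂ)) * h3

theorem q_mul_stringMagnon {q : ℝ} (hq0 : 0 < q) (n : ℕ) (β : ℝ) (j : ℕ) :
    (q : ℂ) * stringMagnon q n β (j + 1) =
      (Complex.exp (2 * (Complex.I * β)) - ((q ^ (n - 2 * j : ℝ) : ℝ) : ℂ)) /
        (Complex.exp (2 * (Complex.I * β)) - ((q ^ (n - 2 * (j + 1 : ℕ) : ℝ) : ℝ) : ℂ)) := by
  have hq' : (q : ℂ) ≠ 0 := by exact_mod_cast hq0.ne'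
  have h1 := stringSinh_exp hq0 n β j
  have h2 := stringSinh_exp hq0 n β (j + 1)
  have h3 : q ^ (-((n : ℝ) / 2 - (j + 1 : ℕ))) = q ^ (-((n : ℝ) / 2 - j)) * q := by
    rw [← Real.rpow_add_one hq0.ne']
    congr 1
    push_cast
    ring
  have h4 : ((q ^ (-((n : ℝ) / 2 - j)) : ℝ) : ℂ) ≠ 0 := by
    exact_mod_cast (Real.rpow_pos_of_pos hq0 _).ne'
  have h5 : Complex.exp (-(Complex.I * β)) ≠ 0 := Complex.exp_ne_zero _
  rw [h3] at h2
  rw [stringMagnon_eq, ← mul_div_mul_left _ _ (two_ne_zero (α := ℂ)), h1, h2]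
  push_cast
  rw [← mul_div_assoc, mul_comm (q : ℂ), mul_right_comm, mul_assoc _ _ (q : ℂ)]
  rw [show Complex.exp (-(Complex.I * β)) * (((q ^ (-((n : ℝ) / 2 - j)) : ℝ) : ℂ) * (q : ℂ)) =
    Complex.exp (-(Complex.I * β)) * ((q ^ (-((n : ℝ) / 2 - j)) : ℝ) : ℂ) * q by ring]
  rw [mul_div_mul_left]
  exact mul_ne_zero (mul_ne_zero h5 h4) hq'

theorem one_sub_q_mul_stringMagnon {q : ℝ} (hq0 : 0 < q) (hq1 : q < 1) {n : ℕ} {β : ℝ}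
    (h : ∀ b, stringSinh q n β b ≠ 0) (j : ℕ) :
    1 - (q : ℂ) * stringMagnon q n β (j + 1) ≠ 0 := by
  have h2 : Complex.exp (2 * (Complex.I * β)) - ((q ^ (n - 2 * (j + 1 : ℕ) : ℝ) : ℝ) : ℂ) ≠ 0 := by
    intro h0
    have h1 := stringSinh_exp hq0 n β (j + 1)
    rw [h0, mul_zero] at h1
    exact h (j + 1) (by simpa using h1)
  rw [q_mul_stringMagnon hq0, one_sub_div h2]
  refine div_ne_zero ?_ h2
  rw [sub_sub_sub_cancel_left, sub_ne_zero]
  refine fun h3 => absurd (Complex.ofReal_injective h3) ?_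
  refine (Real.rpow_lt_rpow_of_exponent_gt hq0 hq1 ?_).ne
  push_cast
  linarith

/-- The product of powers of the momenta of a bound state, written in terms of the position of the
last magnon and the distances of neighbouring magnons. -/
theorem prod_string_zpow {s : ℕ → ℂ} (hs : ∀ b, s b ≠ 0) (y : ℕ → ℤ) (n : ℕ) :
    ∏ j ∈ range (n + 1), (s j / s (j + 1)) ^ y j =
      (s 0 / s (n + 1)) ^ y n * ∏ b ∈ range n, (s (b + 1) / s 0) ^ (y (b + 1) - y b) := by
  induction n with
  | zero => simp
  | succ n ih =>
    rw [prod_range_succ, ih, prod_range_succ _ n]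
    have h0 := hs 0
    have h1 := hs (n + 1)
    have h2 := hs (n + 2)
    have e : (s 0 / s (n + 1)) ^ y n * (s (n + 1) / s (n + 1 + 1)) ^ y (n + 1) =
        (s 0 / s (n + 1 + 1)) ^ y (n + 1) * (s (n + 1) / s 0) ^ (y (n + 1) - y n) := by
      rw [zpow_sub₀ (div_ne_zero h1 h0)]
      simp only [div_zpow]
      have := zpow_ne_zero (y n) h0
      have := zpow_ne_zero (y n) h1
      have := zpow_ne_zero (y (n + 1)) h0
      have := zpow_ne_zero (y (n + 1)) h2
      field_simp
    linear_combination (∏ b ∈ range n, (s (b + 1) / s 0) ^ (y (b + 1) - y b)) * e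

theorem continuous_stringSinh (q : ℝ) (n b : ℕ) : Continuous fun β => stringSinh q n β b := by
  unfold stringSinh
  fun_prop

/-! ### Systems of bound states -/

/-- The rapidities for which all momenta are finite. -/
def rapidityDomain {k : ℕ} (n : Fin k → ℕ) : Set (Fin k → ℝ) :=
  {β | ∀ i, Even (n i) → Real.sin (β i) ≠ 0}

theorem isOpen_rapidityDomain {k : ℕ} (n : Fin k → ℕ) : IsOpen (rapidityDomain n) := by
  have : rapidityDomain n = ⋂ i, {β | Even (n i) → Real.sin (β i) ≠ 0} := by
    ext β
    simp [rapidityDomain]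
  rw [this]
  refine isOpen_iInter_of_finite fun i => ?_
  by_cases h : Even (n i)
  · simp only [h, true_imp_iff]
    exact isOpen_ne_fun (by fun_prop) continuous_const
  · simp [h]

theorem stringPoint_apply (q : ℝ) {k : ℕ} (n : Fin k → ℕ) (β : Fin k → ℝ) (i : Fin k)
    (j : Fin (n i)) :
    stringPoint q n β (finSigmaFinEquiv ⟨i, j⟩) =
      stringSinh q (n i) (β i) j / stringSinh q (n i) (β i) (j + 1) := by
  have h : ∀ t : (i : Fin k) × Fin (n i), t = ⟨i, j⟩ →
      stringMagnon q (n t.1) (β t.1) (t.2 + 1) =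
        stringSinh q (n i) (β i) j / stringSinh q (n i) (β i) (j + 1) := by
    rintro t rfl
    exact stringMagnon_eq _ _ _ _
  exact h _ (Equiv.symm_apply_apply _ _)

theorem stringPoint_eq (q : ℝ) {k : ℕ} (n : Fin k → ℕ) (β : Fin k → ℝ) (a : Fin (∑ i, n i)) :
    stringPoint q n β a = stringSinh q (n (finSigmaFinEquiv.symm a).1)
        (β (finSigmaFinEquiv.symm a).1) (finSigmaFinEquiv.symm a).2 /
      stringSinh q (n (finSigmaFinEquiv.symm a).1) (β (finSigmaFinEquiv.symm a).1)
        ((finSigmaFinEquiv.symm a).2 + 1) :=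
  stringMagnon_eq _ _ _ _

theorem stringSinh_ne_zero_of_mem {q : ℝ} (hq0 : 0 < q) (hq1 : q < 1) {k : ℕ} {n : Fin k → ℕ}
    {β : Fin k → ℝ} (hβ : β ∈ rapidityDomain n) (i : Fin k) (b : ℕ) :
    stringSinh q (n i) (β i) b ≠ 0 :=
  stringSinh_ne_zero hq0 hq1 (hβ i) b

theorem stringPoint_ne_zero {q : ℝ} (hq0 : 0 < q) (hq1 : q < 1) {k : ℕ} {n : Fin k → ℕ}
    {β : Fin k → ℝ} (hβ : β ∈ rapidityDomain n) (a : Fin (∑ i, n i)) :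
    stringPoint q n β a ≠ 0 := by
  rw [stringPoint_eq]
  exact div_ne_zero (stringSinh_ne_zero_of_mem hq0 hq1 hβ _ _)
    (stringSinh_ne_zero_of_mem hq0 hq1 hβ _ _)

theorem continuousOn_stringPoint {q : ℝ} (hq0 : 0 < q) (hq1 : q < 1) {k : ℕ} (n : Fin k → ℕ)
    (a : Fin (∑ i, n i)) :
    ContinuousOn (fun β => stringPoint q n β a) (rapidityDomain n) := by
  simp only [stringPoint_eq]
  refine ContinuousOn.div ?_ ?_ fun β hβ => stringSinh_ne_zero_of_mem hq0 hq1 hβ _ _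
  · exact ((continuous_stringSinh q _ _).comp (continuous_apply _)).continuousOn
  · exact ((continuous_stringSinh q _ _).comp (continuous_apply _)).continuousOn

theorem continuousOn_amplitude {q : ℝ} (hq0 : 0 < q) (hq1 : q < 1) {k : ℕ} (n : Fin k → ℕ)
    (π : Equiv.Perm (Fin (∑ i, n i))) :
    ContinuousOn (fun β => amplitude q fun l => stringPoint q n β (π l)) (rapidityDomain n) := by
  unfold amplitude
  refine continuousOn_finsetProd _ fun i _ => continuousOn_finsetProd _ fun j _ => ?_
  have h1 := continuousOn_stringPoint hq0 hq1 n (π i)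
  have h2 := continuousOn_stringPoint hq0 hq1 n (π j)
  exact (continuousOn_const.sub (continuousOn_const.mul h1)).add (h1.mul h2)

/-- The permutation keeps the order of the magnons in each bound state. -/
def IsStringOrdered {k : ℕ} (n : Fin k → ℕ) (π : Equiv.Perm (Fin (∑ i, n i))) : Prop :=
  ∀ (i : Fin k) (j : ℕ) (h : j + 1 < n i),
    π.symm (finSigmaFinEquiv ⟨i, ⟨j, by omega⟩⟩) < π.symm (finSigmaFinEquiv ⟨i, ⟨j + 1, h⟩⟩)

/-- If some magnon stands before its predecessor in the same bound state, the product over pairs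
contains their reversed pair factor, which vanishes. -/
theorem amplitude_eq_zero {q : ℝ} (hq0 : 0 < q) (hq1 : q < 1) {k : ℕ} {n : Fin k → ℕ}
    {β : Fin k → ℝ} (hβ : β ∈ rapidityDomain n) {π : Equiv.Perm (Fin (∑ i, n i))}
    (hπ : ¬ IsStringOrdered n π) : amplitude q (fun l => stringPoint q n β (π l)) = 0 := by
  simp only [IsStringOrdered, not_forall, not_lt] at hπ
  obtain ⟨i, j, h, hle⟩ := hπ
  have hlt : π.symm (finSigmaFinEquiv ⟨i, ⟨j + 1, h⟩⟩) <
      π.symm (finSigmaFinEquiv ⟨i, ⟨j, by omega⟩⟩) := by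
    refine lt_of_le_of_ne hle fun heq => ?_
    have := finSigmaFinEquiv.injective (π.symm.injective heq)
    simp at this
  refine prod_eq_zero (mem_univ (π.symm (finSigmaFinEquiv ⟨i, ⟨j + 1, h⟩⟩)))
    (prod_eq_zero (mem_Ioi.2 hlt) ?_)
  simp only [Equiv.apply_symm_apply]
  have h1 := pairFactor_stringMagnon hq0 (stringSinh_ne_zero_of_mem hq0 hq1 hβ i) j
  rw [stringMagnon_eq, stringMagnon_eq] at h1
  rw [stringPoint_apply, stringPoint_apply]
  exact h1

/-- The position of the `b`-th magnon of the `i`-th bound state. -/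
def stringPos {k : ℕ} (n : Fin k → ℕ) (π : Equiv.Perm (Fin (∑ i, n i)))
    (x : Fin (∑ i, n i) → ℤ) (i : Fin k) (b : ℕ) : ℤ :=
  if h : b < n i then x (π.symm (finSigmaFinEquiv ⟨i, ⟨b, h⟩⟩)) else 0

theorem IsStringOrdered.stringPos_lt {k : ℕ} {n : Fin k → ℕ} {π : Equiv.Perm (Fin (∑ i, n i))}
    (hπ : IsStringOrdered n π) {x : Fin (∑ i, n i) → ℤ} (hx : StrictMono x) {i : Fin k} {b : ℕ}
    (hb : b + 1 < n i) : stringPos n π x i b < stringPos n π x i (b + 1) := by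
  rw [stringPos, stringPos, dif_pos hb, dif_pos (by omega)]
  exact hx (hπ i b hb)

theorem prod_stringPoint_zpow {q : ℝ} (hq0 : 0 < q) (hq1 : q < 1) {k : ℕ} {n : Fin k → ℕ}
    (hn : ∀ i, 0 < n i) {β : Fin k → ℝ} (hβ : β ∈ rapidityDomain n)
    (π : Equiv.Perm (Fin (∑ i, n i))) (x : Fin (∑ i, n i) → ℤ) :
    ∏ l, stringPoint q n β (π l) ^ x l = ∏ i,
      (stringSinh q (n i) (β i) 0 / stringSinh q (n i) (β i) (n i)) ^ stringPos n π x i (n i - 1) *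
        ∏ b ∈ range (n i - 1), (stringSinh q (n i) (β i) (b + 1) / stringSinh q (n i) (β i) 0) ^
          (stringPos n π x i (b + 1) - stringPos n π x i b) := by
  have h1 : ∏ l, stringPoint q n β (π l) ^ x l =
      ∏ a, stringPoint q n β a ^ x (π.symm a) := by
    rw [← Equiv.prod_comp π fun a => stringPoint q n β a ^ x (π.symm a)]
    simp only [Equiv.symm_apply_apply]
  rw [h1, ← Equiv.prod_comp finSigmaFinEquiv, Fintype.prod_sigma]
  refine prod_congr rfl fun i _ => ?_
  obtain ⟨n', hn'⟩ : ∃ n', n i = n' + 1 := ⟨n i - 1, by have := hn i; omega⟩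
  have h2 : ∏ j : Fin (n i), stringPoint q n β (finSigmaFinEquiv ⟨i, j⟩) ^
      x (π.symm (finSigmaFinEquiv ⟨i, j⟩)) = ∏ j ∈ range (n i),
        (stringSinh q (n i) (β i) j / stringSinh q (n i) (β i) (j + 1)) ^ stringPos n π x i j := by
    rw [← Fin.prod_univ_eq_prod_range (fun j : ℕ => (stringSinh q (n i) (β i) j /
      stringSinh q (n i) (β i) (j + 1)) ^ stringPos n π x i j)]
    refine prod_congr rfl fun j _ => ?_
    rw [stringPoint_apply, stringPos, dif_pos j.2]
  rw [h2]
  generalize hs : stringSinh q (n i) (β i) = s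
  rw [hn', Nat.add_sub_cancel]
  exact prod_string_zpow (fun b => hs ▸ stringSinh_ne_zero_of_mem hq0 hq1 hβ i b) _ _

theorem norm_zeta {q : ℝ} (hq0 : 0 < q) (hq1 : q < 1) {n : ℕ} (hn : 0 < n) (β : ℝ) :
    ‖stringSinh q n β 0 / stringSinh q n β n‖ = 1 := by
  rw [norm_div, norm_stringSinh_self, div_self]
  exact norm_ne_zero_iff.2 (stringSinh_zero_ne_zero hq0 hq1 hn β)

theorem norm_gap_le_one (q : ℝ) {n b : ℕ} (β : ℝ) (hb : b ≤ n) :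
    ‖stringSinh q n β b / stringSinh q n β 0‖ ≤ 1 := by
  rw [norm_div]
  refine div_le_one_of_le₀ (norm_stringSinh_le β ?_) (norm_nonneg _)
  have h1 : (b : ℝ) ≤ n := by exact_mod_cast hb
  have h2 : (0 : ℝ) ≤ b := Nat.cast_nonneg b
  rw [Nat.cast_zero, sub_zero, abs_of_nonneg (show (0 : ℝ) ≤ n / 2 by linarith)]
  exact abs_le.2 ⟨by linarith, by linarith⟩

/-- The total momenta are unimodular, and each internal distance is a nonnegative exponent of a
number of norm at most one. -/
theorem norm_prod_stringPoint_le {q : ℝ} (hq0 : 0 < q) (hq1 : q < 1) {k : ℕ} {n : Fin k → ℕ}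
    (hn : ∀ i, 0 < n i) {β : Fin k → ℝ} (hβ : β ∈ rapidityDomain n)
    {π : Equiv.Perm (Fin (∑ i, n i))} (hπ : IsStringOrdered n π) {x : Fin (∑ i, n i) → ℤ}
    (hx : StrictMono x) : ‖∏ l, stringPoint q n β (π l) ^ x l‖ ≤ 1 := by
  rw [prod_stringPoint_zpow hq0 hq1 hn hβ, norm_prod]
  refine prod_le_one (fun _ _ => norm_nonneg _) fun i _ => ?_
  rw [norm_mul, norm_zpow, norm_zeta hq0 hq1 (hn i), one_zpow, one_mul, norm_prod]
  refine prod_le_one (fun _ _ => norm_nonneg _) fun b hb => ?_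
  rw [mem_range] at hb
  have h1 := hπ.stringPos_lt hx (i := i) (b := b) (by omega)
  obtain ⟨g, hg⟩ := Int.eq_ofNat_of_zero_le (sub_nonneg.2 h1.le)
  rw [hg, norm_zpow, zpow_natCast]
  exact pow_le_one₀ (norm_nonneg _) (norm_gap_le_one q _ (by omega))

/-- The plane wave of a permutation, weighted by the amplitude. -/
def betheTerm (q : ℝ) {m : ℕ} (z : Fin m → ℂ) (π : Equiv.Perm (Fin m)) (X : Finset ℤ) : ℂ :=
  if h : #X = m then amplitude q (fun l => z (π l)) * ∏ l, z (π l) ^ X.orderEmbOfFin h l else 0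

theorem betheState_eq_sum (q : ℝ) {m : ℕ} (z : Fin m → ℂ) (X : Finset ℤ) :
    betheState q z X = ∑ π : Equiv.Perm (Fin m), ((Equiv.Perm.sign π : ℤˣ) : ℂ) *
      betheTerm q z π X := by
  by_cases h : #X = m
  · simp only [betheState, betheTerm, dif_pos h, wave]
  · simp [betheState, betheTerm, dif_neg h]

theorem norm_betheTerm_le {q : ℝ} (hq0 : 0 < q) (hq1 : q < 1) {k : ℕ} {n : Fin k → ℕ}
    (hn : ∀ i, 0 < n i) {β : Fin k → ℝ} (hβ : β ∈ rapidityDomain n)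
    (π : Equiv.Perm (Fin (∑ i, n i))) (X : Finset ℤ) :
    ‖betheTerm q (stringPoint q n β) π X‖ ≤ ‖amplitude q fun l => stringPoint q n β (π l)‖ := by
  rw [betheTerm]
  split_ifs with h
  · by_cases hπ : IsStringOrdered n π
    · rw [norm_mul]
      exact mul_le_of_le_one_right (norm_nonneg _)
        (norm_prod_stringPoint_le hq0 hq1 hn hβ hπ (X.orderEmbOfFin h).strictMono)
    · rw [amplitude_eq_zero hq0 hq1 hβ hπ, zero_mul]
  · rw [norm_zero]
    exact norm_nonneg _

theorem norm_betheState_le {q : ℝ} (hq0 : 0 < q) (hq1 : q < 1) {k : ℕ} {n : Fin k → ℕ}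
    (hn : ∀ i, 0 < n i) {β : Fin k → ℝ} (hβ : β ∈ rapidityDomain n) (X : Finset ℤ) :
    ‖betheState q (stringPoint q n β) X‖ ≤ ∑ π : Equiv.Perm (Fin (∑ i, n i)),
      ‖amplitude q fun l => stringPoint q n β (π l)‖ := by
  rw [betheState_eq_sum]
  refine norm_sum_le_of_le _ fun π _ => ?_
  rw [norm_mul]
  have : ‖((Equiv.Perm.sign π : ℤˣ) : ℂ)‖ = 1 := by
    rcases Int.units_eq_one_or (Equiv.Perm.sign π) with h | h <;> simp [h]
  rw [this, one_mul]
  exact norm_betheTerm_le hq0 hq1 hn hβ π X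

theorem isAdmissible_stringPoint {q : ℝ} (hq0 : 0 < q) (hq1 : q < 1) {k : ℕ} {n : Fin k → ℕ}
    (hn : ∀ i, 0 < n i) {β : Fin k → ℝ} (hβ : β ∈ rapidityDomain n)
    (hprod : ∀ S : Finset (Fin (∑ i, n i)), S.Nonempty →
      1 - ∏ a ∈ S, (q : ℂ) * stringPoint q n β a ≠ 0) :
    IsAdmissible q (stringPoint q n β) where
  ne_zero := stringPoint_ne_zero hq0 hq1 hβ
  one_sub_ne_zero a :=
    one_sub_q_mul_stringMagnon hq0 hq1 (stringSinh_ne_zero_of_mem hq0 hq1 hβ _) _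
  one_sub_prod_ne_zero := hprod
  -- A nonzero amplitude forces the last place to be taken by the last magnon of a bound state. Its
  -- momentum `s_{n-1} / s_n` has norm at most one, and the factor `q` makes the bound strict.
  norm_last π l hl hA := by
    have hπ : IsStringOrdered n π := by
      by_contra h
      exact hA (amplitude_eq_zero hq0 hq1 hβ h)
    obtain ⟨⟨i, j⟩, hij⟩ := finSigmaFinEquiv.surjective (π l)
    have hj : (j : ℕ) + 1 = n i := by
      by_contra hne
      have h1 := hπ i j (by omega)
      rw [Fin.eta, hij, Equiv.symm_apply_apply, Fin.lt_def] at h1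
      have := (π.symm (finSigmaFinEquiv ⟨i, ⟨(j : ℕ) + 1, by omega⟩⟩)).2
      omega
    rw [← hij, stringPoint_apply, hj, norm_mul, Complex.norm_real, Real.norm_of_nonneg hq0.le,
      norm_div]
    refine (mul_le_of_le_one_right hq0.le (div_le_one_of_le₀ (norm_stringSinh_le _ ?_)
      (norm_nonneg _))).trans_lt hq1
    have h1 : (n i : ℝ) = j + 1 := by exact_mod_cast hj.symm
    have h2 : (0 : ℝ) ≤ (j : ℕ) := Nat.cast_nonneg _
    rw [h1, show ((j : ℕ) + 1 : ℝ) / 2 - ((j : ℕ) + 1) = -(((j : ℕ) + 1) / 2) by ring, abs_neg,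
      abs_of_nonneg (show (0 : ℝ) ≤ ((j : ℕ) + 1) / 2 by linarith)]
    exact abs_le.2 ⟨by linarith, by linarith⟩
  bounded := ⟨_, norm_betheState_le hq0 hq1 hn hβ⟩

end XXZ

end

/-! ### Null sets of rapidities, interchange of transform and integral, and square summability of
packets. -/

noncomputable section

namespace XXZ

open Finset Filter Topology MeasureTheory

/-! ### Exceptional rapidities -/

theorem countable_exp_eq (u : ℂ) : {t : ℝ | Complex.exp (2 * (Complex.I * t)) = u}.Countable := by
  rcases Set.eq_empty_or_nonempty {t : ℝ | Complex.exp (2 * (Complex.I * t)) = u} with h | ⟨t₀, h₀⟩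
  · rw [h]
    exact Set.countable_empty
  · refine (Set.countable_range fun a : ℤ => t₀ + a * Real.pi).mono fun t ht => ?_
    have h1 : Complex.exp (2 * (Complex.I * t)) = Complex.exp (2 * (Complex.I * t₀)) := by
      rw [show Complex.exp (2 * (Complex.I * t)) = u from ht]
      exact (show Complex.exp (2 * (Complex.I * t₀)) = u from h₀).symm
    obtain ⟨a, ha⟩ := Complex.exp_eq_exp_iff_exists_int.1 h1
    refine ⟨a, ?_⟩
    have h2 : (2 * Complex.I) * (t : ℂ) = (2 * Complex.I) * ((t₀ + a * Real.pi : ℝ) : ℂ) := by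
      push_cast
      linear_combination ha
    have h3 := mul_left_cancel₀ (mul_ne_zero two_ne_zero Complex.I_ne_zero) h2
    exact (Complex.ofReal_injective h3).symm

/-- In the variable `u = e^{2iβ}` the equation becomes polynomial, `c ∏ (u - A a) = ∏ (u - B a)`. A
nonzero polynomial has finitely many roots, and each value of `u` comes from countably many `β`. -/
theorem countable_prod_stringMagnon_eq_one {q : ℝ} (hq0 : 0 < q) (hq1 : q < 1) (n : ℕ)
    {ι : Type*} {S : Finset ι} (hS : S.Nonempty) (j : ι → ℕ) (c : ℂ) :
    {t : ℝ | c * ∏ a ∈ S, (q : ℂ) * stringMagnon q n t (j a + 1) = 1}.Countable := by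
  let A : ι → ℂ := fun a => ((q ^ (n - 2 * j a : ℝ) : ℝ) : ℂ)
  let B : ι → ℂ := fun a => ((q ^ (n - 2 * (j a + 1 : ℕ) : ℝ) : ℝ) : ℂ)
  let P : Polynomial ℂ := Polynomial.C c * ∏ a ∈ S, (Polynomial.X - Polynomial.C (A a)) -
    ∏ a ∈ S, (Polynomial.X - Polynomial.C (B a))
  have hP : P ≠ 0 := by
    -- At `u = A a₀` with the smallest `j` the first product vanishes. The second does not, since
    -- the exponent of `q` in every `B a` is strictly smaller than that in `A a₀`.
    obtain ⟨a₀, ha₀, hmin⟩ := S.exists_min_image j hS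
    intro h0
    have h1 : P.eval (A a₀) = 0 := by rw [h0, Polynomial.eval_zero]
    simp only [P, Polynomial.eval_sub, Polynomial.eval_mul, Polynomial.eval_prod,
      Polynomial.eval_C, Polynomial.eval_X] at h1
    rw [prod_eq_zero ha₀ (sub_self _), mul_zero, zero_sub, neg_eq_zero, prod_eq_zero_iff] at h1
    obtain ⟨a, ha, h2⟩ := h1
    have h3 := Complex.ofReal_injective (sub_eq_zero.1 h2)
    have h4 : (n - 2 * j a₀ : ℝ) < n - 2 * (j a + 1 : ℕ) := by
      by_contra hlt
      have hle : (j a₀ : ℝ) ≤ j a := by exact_mod_cast hmin a ha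
      rcases (not_lt.1 hlt).eq_or_lt with h | h
      · push_cast at h
        linarith
      · exact (Real.rpow_lt_rpow_of_exponent_gt hq0 hq1 h).ne h3
    have hle : (j a₀ : ℝ) ≤ j a := by exact_mod_cast hmin a ha
    push_cast at h4
    linarith
  refine (P.roots.toFinset.countable_toSet.biUnion fun u _ => countable_exp_eq u).mono
    fun t ht => ?_
  simp only [Set.mem_iUnion]
  refine ⟨Complex.exp (2 * (Complex.I * t)), ?_, rfl⟩
  rw [mem_coe, Multiset.mem_toFinset, Polynomial.mem_roots hP, Polynomial.IsRoot.def]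
  simp only [P, Polynomial.eval_sub, Polynomial.eval_mul, Polynomial.eval_prod,
    Polynomial.eval_C, Polynomial.eval_X]
  have h1 : c * ∏ a ∈ S, (q : ℂ) * stringMagnon q n t (j a + 1) = 1 := ht
  simp only [q_mul_stringMagnon hq0, prod_div_distrib] at h1
  -- If a denominator vanished, the quotient would be zero by convention and could not contribute to
  -- the value one.
  have h2 : ∏ a ∈ S, (Complex.exp (2 * (Complex.I * t)) - B a) ≠ 0 := by
    intro h0
    rw [show ∏ a ∈ S, (Complex.exp (2 * (Complex.I * t)) -
      ((q ^ (n - 2 * (j a + 1 : ℕ) : ℝ) : ℝ) : ℂ)) = 0 from h0] at h1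
    simp at h1
  rw [← mul_div_assoc, div_eq_one_iff_eq h2] at h1
  exact sub_eq_zero.2 h1

theorem stringPoint_of_fst_eq (q : ℝ) {k : ℕ} (n : Fin k → ℕ) (β : Fin k → ℝ)
    {a : Fin (∑ i, n i)} {i : Fin k} (h : (finSigmaFinEquiv.symm a).1 = i) :
    stringPoint q n β a =
      stringMagnon q (n i) (β i) (((finSigmaFinEquiv.symm a).2 : ℕ) + 1) := by
  subst h
  rfl

theorem measurable_stringPoint (q : ℝ) {k : ℕ} (n : Fin k → ℕ) (a : Fin (∑ i, n i)) :
    Measurable fun β => stringPoint q n β a := by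
  simp only [stringPoint_eq]
  refine Measurable.div ?_ ?_
  · exact ((continuous_stringSinh q _ _).comp (continuous_apply _)).measurable
  · exact ((continuous_stringSinh q _ _).comp (continuous_apply _)).measurable

/-- Choose a bound state `i` that meets `S`. Along every line parallel to the axis `i`, only the
factors of that bound state vary, so the exceptional set meets the line in a countable set; a Fubini
argument makes it a null set. -/
theorem ae_one_sub_prod_ne_zero {q : ℝ} (hq0 : 0 < q) (hq1 : q < 1) {k : ℕ} (n : Fin k → ℕ) :
    ∀ᵐ β : Fin k → ℝ, ∀ S : Finset (Fin (∑ i, n i)), S.Nonempty →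
      1 - ∏ a ∈ S, (q : ℂ) * stringPoint q n β a ≠ 0 := by
  rw [ae_all_iff]
  intro S
  by_cases hS : S.Nonempty
  swap
  · exact ae_of_all _ fun _ h => absurd h hS
  obtain ⟨a₀, ha₀⟩ := hS
  set i := (finSigmaFinEquiv.symm a₀).1 with hi
  have hmeas : MeasurableSet {β | 1 - ∏ a ∈ S, (q : ℂ) * stringPoint q n β a ≠ 0} := by
    have : Measurable fun β => 1 - ∏ a ∈ S, (q : ℂ) * stringPoint q n β a :=
      measurable_const.sub (Finset.measurable_fun_prod _ fun a _ =>
        measurable_const.mul (measurable_stringPoint q n a))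
    exact this (measurableSet_singleton (0 : ℂ)).compl
  have key := ae_mem_of_ae_add_linearMap_mem
    (LinearMap.toSpanSingleton ℝ (Fin k → ℝ) (Pi.single i 1)) (volume : Measure ℝ)
    (volume : Measure (Fin k → ℝ)) hmeas fun β => ?_
  · filter_upwards [key] with β hβ _
    exact hβ
  set S₁ := {a ∈ S | (finSigmaFinEquiv.symm a).1 = i} with hS₁
  have hS₁n : S₁.Nonempty := ⟨a₀, mem_filter.2 ⟨ha₀, rfl⟩⟩
  have hc := countable_prod_stringMagnon_eq_one hq0 hq1 (n i) hS₁n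
    (fun a => ((finSigmaFinEquiv.symm a).2 : ℕ))
    (∏ a ∈ S with ¬ (finSigmaFinEquiv.symm a).1 = i, (q : ℂ) * stringPoint q n β a)
  have hc' := (hc.preimage (add_right_injective (β i))).ae_notMem (volume : Measure ℝ)
  filter_upwards [hc'] with t ht
  intro h0
  refine ht ?_
  rw [sub_eq_zero] at h0
  have hv : ∀ i', (β + (LinearMap.toSpanSingleton ℝ (Fin k → ℝ) (Pi.single i 1)) t) i' =
      if i' = i then β i + t else β i' := by
    intro i'
    by_cases h : i' = i
    · subst h
      simp
    · simp [h]
  rw [← prod_filter_mul_prod_filter_not S fun a => (finSigmaFinEquiv.symm a).1 = i] at h0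
  rw [Set.mem_preimage]
  change _ = _
  rw [h0, mul_comm]
  congr 1
  · refine prod_congr rfl fun a ha => ?_
    rw [stringPoint_of_fst_eq q n _ (mem_filter.1 ha).2, hv, if_pos rfl]
  · refine prod_congr rfl fun a ha => ?_
    rw [stringPoint_of_fst_eq q n _ rfl, stringPoint_of_fst_eq q n _ rfl, hv,
      if_neg (mem_filter.1 ha).2]

/-! ### Integrals of wave functions -/

/-- A family of wave functions with an integrable bound. -/
structure IsDominatedFamily {α : Type*} [MeasurableSpace α] (μ : Measure α)
    (Φ : α → Finset ℤ → ℂ) (G : α → ℝ) : Prop where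
  measurable : ∀ X, AEStronglyMeasurable (fun a => Φ a X) μ
  bound : ∀ a X, ‖Φ a X‖ ≤ G a
  integrable : Integrable G μ

namespace IsDominatedFamily

variable {α : Type*} [MeasurableSpace α] {μ : Measure α} {Φ : α → Finset ℤ → ℂ} {G : α → ℝ}

theorem bound_nonneg (h : IsDominatedFamily μ Φ G) (a : α) : 0 ≤ G a :=
  (norm_nonneg _).trans (h.bound a ∅)

theorem norm_tailSum_le (h : IsDominatedFamily μ Φ G) {q : ℝ} (hq0 : 0 < q) (hq1 : q < 1) (c : ℤ)
    (k : ℕ) (X : Finset ℤ) (a : α) :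
    ‖tailSum q c (Φ a) k X‖ ≤ tailBound q c k #X * G a :=
  XXZ.norm_tailSum_le hq0 hq1 (h.bound_nonneg a) (h.bound a) k X

theorem integrable_tailSum (h : IsDominatedFamily μ Φ G) {q : ℝ} (hq0 : 0 < q) (hq1 : q < 1)
    (c : ℤ) (k : ℕ) (X : Finset ℤ) : Integrable (fun a => tailSum q c (Φ a) k X) μ := by
  refine (h.integrable.const_mul (tailBound q c k #X)).mono' ?_
    (ae_of_all _ (h.norm_tailSum_le hq0 hq1 c k X))
  induction k generalizing X with
  | zero => exact h.measurable X
  | succ k ih =>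
    simp only [tailSum]
    refine AEStronglyMeasurable.const_mul ?_ _
    refine aestronglyMeasurable_of_tendsto_ae atTop (f := fun N a => ∑ i ∈ range N,
      if c + (i : ℤ) ∈ X then 0 else
        raiseWeight q X (c + i) * tailSum q c (Φ a) k (insert (c + (i : ℤ)) X))
      (fun N => ?_) (ae_of_all _ fun a => ?_)
    · refine Finset.aestronglyMeasurable_fun_sum _ fun i _ => ?_
      split_ifs
      · exact aestronglyMeasurable_const
      · exact (ih _).const_mul _
    · refine Summable.tendsto_sum_tsum_nat (summable_raise hq0 hq1
        (C := tailBound q c k (#X + 1) * G a) (fun Y hY => ?_)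
        (mul_nonneg (tailBound_nonneg hq0 hq1 _ _ _) (h.bound_nonneg a)))
      rw [← hY]
      exact h.norm_tailSum_le hq0 hq1 c k Y a

/-- The geometric majorant of the terms is integrable in the parameter, so sum and integral may be
exchanged at each level of the recursion. -/
theorem tailSum_integral (h : IsDominatedFamily μ Φ G) {q : ℝ} (hq0 : 0 < q) (hq1 : q < 1)
    (c : ℤ) (k : ℕ) (X : Finset ℤ) :
    tailSum q c (fun X => ∫ a, Φ a X ∂μ) k X = ∫ a, tailSum q c (Φ a) k X ∂μ := by
  induction k generalizing X with
  | zero => rfl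
  | succ k ih =>
    simp only [tailSum]
    rw [integral_const_mul]
    congr 1
    simp only [raiseHalf, ih]
    have hint : ∀ i : ℕ, Integrable (fun a => if c + (i : ℤ) ∈ X then 0 else
        raiseWeight q X (c + i) * tailSum q c (Φ a) k (insert (c + (i : ℤ)) X)) μ := by
      intro i
      split_ifs
      · exact integrable_zero _ _ _
      · exact (h.integrable_tailSum hq0 hq1 c k _).const_mul _
    have hb : ∀ (i : ℕ) a, ‖if c + (i : ℤ) ∈ X then 0 else
        raiseWeight q X (c + i) * tailSum q c (Φ a) k (insert (c + (i : ℤ)) X)‖ ≤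
        q ^ (c - 2 * (#X : ℤ)) * (tailBound q c k (#X + 1) * G a) * q ^ i := by
      intro i a
      refine norm_raise_term_le hq0 hq1 (fun Y hY => ?_)
        (mul_nonneg (tailBound_nonneg hq0 hq1 _ _ _) (h.bound_nonneg a)) i
      rw [← hY]
      exact h.norm_tailSum_le hq0 hq1 c k Y a
    rw [← integral_tsum_of_summable_integral_norm hint]
    · refine tsum_congr fun i => ?_
      split_ifs
      · rw [integral_zero]
      · rw [integral_const_mul]
    · refine Summable.of_nonneg_of_le (fun i => integral_nonneg fun a => norm_nonneg _)
        (fun i => integral_mono (hint i).norm ?_ (hb i)) ?_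
      · exact ((h.integrable.const_mul _).const_mul _).mul_const _
      · simp only [integral_mul_const]
        exact (summable_geometric_of_lt_one hq0.le hq1).mul_left _

theorem peelSum_integral (h : IsDominatedFamily μ Φ G) {q : ℝ} (hq0 : 0 < q) (hq1 : q < 1)
    (w : ℕ → ℂ) (x : ℕ → ℤ) (r : ℕ) (c : ℤ) (k s : ℕ) (X : Finset ℤ) :
    Integrable (fun a => peelSum w x r (tailSum q c (Φ a)) k s X) μ ∧
      peelSum w x r (tailSum q c fun X => ∫ a, Φ a X ∂μ) k s X =
        ∫ a, peelSum w x r (tailSum q c (Φ a)) k s X ∂μ := by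
  induction k generalizing s X with
  | zero => exact ⟨h.integrable_tailSum hq0 hq1 c 0 X, h.tailSum_integral hq0 hq1 c 0 X⟩
  | succ k ih =>
    simp only [peelSum]
    have h1 : ∀ l ∈ Ioc s r, Integrable
        (fun a => w l * peelSum w x r (tailSum q c (Φ a)) k l (insert (x l) X)) μ :=
      fun l _ => (ih l _).1.const_mul _
    refine ⟨(integrable_finsetSum _ h1).add (h.integrable_tailSum hq0 hq1 c (k + 1) X), ?_⟩
    rw [integral_add (integrable_finsetSum _ h1) (h.integrable_tailSum hq0 hq1 c (k + 1) X),
      integral_finsetSum _ h1, h.tailSum_integral hq0 hq1]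
    congr 1
    refine sum_congr rfl fun l _ => ?_
    rw [integral_const_mul, (ih l _).2]

theorem integrable_dwTransform (h : IsDominatedFamily μ Φ G) {q : ℝ} (hq0 : 0 < q) (hq1 : q < 1)
    (m : ℕ) (δ : YoungDiagram) : Integrable (fun a => dwTransform q m (Φ a) δ) μ :=
  (h.peelSum_integral hq0 hq1 _ _ _ _ _ _ _).1.const_mul _

theorem dwTransform_integral (h : IsDominatedFamily μ Φ G) {q : ℝ} (hq0 : 0 < q) (hq1 : q < 1)
    (m : ℕ) (δ : YoungDiagram) :
    dwTransform q m (fun X => ∫ a, Φ a X ∂μ) δ = ∫ a, dwTransform q m (Φ a) δ ∂μ := by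
  simp only [dwTransform]
  rw [integral_const_mul, (h.peelSum_integral hq0 hq1 _ _ _ _ _ _ _).2]

end IsDominatedFamily

theorem tailSum_const_mul (q : ℝ) (c : ℤ) (b : ℂ) (ψ : Finset ℤ → ℂ) (k : ℕ) :
    tailSum q c (fun X => b * ψ X) k = fun X => b * tailSum q c ψ k X := by
  induction k with
  | zero => rfl
  | succ k ih =>
    funext X
    simp only [tailSum, ih, raiseHalf]
    have h : ∀ i : ℕ, (if c + (i : ℤ) ∈ X then 0 else raiseWeight q X (c + i) *
        (b * tailSum q c ψ k (insert (c + (i : ℤ)) X))) =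
        b * if c + (i : ℤ) ∈ X then 0 else
          raiseWeight q X (c + i) * tailSum q c ψ k (insert (c + (i : ℤ)) X) := by
      intro i
      split_ifs
      · rw [mul_zero]
      · ring
    simp only [h, tsum_mul_left]
    ring

theorem peelSum_const_mul (w : ℕ → ℂ) (x : ℕ → ℤ) (r : ℕ) (b : ℂ) (S : ℕ → Finset ℤ → ℂ)
    (k s : ℕ) (X : Finset ℤ) :
    peelSum w x r (fun k X => b * S k X) k s X = b * peelSum w x r S k s X := by
  induction k generalizing s X with
  | zero => rfl
  | succ k ih =>
    simp only [peelSum, ih, mul_add, mul_sum]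
    congr 1
    exact sum_congr rfl fun l _ => by ring

theorem dwTransform_const_mul (q : ℝ) (m : ℕ) (b : ℂ) (ψ : Finset ℤ → ℂ) (δ : YoungDiagram) :
    dwTransform q m (fun X => b * ψ X) δ = b * dwTransform q m ψ δ := by
  rw [dwTransform, dwTransform, funext (tailSum_const_mul q _ b ψ), peelSum_const_mul]
  ring

/-! ### Wave packets -/

theorem IsTestFunction.continuous_mul {k : ℕ} {n : Fin k → ℕ} {f : (Fin k → ℝ) → ℂ}
    (hf : IsTestFunction n f) {g : (Fin k → ℝ) → ℂ} (hg : ContinuousOn g (rapidityDomain n)) :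
    Continuous (fun β => f β * g β) := by
  have hfc : Continuous f := hf.smooth.continuous
  exact (hfc.continuousOn.mul hg).continuous_of_tsupport_subset (isOpen_rapidityDomain n)
    ((tsupport_mul_subset_left (f := f) (g := g)).trans hf.support)

theorem IsTestFunction.integrable_mul {k : ℕ} {n : Fin k → ℕ} {f : (Fin k → ℝ) → ℂ}
    (hf : IsTestFunction n f) {g : (Fin k → ℝ) → ℂ} (hg : ContinuousOn g (rapidityDomain n)) :
    Integrable (fun β => f β * g β) :=
  (hf.continuous_mul hg).integrable_of_hasCompactSupport hf.compact.mul_right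

theorem IsTestFunction.mem_of_ne_zero {k : ℕ} {n : Fin k → ℕ} {f : (Fin k → ℝ) → ℂ}
    (hf : IsTestFunction n f) {β : Fin k → ℝ} (h : f β ≠ 0) : β ∈ rapidityDomain n :=
  hf.support (subset_tsupport f h)

theorem continuousOn_betheTerm {q : ℝ} (hq0 : 0 < q) (hq1 : q < 1) {k : ℕ} (n : Fin k → ℕ)
    (π : Equiv.Perm (Fin (∑ i, n i))) (X : Finset ℤ) :
    ContinuousOn (fun β => betheTerm q (stringPoint q n β) π X) (rapidityDomain n) := by
  by_cases h : #X = ∑ i, n i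
  · simp only [betheTerm, dif_pos h]
    refine (continuousOn_amplitude hq0 hq1 n π).mul (continuousOn_finsetProd _ fun l _ => ?_)
    exact (continuousOn_stringPoint hq0 hq1 n (π l)).zpow₀ _ fun β hβ =>
      Or.inl (stringPoint_ne_zero hq0 hq1 hβ _)
  · simp only [betheTerm, dif_neg h]
    exact continuousOn_const

theorem continuousOn_betheState {q : ℝ} (hq0 : 0 < q) (hq1 : q < 1) {k : ℕ} (n : Fin k → ℕ)
    (X : Finset ℤ) :
    ContinuousOn (fun β => betheState q (stringPoint q n β) X) (rapidityDomain n) := by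
  simp only [betheState_eq_sum]
  exact continuousOn_finsetSum _ fun π _ =>
    continuousOn_const.mul (continuousOn_betheTerm hq0 hq1 n π X)

theorem IsTestFunction.integrable_betheState {q : ℝ} (hq0 : 0 < q) (hq1 : q < 1) {k : ℕ}
    {n : Fin k → ℕ} {f : (Fin k → ℝ) → ℂ} (hf : IsTestFunction n f) (X : Finset ℤ) :
    Integrable (fun β => f β * betheState q (stringPoint q n β) X) :=
  hf.integrable_mul (continuousOn_betheState hq0 hq1 n X)

theorem IsTestFunction.isDominatedFamily {q : ℝ} (hq0 : 0 < q) (hq1 : q < 1) {k : ℕ}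
    {n : Fin k → ℕ} (hn : ∀ i, 0 < n i) {f : (Fin k → ℝ) → ℂ} (hf : IsTestFunction n f) :
    IsDominatedFamily volume (fun β X => f β * betheState q (stringPoint q n β) X)
      (fun β => ∑ π : Equiv.Perm (Fin (∑ i, n i)),
        ‖f β * amplitude q fun l => stringPoint q n β (π l)‖) where
  measurable X := (hf.integrable_betheState hq0 hq1 X).1
  bound β X := by
    simp only [norm_mul, ← mul_sum]
    by_cases h : f β = 0
    · simp [h]
    · exact mul_le_mul_of_nonneg_left (norm_betheState_le hq0 hq1 hn (hf.mem_of_ne_zero h) X)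
        (norm_nonneg _)
  integrable := integrable_finsetSum _ fun π _ =>
    (hf.integrable_mul (continuousOn_amplitude hq0 hq1 n π)).norm

theorem IsTestFunction.ae_dwTransform_eq {q : ℝ} (hq0 : 0 < q) (hq1 : q < 1) {k : ℕ}
    {n : Fin k → ℕ} (hn : ∀ i, 0 < n i) {f : (Fin k → ℝ) → ℂ} (hf : IsTestFunction n f)
    (δ : YoungDiagram) :
    (fun β => dwTransform q (∑ i, n i) (fun X => f β * betheState q (stringPoint q n β) X) δ)
      =ᵐ[volume] fun β => f β * dwState q (stringPoint q n β) δ := by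
  filter_upwards [ae_one_sub_prod_ne_zero hq0 hq1 n] with β hβ
  rw [dwTransform_const_mul]
  by_cases h : f β = 0
  · simp [h]
  · rw [dwTransform_betheState hq0 hq1
      (isAdmissible_stringPoint hq0 hq1 hn (hf.mem_of_ne_zero h) hβ)]

theorem IsTestFunction.integrable_dwState {q : ℝ} (hq0 : 0 < q) (hq1 : q < 1) {k : ℕ}
    {n : Fin k → ℕ} (hn : ∀ i, 0 < n i) {f : (Fin k → ℝ) → ℂ} (hf : IsTestFunction n f)
    (δ : YoungDiagram) :
    Integrable (fun β => f β * dwState q (stringPoint q n β) δ) :=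
  ((hf.isDominatedFamily hq0 hq1 hn).integrable_dwTransform hq0 hq1 _ δ).congr
    (hf.ae_dwTransform_eq hq0 hq1 hn δ)

/-- Almost everywhere on the support of `f` the momenta are admissible, so the integrand is the
transform of the ferromagnetic one, and the transform commutes with the dominated integral.
Everything about domain wall packets thereby follows from the transform of one square summable
vector. -/
theorem IsTestFunction.dwPacket_eq {q : ℝ} (hq0 : 0 < q) (hq1 : q < 1) {k : ℕ}
    {n : Fin k → ℕ} (hn : ∀ i, 0 < n i) {f : (Fin k → ℝ) → ℂ} (hf : IsTestFunction n f) :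
    dwPacket q n f = dwTransform q (∑ i, n i) (bethePacket q n f) := by
  funext δ
  rw [dwPacket, ← integral_congr_ae (hf.ae_dwTransform_eq hq0 hq1 hn δ),
    ← (hf.isDominatedFamily hq0 hq1 hn).dwTransform_integral hq0 hq1]
  rfl

theorem bethePacket_eq_zero (q : ℝ) {k : ℕ} (n : Fin k → ℕ) (f : (Fin k → ℝ) → ℂ) {X : Finset ℤ}
    (hX : #X ≠ ∑ i, n i) : bethePacket q n f X = 0 := by
  simp [bethePacket, betheState, dif_neg hX]

/-! ### Bessel's inequality for the total momenta -/

/-- The total momentum factor `s_0 / s_n` of a bound state. -/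
def zeta (q : ℝ) (n : ℕ) (β : ℝ) : ℂ := stringSinh q n β 0 / stringSinh q n β n

/-- The derivative of the total momentum. -/
def momentumDeriv (q : ℝ) (n : ℕ) (β : ℝ) : ℝ :=
  Real.sinh (n * -Real.log q) / ‖stringSinh q n β 0‖ ^ 2

theorem stringSinh_self_eq (q : ℝ) (n : ℕ) (β : ℝ) :
    stringSinh q n β n = -(starRingEnd ℂ) (stringSinh q n β 0) := by
  rw [stringSinh_eq, stringSinh_eq, map_add, map_mul, Complex.conj_ofReal, Complex.conj_ofReal,
    Complex.conj_I, show ((n : ℝ) / 2 - n) * -Real.log q =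
      -(((n : ℝ) / 2 - (0 : ℕ)) * -Real.log q) by push_cast; ring, Real.sinh_neg, Real.cosh_neg]
  push_cast
  ring

theorem stringSinh_self_ne_zero {q : ℝ} (hq0 : 0 < q) (hq1 : q < 1) {n : ℕ} (hn : 0 < n) (β : ℝ) :
    stringSinh q n β n ≠ 0 := by
  rw [stringSinh_self_eq, neg_ne_zero, Ne, map_eq_zero]
  exact stringSinh_zero_ne_zero hq0 hq1 hn β

theorem continuous_zeta {q : ℝ} (hq0 : 0 < q) (hq1 : q < 1) {n : ℕ} (hn : 0 < n) :
    Continuous (zeta q n) :=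
  (continuous_stringSinh q n 0).div (continuous_stringSinh q n n)
    (stringSinh_self_ne_zero hq0 hq1 hn)

theorem zeta_ne_zero {q : ℝ} (hq0 : 0 < q) (hq1 : q < 1) {n : ℕ} (hn : 0 < n) (β : ℝ) :
    zeta q n β ≠ 0 :=
  div_ne_zero (stringSinh_zero_ne_zero hq0 hq1 hn β) (stringSinh_self_ne_zero hq0 hq1 hn β)

theorem continuous_zeta_zpow {q : ℝ} (hq0 : 0 < q) (hq1 : q < 1) {n : ℕ} (hn : 0 < n) (d : ℤ) :
    Continuous fun β => zeta q n β ^ d :=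
  (continuous_zeta hq0 hq1 hn).zpow₀ d fun β => Or.inl (zeta_ne_zero hq0 hq1 hn β)

theorem continuous_momentumDeriv {q : ℝ} (hq0 : 0 < q) (hq1 : q < 1) {n : ℕ} (hn : 0 < n) :
    Continuous (momentumDeriv q n) :=
  continuous_const.div ((continuous_stringSinh q n 0).norm.pow 2) fun β =>
    pow_ne_zero _ (norm_ne_zero_iff.2 (stringSinh_zero_ne_zero hq0 hq1 hn β))

theorem exists_le_momentumDeriv {q : ℝ} (hq0 : 0 < q) (hq1 : q < 1) {n : ℕ} (hn : 0 < n) :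
    ∃ κ : ℝ, 0 < κ ∧ ∀ β, κ ≤ momentumDeriv q n β := by
  have hη := eta_pos hq0 hq1
  have hn' : (0 : ℝ) < n := by exact_mod_cast hn
  have h1 : 0 < Real.sinh (n * -Real.log q) := Real.sinh_pos_iff.2 (by positivity)
  refine ⟨Real.sinh (n * -Real.log q) /
    (Real.sinh (((n : ℝ) / 2 - (0 : ℕ)) * -Real.log q) ^ 2 + 1), by positivity, fun β => ?_⟩
  have h2 : 0 < ‖stringSinh q n β 0‖ ^ 2 := by
    have := norm_pos_iff.2 (stringSinh_zero_ne_zero hq0 hq1 hn β)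
    positivity
  refine div_le_div_of_nonneg_left h1.le h2 ?_
  rw [norm_sq_stringSinh]
  linarith [Real.sin_sq_le_one β]

theorem hasDerivAt_stringSinh (q : ℝ) (n b : ℕ) (β : ℝ) :
    HasDerivAt (fun β => stringSinh q n β b) (Complex.cosh (Complex.I * β +
      ((n : ℂ) / 2 - b) * ((-Real.log q : ℝ) : ℂ)) * Complex.I) β := by
  have h1 : HasDerivAt (fun β : ℝ => Complex.I * (β : ℂ) +
      ((n : ℂ) / 2 - b) * ((-Real.log q : ℝ) : ℂ)) Complex.I β := by
    have := ((Complex.ofRealCLM.hasDerivAt (x := β)).const_mul Complex.I).add_const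
      (((n : ℂ) / 2 - b) * ((-Real.log q : ℝ) : ℂ))
    simpa using this
  exact (Complex.hasDerivAt_sinh _).comp β h1

/-- In the quotient rule the subtraction theorem for `sinh` reduces the numerator to a constant, and
`s_0 s_n = -|s_0|²` makes the logarithmic derivative `i` times a positive density. Integrating
against this density amounts to using the total momentum as the variable. -/
theorem hasDerivAt_zeta {q : ℝ} (hq0 : 0 < q) (hq1 : q < 1) {n : ℕ} (hn : 0 < n) (β : ℝ) :
    HasDerivAt (zeta q n) (Complex.I * momentumDeriv q n β * zeta q n β) β := by
  have h0 := stringSinh_zero_ne_zero hq0 hq1 hn β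
  have h1 := stringSinh_self_ne_zero hq0 hq1 hn β
  have h := (hasDerivAt_stringSinh q n 0 β).div (hasDerivAt_stringSinh q n n β) h1
  refine HasDerivAt.congr_deriv (f := zeta q n) h (Eq.symm ?_)
  have e1 : Complex.cosh (Complex.I * β + ((n : ℂ) / 2 - (0 : ℕ)) * ((-Real.log q : ℝ) : ℂ)) *
      stringSinh q n β n - stringSinh q n β 0 *
      Complex.cosh (Complex.I * β + ((n : ℂ) / 2 - n) * ((-Real.log q : ℝ) : ℂ)) =
      -((Real.sinh (n * -Real.log q) : ℝ) : ℂ) := by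
    have e2 : ((Real.sinh (n * -Real.log q) : ℝ) : ℂ) =
        Complex.sinh ((Complex.I * β + ((n : ℂ) / 2 - (0 : ℕ)) * ((-Real.log q : ℝ) : ℂ)) -
          (Complex.I * β + ((n : ℂ) / 2 - n) * ((-Real.log q : ℝ) : ℂ))) := by
      rw [Complex.ofReal_sinh]
      congr 1
      push_cast
      ring
    rw [e2, Complex.sinh_sub, stringSinh, stringSinh]
    ring
  have e3 : ((‖stringSinh q n β 0‖ ^ 2 : ℝ) : ℂ) = -(stringSinh q n β 0 * stringSinh q n β n) := by
    rw [stringSinh_self_eq, mul_neg, neg_neg, Complex.mul_conj, Complex.normSq_eq_norm_sq]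
  have e4 : (momentumDeriv q n β : ℂ) = ((Real.sinh (n * -Real.log q) : ℝ) : ℂ) /
      -(stringSinh q n β 0 * stringSinh q n β n) := by
    rw [momentumDeriv, ← e3, Complex.ofReal_div]
  rw [e4, zeta]
  generalize ((Real.sinh (n * -Real.log q) : ℝ) : ℂ) = S at e1 ⊢
  clear h
  generalize Complex.cosh (Complex.I * β + ((n : ℂ) / 2 - (0 : ℕ)) * ((-Real.log q : ℝ) : ℂ)) = c0
    at e1 ⊢
  generalize Complex.cosh (Complex.I * β + ((n : ℂ) / 2 - n) * ((-Real.log q : ℝ) : ℂ)) = cn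
    at e1 ⊢
  generalize stringSinh q n β 0 = s0 at *
  generalize stringSinh q n β n = sn at *
  field_simp
  linear_combination -e1

theorem hasDerivAt_zeta_zpow {q : ℝ} (hq0 : 0 < q) (hq1 : q < 1) {n : ℕ} (hn : 0 < n) (d : ℤ)
    (β : ℝ) :
    HasDerivAt (fun β => zeta q n β ^ d)
      (Complex.I * d * (zeta q n β ^ d * momentumDeriv q n β)) β := by
  have hz := zeta_ne_zero hq0 hq1 hn β
  have h := (hasDerivAt_zpow d (zeta q n β) (Or.inl hz)).comp β (hasDerivAt_zeta hq0 hq1 hn β)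
  refine HasDerivAt.congr_deriv h (Eq.symm ?_)
  rw [zpow_sub_one₀ hz]
  field_simp

theorem zeta_period (q : ℝ) (n T : ℕ) : zeta q n (T * Real.pi) = zeta q n (-(T * Real.pi)) := by
  have h : ∀ b, stringSinh q n (T * Real.pi) b = stringSinh q n (-(T * Real.pi)) b := by
    intro b
    rw [stringSinh_eq, stringSinh_eq, Real.cos_neg, Real.sin_neg, Real.sin_nat_mul_pi]
    simp
  rw [zeta, zeta, h, h]

/-- Up to the nonzero factor `i d`, the integrand is the derivative of `ζ^d`, which takes equal
values at the two end points. -/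
theorem integral_zeta_zpow {q : ℝ} (hq0 : 0 < q) (hq1 : q < 1) {n : ℕ} (hn : 0 < n) (T : ℕ)
    {d : ℤ} (hd : d ≠ 0) :
    ∫ β in Set.Ioc (-(T * Real.pi)) (T * Real.pi), zeta q n β ^ d * momentumDeriv q n β = 0 := by
  have hle : -(T * Real.pi) ≤ T * Real.pi := by
    have : 0 ≤ T * Real.pi := by positivity
    linarith
  have hc : Continuous fun β => Complex.I * d * (zeta q n β ^ d * momentumDeriv q n β) :=
    continuous_const.mul ((continuous_zeta_zpow hq0 hq1 hn d).mul
      (Complex.continuous_ofReal.comp (continuous_momentumDeriv hq0 hq1 hn)))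
  have h := intervalIntegral.integral_eq_sub_of_hasDerivAt
    (fun β _ => hasDerivAt_zeta_zpow hq0 hq1 hn d β)
    (hc.intervalIntegrable (-(T * Real.pi)) (T * Real.pi))
  rw [zeta_period, sub_self, intervalIntegral.integral_const_mul,
    intervalIntegral.integral_of_le hle] at h
  refine (mul_eq_zero.1 h).resolve_left (mul_ne_zero Complex.I_ne_zero ?_)
  exact_mod_cast hd

/-- The box `(-Tπ, Tπ]^k`. -/
def rapidityBox (k T : ℕ) : Set (Fin k → ℝ) :=
  Set.univ.pi fun _ => Set.Ioc (-(T * Real.pi)) (T * Real.pi)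

theorem integral_box_prod {k : ℕ} (T : ℕ) (g : Fin k → ℝ → ℂ) :
    ∫ β in rapidityBox k T, ∏ i, g i (β i) =
      ∏ i, ∫ t in Set.Ioc (-(T * Real.pi)) (T * Real.pi), g i t := by
  rw [rapidityBox, volume_pi, Measure.restrict_pi_pi]
  exact integral_fintype_prod_eq_prod g

theorem integrableOn_box {k : ℕ} (T : ℕ) {E : Type*} [NormedAddCommGroup E]
    {g : (Fin k → ℝ) → E} (hg : Continuous g) : IntegrableOn g (rapidityBox k T) := by
  have h : IsCompact (Set.univ.pi fun _ : Fin k => Set.Icc (-(T * Real.pi)) (T * Real.pi)) :=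
    isCompact_univ_pi fun _ => isCompact_Icc
  exact (hg.continuousOn.integrableOn_compact h).mono_set
    (Set.pi_mono fun _ _ => Set.Ioc_subset_Icc_self)

/-- The plane wave of the total momenta. -/
def zetaWave (q : ℝ) {k : ℕ} (n : Fin k → ℕ) (Y : Fin k → ℤ) (β : Fin k → ℝ) : ℂ :=
  ∏ i, zeta q (n i) (β i) ^ Y i

theorem continuous_zetaWave {q : ℝ} (hq0 : 0 < q) (hq1 : q < 1) {k : ℕ} {n : Fin k → ℕ}
    (hn : ∀ i, 0 < n i) (Y : Fin k → ℤ) : Continuous (zetaWave q n Y) :=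
  continuous_finsetProd _ fun i _ =>
    (continuous_zeta_zpow hq0 hq1 (hn i) (Y i)).comp (continuous_apply i)

theorem zetaWave_mul_conj {q : ℝ} (hq0 : 0 < q) (hq1 : q < 1) {k : ℕ} {n : Fin k → ℕ}
    (hn : ∀ i, 0 < n i) (Y Y' : Fin k → ℤ) (β : Fin k → ℝ) :
    zetaWave q n Y β * (starRingEnd ℂ) (zetaWave q n Y' β) = zetaWave q n (Y - Y') β := by
  simp only [zetaWave, map_prod, ← prod_mul_distrib]
  refine prod_congr rfl fun i _ => ?_
  have h0 := zeta_ne_zero hq0 hq1 (hn i) (β i)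
  have h1 : (starRingEnd ℂ) (zeta q (n i) (β i)) = (zeta q (n i) (β i))⁻¹ := by
    refine eq_inv_of_mul_eq_one_right ?_
    rw [Complex.mul_conj, Complex.normSq_eq_norm_sq, zeta, norm_zeta hq0 hq1 (hn i)]
    simp
  rw [map_zpow₀, h1, inv_zpow, Pi.sub_apply, zpow_sub₀ h0, div_eq_mul_inv]

/-- The density that makes the plane waves of the total momenta orthogonal. -/
def momentumDensity (q : ℝ) {k : ℕ} (n : Fin k → ℕ) (β : Fin k → ℝ) : ℝ :=
  ∏ i, momentumDeriv q (n i) (β i)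

theorem continuous_momentumDensity {q : ℝ} (hq0 : 0 < q) (hq1 : q < 1) {k : ℕ} {n : Fin k → ℕ}
    (hn : ∀ i, 0 < n i) : Continuous (momentumDensity q n) :=
  continuous_finsetProd _ fun i _ =>
    (continuous_momentumDeriv hq0 hq1 (hn i)).comp (continuous_apply i)

theorem exists_le_momentumDensity {q : ℝ} (hq0 : 0 < q) (hq1 : q < 1) {k : ℕ} {n : Fin k → ℕ}
    (hn : ∀ i, 0 < n i) : ∃ κ : ℝ, 0 < κ ∧ ∀ β, κ ≤ momentumDensity q n β := by
  choose κ h1 h2 using fun i => exists_le_momentumDeriv hq0 hq1 (hn i)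
  exact ⟨∏ i, κ i, prod_pos fun i _ => h1 i, fun β =>
    prod_le_prod (fun i _ => (h1 i).le) fun i _ => h2 i (β i)⟩

theorem integral_zetaWave {q : ℝ} (hq0 : 0 < q) (hq1 : q < 1) {k : ℕ} {n : Fin k → ℕ}
    (hn : ∀ i, 0 < n i) (T : ℕ) (Y : Fin k → ℤ) :
    ∫ β in rapidityBox k T, zetaWave q n Y β * momentumDensity q n β =
      if Y = 0 then ((∫ β in rapidityBox k T, momentumDensity q n β : ℝ) : ℂ) else 0 := by
  split_ifs with h
  · rw [← integral_complex_ofReal]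
    simp [h, zetaWave]
  · obtain ⟨i, hi⟩ : ∃ i, Y i ≠ 0 := by
      by_contra! h'
      exact h (funext h')
    simp only [zetaWave, momentumDensity, Complex.ofReal_prod, ← prod_mul_distrib]
    rw [integral_box_prod T fun i t => zeta q (n i) t ^ Y i * momentumDeriv q (n i) t]
    exact prod_eq_zero (mem_univ i) (integral_zeta_zpow hq0 hq1 (hn i) T hi)

theorem integral_norm_sq_zetaWave {q : ℝ} (hq0 : 0 < q) (hq1 : q < 1) {k : ℕ} {n : Fin k → ℕ}
    (hn : ∀ i, 0 < n i) (T : ℕ) (𝒴 : Finset (Fin k → ℤ)) (b : (Fin k → ℤ) → ℂ) :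
    ∫ β in rapidityBox k T, ‖∑ Y ∈ 𝒴, b Y * zetaWave q n Y β‖ ^ 2 * momentumDensity q n β =
      (∫ β in rapidityBox k T, momentumDensity q n β) * ∑ Y ∈ 𝒴, ‖b Y‖ ^ 2 := by
  apply Complex.ofReal_injective
  rw [← integral_complex_ofReal]
  have h1 : ∀ β, ((‖∑ Y ∈ 𝒴, b Y * zetaWave q n Y β‖ ^ 2 * momentumDensity q n β : ℝ) : ℂ) =
      ∑ Y ∈ 𝒴, ∑ Y' ∈ 𝒴, b Y * (starRingEnd ℂ) (b Y') *
        (zetaWave q n (Y - Y') β * momentumDensity q n β) := by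
    intro β
    rw [Complex.ofReal_mul, ← Complex.normSq_eq_norm_sq, ← Complex.mul_conj, map_sum, sum_mul_sum,
      sum_mul]
    refine sum_congr rfl fun Y _ => ?_
    rw [sum_mul]
    refine sum_congr rfl fun Y' _ => ?_
    rw [← zetaWave_mul_conj hq0 hq1 hn, map_mul]
    ring
  have hint : ∀ Y : Fin k → ℤ, IntegrableOn
      (fun β => zetaWave q n Y β * momentumDensity q n β) (rapidityBox k T) := fun Y =>
    integrableOn_box T ((continuous_zetaWave hq0 hq1 hn Y).mul
      (Complex.continuous_ofReal.comp (continuous_momentumDensity hq0 hq1 hn)))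
  simp only [h1]
  rw [integral_finsetSum _ fun Y _ => integrable_finsetSum _ fun Y' _ =>
    (hint (Y - Y')).const_mul _]
  push_cast
  rw [mul_sum]
  refine sum_congr rfl fun Y hY => ?_
  rw [integral_finsetSum _ fun Y' _ => (hint (Y - Y')).const_mul _]
  simp only [integral_const_mul, integral_zetaWave hq0 hq1 hn, sub_eq_zero, mul_ite, mul_zero,
    sum_ite_eq, if_pos hY]
  rw [Complex.mul_conj, Complex.normSq_eq_norm_sq, mul_comm]
  push_cast
  rfl

/-- Young's inequality with a free parameter `c`, the weight entering one term directly and the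
other only through its lower bound. -/
theorem mul_le_weighted {c κ W x C : ℝ} (hc : 0 < c) (hκ : 0 < κ) (hW : κ ≤ W) (hx : 0 ≤ x)
    (hxC : x ≤ C) (y : ℝ) :
    x * y ≤ c / (2 * κ) * C ^ 2 + 1 / (2 * c) * (y ^ 2 * W) := by
  have hW0 : 0 < W := hκ.trans_le hW
  have e1 : c / (2 * W) * x ^ 2 + 1 / (2 * c) * (y ^ 2 * W) - x * y =
      (c * x - W * y) ^ 2 / (2 * W * c) := by
    field_simp
    ring
  have e2 : 0 ≤ (c * x - W * y) ^ 2 / (2 * W * c) := by positivity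
  have e3 : c / (2 * W) * x ^ 2 ≤ c / (2 * κ) * C ^ 2 := by gcongr
  linarith

/-- Bessel's inequality for the plane waves of the total momenta. -/
theorem exists_bessel {q : ℝ} (hq0 : 0 < q) (hq1 : q < 1) {k : ℕ} {n : Fin k → ℕ}
    (hn : ∀ i, 0 < n i) (T : ℕ) :
    ∃ K : ℝ, 0 ≤ K ∧ ∀ (F : (Fin k → ℝ) → ℂ) (C : ℝ), Continuous F →
      (∀ β, β ∉ rapidityBox k T → F β = 0) → (∀ β, ‖F β‖ ≤ C) →
      ∀ 𝒴 : Finset (Fin k → ℤ), ∑ Y ∈ 𝒴, ‖∫ β, F β * zetaWave q n Y β‖ ^ 2 ≤ K * C ^ 2 := by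
  obtain ⟨κ, hκ, hκW⟩ := exists_le_momentumDensity hq0 hq1 hn
  set c₀ := ∫ β in rapidityBox k T, momentumDensity q n β with hc₀
  have hc₀n : 0 ≤ c₀ := integral_nonneg fun β => hκ.le.trans (hκW β)
  have hvol : volume (rapidityBox k T) ≠ ⊤ := by
    rw [rapidityBox, volume_pi, Measure.pi_pi]
    exact ENNReal.prod_ne_top fun i _ => measure_Ioc_lt_top.ne
  set V := volume.real (rapidityBox k T) with hV
  have hVn : 0 ≤ V := measureReal_nonneg
  refine ⟨(c₀ + 1) / κ * V, by positivity, fun F C hF hFbox hFC 𝒴 => ?_⟩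
  have hbox : ∀ Y : Fin k → ℤ, ∫ β, F β * zetaWave q n Y β =
      ∫ β in rapidityBox k T, F β * zetaWave q n Y β := fun Y =>
    (setIntegral_eq_integral_of_forall_compl_eq_zero fun β hβ => by
      rw [hFbox β hβ, zero_mul]).symm
  simp only [hbox]
  set a : (Fin k → ℤ) → ℂ := fun Y => ∫ β in rapidityBox k T, F β * zetaWave q n Y β with ha
  -- Integrating `F` against the trigonometric sum with the conjugate coefficients reproduces the
  -- sum of squares to be bounded.
  set g : (Fin k → ℝ) → ℂ := fun β => ∑ Y ∈ 𝒴, (starRingEnd ℂ) (a Y) * zetaWave q n Y β with hg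
  have hgc : Continuous g := continuous_finsetSum _ fun Y _ =>
    continuous_const.mul (continuous_zetaWave hq0 hq1 hn Y)
  have h1 : ((∑ Y ∈ 𝒴, ‖a Y‖ ^ 2 : ℝ) : ℂ) = ∫ β in rapidityBox k T, F β * g β := by
    have e : ∀ β, F β * g β = ∑ Y ∈ 𝒴, (starRingEnd ℂ) (a Y) * (F β * zetaWave q n Y β) := by
      intro β
      rw [hg, mul_sum]
      exact sum_congr rfl fun Y _ => by ring
    simp only [e]
    rw [integral_finsetSum]
    · push_cast
      refine sum_congr rfl fun Y _ => ?_
      rw [integral_const_mul, ← Complex.ofReal_pow, ← Complex.normSq_eq_norm_sq,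
        Complex.normSq_eq_conj_mul_self]
    · exact fun Y _ => (integrableOn_box T
        (hF.mul (continuous_zetaWave hq0 hq1 hn Y))).const_mul _
  have h2 : ∫ β in rapidityBox k T, ‖g β‖ ^ 2 * momentumDensity q n β =
      c₀ * ∑ Y ∈ 𝒴, ‖a Y‖ ^ 2 := by
    have := integral_norm_sq_zetaWave hq0 hq1 hn T 𝒴 fun Y => (starRingEnd ℂ) (a Y)
    simp only [RCLike.norm_conj] at this
    exact this
  -- The parameter `c₀ + 1` is positive, and with it the term in `g` contributes at most half of the
  -- sum of squares and can be absorbed.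
  have h3 : ∀ β, ‖F β * g β‖ ≤ (c₀ + 1) / (2 * κ) * C ^ 2 +
      1 / (2 * (c₀ + 1)) * (‖g β‖ ^ 2 * momentumDensity q n β) := by
    intro β
    rw [norm_mul]
    exact mul_le_weighted (by linarith) hκ (hκW β) (norm_nonneg _) (hFC β) _
  have hint : IntegrableOn (fun β => ‖g β‖ ^ 2 * momentumDensity q n β) (rapidityBox k T) :=
    integrableOn_box T ((hgc.norm.pow 2).mul (continuous_momentumDensity hq0 hq1 hn))
  have hconst : Integrable (fun _ : Fin k → ℝ => (c₀ + 1) / (2 * κ) * C ^ 2)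
      (volume.restrict (rapidityBox k T)) := integrableOn_const hvol
  have hint' : Integrable (fun β => 1 / (2 * (c₀ + 1)) * (‖g β‖ ^ 2 * momentumDensity q n β))
      (volume.restrict (rapidityBox k T)) := Integrable.const_mul hint _
  have h4 : ∑ Y ∈ 𝒴, ‖a Y‖ ^ 2 ≤ (c₀ + 1) / (2 * κ) * C ^ 2 * V +
      1 / (2 * (c₀ + 1)) * (c₀ * ∑ Y ∈ 𝒴, ‖a Y‖ ^ 2) := by
    calc ∑ Y ∈ 𝒴, ‖a Y‖ ^ 2 = ‖((∑ Y ∈ 𝒴, ‖a Y‖ ^ 2 : ℝ) : ℂ)‖ := by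
          rw [Complex.norm_real, Real.norm_of_nonneg (sum_nonneg fun _ _ => by positivity)]
      _ ≤ ∫ β in rapidityBox k T, ‖F β * g β‖ := by
          rw [h1]
          exact norm_integral_le_integral_norm _
      _ ≤ ∫ β in rapidityBox k T, ((c₀ + 1) / (2 * κ) * C ^ 2 +
          1 / (2 * (c₀ + 1)) * (‖g β‖ ^ 2 * momentumDensity q n β)) :=
          integral_mono (integrableOn_box T (hF.mul hgc).norm)
            (hconst.add hint') h3
      _ = _ := by
          rw [integral_add hconst hint', setIntegral_const, integral_const_mul, h2,
            smul_eq_mul]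
          ring
  set σ := ∑ Y ∈ 𝒴, ‖a Y‖ ^ 2
  have hσ : 0 ≤ σ := sum_nonneg fun _ _ => by positivity
  have h5 : 1 / (2 * (c₀ + 1)) * (c₀ * σ) ≤ σ / 2 := by
    rw [div_mul_eq_mul_div, one_mul, div_le_div_iff₀ (by linarith) two_pos]
    nlinarith
  have h6 : (c₀ + 1) / (2 * κ) * C ^ 2 * V = (c₀ + 1) / κ * V * C ^ 2 / 2 := by
    field_simp
  linarith

/-! ### Square summability of wave packets -/

/-- The distances between the neighbouring magnons of the bound states. -/
def stringGap {k : ℕ} (n : Fin k → ℕ) (π : Equiv.Perm (Fin (∑ i, n i)))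
    (x : Fin (∑ i, n i) → ℤ) (t : (i : Fin k) × Fin (n i - 1)) : ℕ :=
  (stringPos n π x t.1 (t.2 + 1) - stringPos n π x t.1 t.2).toNat

/-- The positions of the last magnons of the bound states. -/
def stringTop {k : ℕ} (n : Fin k → ℕ) (π : Equiv.Perm (Fin (∑ i, n i)))
    (x : Fin (∑ i, n i) → ℤ) (i : Fin k) : ℤ :=
  stringPos n π x i (n i - 1)

theorem IsStringOrdered.coe_stringGap {k : ℕ} {n : Fin k → ℕ} {π : Equiv.Perm (Fin (∑ i, n i))}
    (hπ : IsStringOrdered n π) {x : Fin (∑ i, n i) → ℤ} (hx : StrictMono x)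
    (t : (i : Fin k) × Fin (n i - 1)) :
    (stringGap n π x t : ℤ) = stringPos n π x t.1 (t.2 + 1) - stringPos n π x t.1 t.2 := by
  have h1 := t.2.isLt
  have h := hπ.stringPos_lt hx (i := t.1) (b := t.2) (by omega)
  rw [stringGap, Int.toNat_of_nonneg (by omega)]

/-- Within each bound state the positions are recovered from the last magnon downwards by
subtracting the distances. -/
theorem IsStringOrdered.eq_of_stringTop_eq {k : ℕ} {n : Fin k → ℕ}
    {π : Equiv.Perm (Fin (∑ i, n i))} (hπ : IsStringOrdered n π) {x x' : Fin (∑ i, n i) → ℤ}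
    (hx : StrictMono x) (hx' : StrictMono x') (htop : stringTop n π x = stringTop n π x')
    (hgap : stringGap n π x = stringGap n π x') : x = x' := by
  have h : ∀ i c, c < n i → stringPos n π x i (n i - 1 - c) = stringPos n π x' i (n i - 1 - c) := by
    intro i c
    induction c with
    | zero => exact fun _ => congrFun htop i
    | succ c ih =>
      intro hc
      have h0 := ih (by omega)
      have e : n i - 1 - c = n i - 1 - (c + 1) + 1 := by omega
      have h1 := hπ.coe_stringGap hx ⟨i, ⟨n i - 1 - (c + 1), by omega⟩⟩
      have h2 := hπ.coe_stringGap hx' ⟨i, ⟨n i - 1 - (c + 1), by omega⟩⟩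
      rw [hgap] at h1
      rw [e] at h0
      simp only at h1 h2
      omega
  funext l
  obtain ⟨⟨i, j⟩, hl⟩ := (finSigmaFinEquiv (n := n)).surjective (π l)
  have hj := h i (n i - 1 - j) (by omega)
  have e : n i - 1 - (n i - 1 - (j : ℕ)) = j := by omega
  rw [e, stringPos, stringPos, dif_pos j.isLt, dif_pos j.isLt, Fin.eta, hl,
    Equiv.symm_apply_apply] at hj
  exact hj

/-- Enclose the finite set in a product, bound the sum over `α` for each vector of distances, and
let the remaining sum factor into geometric series. -/
theorem sum_le_of_gap_decay {ι α : Type*} [Fintype ι] [DecidableEq ι] [DecidableEq α]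
    {A : α × (ι → ℕ) → ℝ} (hA : ∀ s, 0 ≤ A s) {K : ℝ} (hK : 0 ≤ K) {ρ : ι → ℝ}
    (h0 : ∀ t, 0 ≤ ρ t) (h1 : ∀ t, ρ t < 1)
    (h : ∀ g (𝒴 : Finset α), ∑ Y ∈ 𝒴, A (Y, g) ≤ K * ∏ t, ρ t ^ g t)
    (S : Finset (α × (ι → ℕ))) : ∑ s ∈ S, A s ≤ K * ∏ t, (1 - ρ t)⁻¹ := by
  obtain ⟨M, hM⟩ : ∃ M, ∀ s ∈ S, ∀ t, s.2 t < M := by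
    refine ⟨(S.sup fun s => univ.sup fun t => s.2 t) + 1, fun s hs t => Nat.lt_succ_of_le ?_⟩
    exact (le_sup (f := fun t => s.2 t) (mem_univ t)).trans
      (le_sup (f := fun s : α × (ι → ℕ) => univ.sup fun t => s.2 t) hs)
  calc ∑ s ∈ S, A s
      ≤ ∑ s ∈ S.image Prod.fst ×ˢ Fintype.piFinset fun _ : ι => range M, A s := by
        refine sum_le_sum_of_subset_of_nonneg (fun s hs => ?_) fun _ _ _ => hA _
        exact mem_product.2 ⟨mem_image_of_mem _ hs,
          Fintype.mem_piFinset.2 fun t => mem_range.2 (hM s hs t)⟩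
    _ = ∑ g ∈ Fintype.piFinset fun _ : ι => range M, ∑ Y ∈ S.image Prod.fst, A (Y, g) := by
        rw [sum_product_right]
    _ ≤ ∑ g ∈ Fintype.piFinset fun _ : ι => range M, K * ∏ t, ρ t ^ g t :=
        sum_le_sum fun g _ => h g _
    _ = K * ∏ t, ∑ b ∈ range M, ρ t ^ b := by rw [← mul_sum, prod_univ_sum]
    _ ≤ K * ∏ t, (1 - ρ t)⁻¹ := by
        refine mul_le_mul_of_nonneg_left (prod_le_prod
          (fun t _ => sum_nonneg fun b _ => pow_nonneg (h0 t) b) fun t _ => ?_) hK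
        rw [← tsum_geometric_of_lt_one (h0 t) (h1 t)]
        exact (summable_geometric_of_lt_one (h0 t) (h1 t)).sum_le_tsum _
          fun b _ => pow_nonneg (h0 t) b

theorem exists_eq_zero_of_notMem_rapidityBox {k : ℕ} {f : (Fin k → ℝ) → ℂ}
    (hf : HasCompactSupport f) : ∃ T : ℕ, ∀ β, β ∉ rapidityBox k T → f β = 0 := by
  obtain ⟨R, hR⟩ := hf.isBounded.exists_norm_le
  obtain ⟨T, hT⟩ := exists_nat_gt R
  refine ⟨T, fun β hβ => by_contra fun h => hβ ?_⟩
  have hβR := hR β (subset_tsupport f h)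
  have hTπ : (T : ℝ) ≤ T * Real.pi :=
    le_mul_of_one_le_right (Nat.cast_nonneg T) (by linarith [Real.pi_gt_three])
  refine Set.mem_univ_pi.2 fun i => ?_
  have h1 := abs_le.1 ((norm_le_pi_norm β i).trans hβR)
  exact ⟨by linarith [h1.1], by linarith [h1.2]⟩

/-- The amplitude of the packet, without the plane waves of the centres of the bound states. -/
def packetKernel (q : ℝ) {k : ℕ} (n : Fin k → ℕ) (f : (Fin k → ℝ) → ℂ)
    (π : Equiv.Perm (Fin (∑ i, n i))) (g : (i : Fin k) × Fin (n i - 1) → ℕ) (β : Fin k → ℝ) : ℂ :=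
  f β * ((amplitude q fun l => stringPoint q n β (π l)) *
    ∏ t : (i : Fin k) × Fin (n i - 1),
      (stringSinh q (n t.1) (β t.1) (t.2 + 1) / stringSinh q (n t.1) (β t.1) 0) ^ g t)

theorem IsTestFunction.mul_betheTerm_eq {q : ℝ} (hq0 : 0 < q) (hq1 : q < 1) {k : ℕ}
    {n : Fin k → ℕ} (hn : ∀ i, 0 < n i) {f : (Fin k → ℝ) → ℂ} (hf : IsTestFunction n f)
    {π : Equiv.Perm (Fin (∑ i, n i))} (hπ : IsStringOrdered n π) {X : Finset ℤ}
    (hX : #X = ∑ i, n i) (β : Fin k → ℝ) :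
    f β * betheTerm q (stringPoint q n β) π X =
      packetKernel q n f π (stringGap n π (X.orderEmbOfFin hX)) β *
        zetaWave q n (stringTop n π (X.orderEmbOfFin hX)) β := by
  by_cases h : f β = 0
  · simp [packetKernel, h]
  have hβ := hf.mem_of_ne_zero h
  rw [betheTerm, dif_pos hX, packetKernel, prod_stringPoint_zpow hq0 hq1 hn hβ, prod_mul_distrib]
  have e : ∏ i, ∏ b ∈ range (n i - 1), (stringSinh q (n i) (β i) (b + 1) /
        stringSinh q (n i) (β i) 0) ^ (stringPos n π (X.orderEmbOfFin hX) i (b + 1) -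
          stringPos n π (X.orderEmbOfFin hX) i b) =
      ∏ t : (i : Fin k) × Fin (n i - 1),
        (stringSinh q (n t.1) (β t.1) (t.2 + 1) / stringSinh q (n t.1) (β t.1) 0) ^
          stringGap n π (X.orderEmbOfFin hX) t := by
    rw [Fintype.prod_sigma]
    refine prod_congr rfl fun i _ => ?_
    rw [prod_range]
    refine prod_congr rfl fun b _ => ?_
    rw [← zpow_natCast, hπ.coe_stringGap (X.orderEmbOfFin hX).strictMono]
  rw [e, zetaWave]
  simp only [zeta, stringTop]
  ring

theorem IsTestFunction.continuous_packetKernel {q : ℝ} (hq0 : 0 < q) (hq1 : q < 1) {k : ℕ}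
    {n : Fin k → ℕ} {f : (Fin k → ℝ) → ℂ} (hf : IsTestFunction n f)
    (π : Equiv.Perm (Fin (∑ i, n i))) (g : (i : Fin k) × Fin (n i - 1) → ℕ) :
    Continuous (packetKernel q n f π g) := by
  refine hf.continuous_mul ((continuousOn_amplitude hq0 hq1 n π).mul
    (continuousOn_finsetProd _ fun t _ => ContinuousOn.pow (ContinuousOn.div ?_ ?_
      fun β hβ => stringSinh_ne_zero_of_mem hq0 hq1 hβ _ _) _))
  · exact ((continuous_stringSinh q _ _).comp (continuous_apply _)).continuousOn
  · exact ((continuous_stringSinh q _ _).comp (continuous_apply _)).continuousOn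

theorem IsTestFunction.exists_norm_packetKernel_le {q : ℝ} (hq0 : 0 < q) (hq1 : q < 1) {k : ℕ}
    {n : Fin k → ℕ} {f : (Fin k → ℝ) → ℂ} (hf : IsTestFunction n f)
    (π : Equiv.Perm (Fin (∑ i, n i))) : ∃ (C : ℝ) (r : Fin k → ℝ), 0 ≤ C ∧
      (∀ i, 0 ≤ r i) ∧ (∀ i, r i < 1) ∧ ∀ (g : (i : Fin k) × Fin (n i - 1) → ℕ) β,
        ‖packetKernel q n f π g β‖ ≤ C * ∏ t, r t.1 ^ g t := by
  choose r h0 h1 hr using fun i => exists_norm_stringSinh_le hq0 hq1 (n i)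
  obtain ⟨C, hC⟩ := (hf.continuous_mul
    (continuousOn_amplitude hq0 hq1 n π)).bounded_above_of_compact_support hf.compact.mul_right
  refine ⟨C, r, (norm_nonneg _).trans (hC 0), h0, h1, fun g β => ?_⟩
  rw [packetKernel, ← mul_assoc, norm_mul, norm_prod]
  refine mul_le_mul (hC β) (prod_le_prod (fun _ _ => norm_nonneg _) fun t _ => ?_)
    (prod_nonneg fun _ _ => norm_nonneg _) ((norm_nonneg _).trans (hC 0))
  rw [norm_pow]
  have := t.2.isLt
  exact pow_le_pow_left₀ (norm_nonneg _) (hr _ _ _ (by omega) (by omega)) _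

/-- A configuration is determined by the last positions and the internal distances of the bound
states. For fixed distances the integrals are coefficients of one kernel with respect to the waves
of the total momenta, so Bessel bounds their squares by the squared supremum of the kernel, which
decays geometrically in the distances. -/
theorem IsTestFunction.memℓp_integral_betheTerm {q : ℝ} (hq0 : 0 < q) (hq1 : q < 1) {k : ℕ}
    {n : Fin k → ℕ} (hn : ∀ i, 0 < n i) {f : (Fin k → ℝ) → ℂ} (hf : IsTestFunction n f)
    (π : Equiv.Perm (Fin (∑ i, n i))) :
    Memℓp (fun X : Finset ℤ => ∫ β, f β * betheTerm q (stringPoint q n β) π X) 2 := by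
  by_cases hπ : IsStringOrdered n π
  swap
  · have h : (fun X : Finset ℤ => ∫ β, f β * betheTerm q (stringPoint q n β) π X) = 0 := by
      funext X
      refine integral_eq_zero_of_ae (Eventually.of_forall fun β => ?_)
      by_cases h : f β = 0
      · simp [h]
      · simp [betheTerm, amplitude_eq_zero hq0 hq1 (hf.mem_of_ne_zero h) hπ]
    rw [h]
    exact zero_memℓp
  obtain ⟨C, r, hC, h0, h1, hr⟩ := hf.exists_norm_packetKernel_le hq0 hq1 π
  obtain ⟨T, hT⟩ := exists_eq_zero_of_notMem_rapidityBox hf.compact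
  obtain ⟨K, hK, hbessel⟩ := exists_bessel hq0 hq1 hn T
  set A : (Fin k → ℤ) × ((i : Fin k) × Fin (n i - 1) → ℕ) → ℝ := fun s =>
    ‖∫ β, packetKernel q n f π s.2 β * zetaWave q n s.1 β‖ ^ 2 with hA
  have hsum := sum_le_of_gap_decay (A := A) (fun s => by positivity) (K := K * C ^ 2)
    (by positivity) (ρ := fun t => r t.1 ^ 2) (fun t => sq_nonneg _)
    (fun t => pow_lt_one₀ (h0 _) (h1 _) two_ne_zero) fun g 𝒴 => by
      refine (hbessel _ _ (hf.continuous_packetKernel hq0 hq1 π g)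
        (fun β hβ => by rw [packetKernel, hT β hβ, zero_mul]) (hr g) 𝒴).trans (le_of_eq ?_)
      rw [mul_pow, ← prod_pow, mul_assoc]
      simp only [← pow_mul, mul_comm]
  refine memℓp_gen' (C := K * C ^ 2 * ∏ t : (i : Fin k) × Fin (n i - 1), (1 - r t.1 ^ 2)⁻¹)
    fun S => ?_
  simp only [ENNReal.toReal_ofNat, Real.rpow_ofNat]
  set label : {X : Finset ℤ // #X = ∑ i, n i} →
      (Fin k → ℤ) × ((i : Fin k) × Fin (n i - 1) → ℕ) := fun X =>
    (stringTop n π (X.1.orderEmbOfFin X.2), stringGap n π (X.1.orderEmbOfFin X.2)) with hlabel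
  have hinj : Function.Injective label := by
    rintro ⟨X, hX⟩ ⟨X', hX'⟩ h
    have hx := hπ.eq_of_stringTop_eq (X.orderEmbOfFin hX).strictMono
      (X'.orderEmbOfFin hX').strictMono (Prod.ext_iff.1 h).1 (Prod.ext_iff.1 h).2
    refine Subtype.ext (coe_injective ?_)
    rw [← range_orderEmbOfFin X hX, ← range_orderEmbOfFin X' hX', hx]
  calc ∑ X ∈ S, ‖∫ β, f β * betheTerm q (stringPoint q n β) π X‖ ^ 2
      = ∑ X ∈ S with #X = ∑ i, n i, ‖∫ β, f β * betheTerm q (stringPoint q n β) π X‖ ^ 2 := by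
        refine (sum_filter_of_ne fun X _ h => by_contra fun hX => h ?_).symm
        simp [betheTerm, dif_neg hX]
    _ = ∑ X ∈ S.subtype fun X => #X = ∑ i, n i,
        ‖∫ β, f β * betheTerm q (stringPoint q n β) π X‖ ^ 2 :=
        (sum_subtype_eq_sum_filter _).symm
    _ = ∑ X ∈ S.subtype fun X => #X = ∑ i, n i, A (label X) := by
        refine sum_congr rfl fun X _ => ?_
        simp only [hf.mul_betheTerm_eq hq0 hq1 hn hπ X.2, hA, hlabel]
    _ = ∑ s ∈ (S.subtype fun X => #X = ∑ i, n i).map ⟨label, hinj⟩, A s :=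
        (sum_map _ ⟨label, hinj⟩ A).symm
    _ ≤ _ := hsum _

theorem IsTestFunction.memℓp_bethePacket {q : ℝ} (hq0 : 0 < q) (hq1 : q < 1) {k : ℕ}
    {n : Fin k → ℕ} (hn : ∀ i, 0 < n i) {f : (Fin k → ℝ) → ℂ} (hf : IsTestFunction n f) :
    Memℓp (bethePacket q n f) 2 := by
  have h : bethePacket q n f = ∑ π : Equiv.Perm (Fin (∑ i, n i)),
      ((Equiv.Perm.sign π : ℤˣ) : ℂ) • fun X : Finset ℤ =>
        ∫ β, f β * betheTerm q (stringPoint q n β) π X := by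
    funext X
    rw [bethePacket, Finset.sum_apply]
    simp only [betheState_eq_sum, mul_sum]
    rw [integral_finsetSum]
    · refine sum_congr rfl fun π _ => ?_
      rw [Pi.smul_apply, smul_eq_mul, ← integral_const_mul]
      exact integral_congr_ae (Eventually.of_forall fun β => mul_left_comm _ _ _)
    · exact fun π _ => hf.integrable_mul
        (continuousOn_const.mul (continuousOn_betheTerm hq0 hq1 n π X))
  rw [h]
  have := Memℓp.finsetSum (p := 2) univ (f := fun π : Equiv.Perm (Fin (∑ i, n i)) =>
    ((Equiv.Perm.sign π : ℤˣ) : ℂ) • fun X : Finset ℤ =>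
        ∫ β, f β * betheTerm q (stringPoint q n β) π X)
    fun π _ => (hf.memℓp_integral_betheTerm hq0 hq1 hn π).const_smul _
  convert this using 1
  funext X
  simp

end XXZ

end

theorem mainTheorem3 (q : ℝ) (hq0 : 0 < q) (hq1 : q < 1) :
    -- finite chain: scalar products of descendants of Bethe vectors
    (∀ (N m m' p p' : ℕ) (z' : Fin m' → ℂ) (z : Fin m → ℂ),
      XXZ.IsBetheSolution q N z' → XXZ.IsBetheSolution q N z →
      inner ℂ (XXZ.finiteDescendant q N p' z') (XXZ.finiteDescendant q N p z) =
        if p = p' then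
          ((q ^ (2 * p ^ 2) / XXZ.qFactorial (q ^ 2) p : ℝ) : ℂ) *
            inner ℂ (XXZ.finiteBethe q N z') (XXZ.kacOp q N p (XXZ.finiteBethe q N z))
        else 0) ∧
    -- half filling
    (∀ (m m' p p' : ℕ) (z' : Fin m' → ℂ) (z : Fin m → ℂ),
      XXZ.IsBetheSolution q (2 * (p + m)) z' → XXZ.IsBetheSolution q (2 * (p + m)) z →
      inner ℂ (XXZ.finiteDescendant q (2 * (p + m)) p z')
          (XXZ.finiteDescendant q (2 * (p + m)) p' z) =
        if p = p' then
          inner ℂ (XXZ.finiteBethe q (2 * (p + m)) z') (XXZ.finiteBethe q (2 * (p + m)) z) *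
            ((XXZ.qBinom (q ^ 2) (2 * p) p : ℝ) : ℂ)
        else 0) ∧
    -- the limit of the factor
    Multipliable (fun k : ℕ => 1 / (1 - q ^ (2 * (k + 1)))) ∧
    Filter.Tendsto (fun p : ℕ => XXZ.qBinom (q ^ 2) (2 * p) p) Filter.atTop
      (nhds (∏' k : ℕ, 1 / (1 - q ^ (2 * (k + 1))))) ∧
    -- wave packets are normalizable
    (∀ (k : ℕ) (n : Fin k → ℕ) (f : (Fin k → ℝ) → ℂ), (∀ i, 0 < n i) → XXZ.IsTestFunction n f →
      (∀ X : Finset ℤ, MeasureTheory.Integrable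
        (fun β : Fin k → ℝ => f β * XXZ.betheState q (XXZ.stringPoint q n β) X)) ∧
      (∀ δ : YoungDiagram, MeasureTheory.Integrable
        (fun β : Fin k → ℝ => f β * XXZ.dwState q (XXZ.stringPoint q n β) δ)) ∧
      Memℓp (XXZ.bethePacket q n f) 2 ∧ Memℓp (XXZ.dwPacket q n f) 2) ∧
    -- scalar products over the domain wall vacuum and over the ferromagnetic vacuum
    (∀ (k k' : ℕ) (n : Fin k → ℕ) (n' : Fin k' → ℕ)
      (f : (Fin k → ℝ) → ℂ) (f' : (Fin k' → ℝ) → ℂ),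
      (∀ i, 0 < n i) → (∀ i, 0 < n' i) → XXZ.IsTestFunction n f → XXZ.IsTestFunction n' f' →
      ∑' δ : YoungDiagram,
          (starRingEnd ℂ) (XXZ.dwPacket q n' f' δ) * XXZ.dwPacket q n f δ =
        (∑' X : Finset ℤ,
          (starRingEnd ℂ) (XXZ.bethePacket q n' f' X) * XXZ.bethePacket q n f X) *
          ((∏' k : ℕ, 1 / (1 - q ^ (2 * (k + 1))) : ℝ) : ℂ)) := by
  refine ⟨?_, ?_, XXZ.multipliable_factor hq0 hq1, XXZ.tendsto_qBinom hq0 hq1, ?_, ?_⟩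
  · intro N m m' p p' z' z hz' hz
    exact XXZ.inner_descendant hq0 hq1 (XXZ.inSector_finiteBethe q N z)
      (XXZ.opE_finiteBethe hq0 hq1 hz) (XXZ.inSector_finiteBethe q N z')
      (XXZ.opE_finiteBethe hq0 hq1 hz') p p'
  · intro m m' p p' z' z hz' hz
    split_ifs with hp
    · subst hp
      exact XXZ.inner_descendant_half hq0 hq1 (XXZ.inSector_finiteBethe q _ z)
        (XXZ.opE_finiteBethe hq0 hq1 hz) (XXZ.inSector_finiteBethe q _ z')
        (XXZ.opE_finiteBethe hq0 hq1 hz')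
    -- For `p ≠ p'` the general formula, valid for every length, already gives zero.
    · exact (XXZ.inner_descendant hq0 hq1 (XXZ.inSector_finiteBethe q _ z)
        (XXZ.opE_finiteBethe hq0 hq1 hz) (XXZ.inSector_finiteBethe q _ z')
        (XXZ.opE_finiteBethe hq0 hq1 hz') p' p).trans (if_neg (Ne.symm hp))
  · intro k n f hn hf
    refine ⟨hf.integrable_betheState hq0 hq1, hf.integrable_dwState hq0 hq1 hn,
      hf.memℓp_bethePacket hq0 hq1 hn, ?_⟩
    rw [hf.dwPacket_eq hq0 hq1 hn]
    exact XXZ.memℓp_dwTransform hq0 hq1 ⟨_, hf.memℓp_bethePacket hq0 hq1 hn⟩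
      fun X => XXZ.bethePacket_eq_zero q n f
  · intro k k' n n' f f' hn hn' hf hf'
    rw [hf.dwPacket_eq hq0 hq1 hn, hf'.dwPacket_eq hq0 hq1 hn']
    exact XXZ.tsum_dwTransform hq0 hq1 ⟨_, hf.memℓp_bethePacket hq0 hq1 hn⟩
      ⟨_, hf'.memℓp_bethePacket hq0 hq1 hn'⟩ (fun X => XXZ.bethePacket_eq_zero q n f)
      fun X => XXZ.bethePacket_eq_zero q n' f'
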